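/- **Theorem.** For $d\ge 1$ let $\mathbb S^d_+=\{x\in\mathbb R^{d+1}: |x|=1,\ x_{d+1}\ge 0\}$ be the closed unit hemisphere with the round metric, and let $0<\lambda_1\le\lambda_2\le\cdots$ be the eigenvalues, repeated according to their (finite) multiplicity, of $-\Delta$ on $\mathbb S^d_+$ with Dirichlet boundary conditions on the equator $x_{d+1}=0$. The spectral zeta function $\zeta_{\mathbb S^d_+}(s)=\sum_{k\ge1}\lambda_k^{-s}$ converges absolutely on some right half-plane and continues to a meromorphic function on $\mathbb C$ that is analytic at $s=0$; put $\det(\mathbb S^d_+)=\exp\bigl(-\zeta_{\mathbb S^d_+}'(0)\bigr)$. Define $s(m,k)$ (Stirling numbers of the first kind) and $t(m,k)$ (central factorial numbers of the first kind) by $$x(x-1)\cdots(x-m+1)=\sum_{k=0}^m s(m,k)x^k,\qquad x\prod_{j=1}^{m-1}\Bigl(x+\frac m2-j\Bigr)=\sum_{k=0}^m t(m,k)x^k$$ (for $m=0$ both left-hand sides are $1$; coefficients with $k>m$ are $0$), and put $$\bar u(n,k)=\frac{2}{(2n)!}\,t(2n,2k),\qquad \bar v(n,k)=\frac{4^{-(n-1)}}{(2n-1)!}\,4^{n-k}\,t(2n-1,2k-1),\qquad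 H_m=\sum_{j=1}^m\frac1j .$$ Let $\zeta$ be the Riemann zeta function. Then for every integer $n\ge1$ $$-\log\det(\mathbb S^{2n-1}_+)=\zeta_{\mathbb S^{2n-1}_+}'(0)=\frac1{(2n-2)!}\sum_{k=0}^{2n-1}\zeta'(-k)\bigl[s(2n-1,k+1)+(-1)^k s(2n-2,k)\bigr]-\sum_{i=1}^{n-1}\bar u(n-1,i)\frac{(n-1)^{2i+1}}{2i}\Bigl(\frac{H_{i-1}}2-H_{2i-1}\Bigr),$$ $$-\log\det(\mathbb S^{2n}_+)=\zeta_{\mathbb S^{2n}_+}'(0)=\frac1{(2n-1)!}\sum_{k=0}^{2n-1}\zeta'(-k)\bigl[s(2n,k+1)+(-1)^{k+1}s(2n-1,k)\bigr]+\sum_{i=1}^{n}\bar v(n,i)\frac{(2n-1)^{2i}}{4i}\Bigl(\frac{H_{i-1}}2-H_{2i-1}\Bigr).$$ -/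

import Mathlib

open scoped ContDiff Laplacian

noncomputable section

namespace Hemisphere

/-! ### The hemisphere and its Dirichlet Laplacian -/

/-- The closed hemisphere of dimension `d`: the points of the unit sphere of `ℝ^(d+1)` whose last
coordinate is nonnegative. Its boundary is the equator, where the last coordinate vanishes. -/
def closedHemisphere (d : ℕ) : Set (EuclideanSpace ℝ (Fin (d + 1))) :=
  {x | ‖x‖ = 1 ∧ 0 ≤ x (Fin.last d)}

/-- The cone over the closed hemisphere: the closed upper half-space without the origin. -/
def closedCone (d : ℕ) : Set (EuclideanSpace ℝ (Fin (d + 1))) :=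
  {y | y ≠ 0 ∧ 0 ≤ y (Fin.last d)}

theorem normalize_mem {d : ℕ} {y : EuclideanSpace ℝ (Fin (d + 1))} (hy : y ∈ closedCone d) :
    ‖y‖⁻¹ • y ∈ closedHemisphere d := by
  refine ⟨?_, ?_⟩
  · rw [norm_smul, norm_inv, norm_norm]
    exact inv_mul_cancel₀ (norm_ne_zero_iff.mpr hy.1)
  · have : (‖y‖⁻¹ • y) (Fin.last d) = ‖y‖⁻¹ * y (Fin.last d) := rfl
    rw [this]
    exact mul_nonneg (inv_nonneg.mpr (norm_nonneg _)) hy.2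

open Classical in
/-- The extension `y ↦ u (y / |y|)` of a function on the closed hemisphere, homogeneous of
degree zero on the cone (and `0` outside the cone, a value that is never used). -/
def homExt {d : ℕ} (u : closedHemisphere d → ℝ) (y : EuclideanSpace ℝ (Fin (d + 1))) : ℝ :=
  if hy : y ∈ closedCone d then u ⟨‖y‖⁻¹ • y, normalize_mem hy⟩ else 0

theorem homExt_zero {d : ℕ} : homExt (0 : closedHemisphere d → ℝ) = 0 := by
  funext y
  by_cases hy : y ∈ closedCone d <;> simp [homExt, hy]

theorem homExt_add {d : ℕ} (u v : closedHemisphere d → ℝ) :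
    homExt (u + v) = homExt u + homExt v := by
  funext y
  by_cases hy : y ∈ closedCone d <;> simp [homExt, hy]

theorem homExt_smul {d : ℕ} (c : ℝ) (u : closedHemisphere d → ℝ) :
    homExt (c • u) = c • homExt u := by
  funext y
  by_cases hy : y ∈ closedCone d <;> simp [homExt, hy]

/-- `u` is smooth on the closed hemisphere, up to and including the boundary. -/
def IsSmooth {d : ℕ} (u : closedHemisphere d → ℝ) : Prop :=
  ContDiffOn ℝ ∞ (homExt u) (closedCone d)

/-- The Laplace-Beltrami operator of the round metric (with the sign for which it is
nonpositive), at points of the open hemisphere: the Euclidean Laplacian of the extension that is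
constant along rays, evaluated on the sphere. -/
def laplaceBeltrami {d : ℕ} (u : closedHemisphere d → ℝ) (x : closedHemisphere d) : ℝ :=
  (Δ (homExt u)) (x : EuclideanSpace ℝ (Fin (d + 1)))

theorem IsSmooth.contDiffAt {d : ℕ} {u : closedHemisphere d → ℝ} (hu : IsSmooth u)
    (x : closedHemisphere d) (hx : 0 < x.1 (Fin.last d)) :
    ContDiffAt ℝ 2 (homExt u) x.1 := by
  refine (ContDiffOn.contDiffAt (s := closedCone d) hu ?_).of_le (WithTop.coe_le_coe.mpr (le_top : (2 : ℕ∞) ≤ ⊤))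
  have hopen : IsOpen {y : EuclideanSpace ℝ (Fin (d + 1)) | 0 < y (Fin.last d)} :=
    isOpen_lt continuous_const (by fun_prop)
  refine Filter.mem_of_superset (hopen.mem_nhds hx) ?_
  intro y hy
  have hy' : 0 < y (Fin.last d) := hy
  refine ⟨?_, hy'.le⟩
  rintro rfl
  simp at hy'

/-- The Dirichlet eigenspace for `l`: the smooth functions on the closed hemisphere that vanish
on the equator and satisfy `-Δ u = l u` in the interior. -/
def dirichletEigenspace (d : ℕ) (l : ℝ) : Submodule ℝ (closedHemisphere d → ℝ) where
  carrier := {u | IsSmooth u ∧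
    (∀ x : closedHemisphere d, x.1 (Fin.last d) = 0 → u x = 0) ∧
    (∀ x : closedHemisphere d, 0 < x.1 (Fin.last d) → -laplaceBeltrami u x = l * u x)}
  zero_mem' := by
    refine ⟨?_, fun _ _ => rfl, fun x _ => ?_⟩
    · rw [IsSmooth, homExt_zero]
      exact contDiffOn_const
    · rw [laplaceBeltrami, homExt_zero]
      have h := InnerProductSpace.laplacian_const (F := ℝ) (c := (0 : ℝ))
        (E := EuclideanSpace ℝ (Fin (d + 1)))
      have h' := congrFun h x.1
      have h0 : (Δ (0 : EuclideanSpace ℝ (Fin (d + 1)) → ℝ)) x.1 = 0 := h'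
      rw [h0]
      simp
  add_mem' := by
    rintro u v ⟨hu, hu0, hul⟩ ⟨hv, hv0, hvl⟩
    refine ⟨?_, fun x hx => ?_, fun x hx => ?_⟩
    · rw [IsSmooth, homExt_add]
      exact ContDiffOn.add hu hv
    · simp [hu0 x hx, hv0 x hx]
    · have h1 := hul x hx
      have h2 := hvl x hx
      rw [laplaceBeltrami] at h1 h2 ⊢
      rw [homExt_add, (hu.contDiffAt x hx).laplacian_add (hv.contDiffAt x hx)]
      simp only [Pi.add_apply]
      linarith
  smul_mem' := by
    rintro c u ⟨hu, hu0, hul⟩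
    refine ⟨?_, fun x hx => ?_, fun x hx => ?_⟩
    · rw [IsSmooth, homExt_smul]
      exact ContDiffOn.const_smul c hu
    · simp [hu0 x hx]
    · have h1 := hul x hx
      rw [laplaceBeltrami] at h1 ⊢
      rw [homExt_smul, InnerProductSpace.laplacian_smul c (hu.contDiffAt x hx)]
      simp only [Pi.smul_apply, smul_eq_mul]
      linear_combination c * h1

/-! ### Spectral zeta function and determinant -/

/-- `Z` is the spectral zeta function of the Dirichlet Laplacian on the `d`-dimensional
hemisphere: the eigenspaces are finite-dimensional, on some right half-plane the series of
`l ^ (-s)` over the eigenvalues `l`, counted with multiplicity, converges absolutely with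
sum `Z s`, and `Z` is meromorphic on the whole plane and analytic at the origin.
(A real number that is not an eigenvalue contributes zero to the sum.) -/
structure IsSpectralZeta (d : ℕ) (Z : ℂ → ℂ) : Prop where
  finite_multiplicity : ∀ l : ℝ, FiniteDimensional ℝ (dirichletEigenspace d l)
  hasSum : ∃ μ : ℝ, ∀ s : ℂ, μ < s.re →
    HasSum (fun l : ℝ => (Module.finrank ℝ (dirichletEigenspace d l) : ℂ) * (l : ℂ) ^ (-s)) (Z s)
  meromorphic : Meromorphic Z
  analyticAt_zero : AnalyticAt ℂ Z 0

open Classical in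
/-- The spectral zeta function (meromorphically continued); its germ at `0` does not depend on
the choice, by the identity theorem. -/
def spectralZeta (d : ℕ) : ℂ → ℂ :=
  if h : ∃ Z, IsSpectralZeta d Z then h.choose else 0

/-- The zeta-regularized determinant of the Dirichlet Laplacian on the `d`-dimensional
hemisphere. -/
def spectralDet (d : ℕ) : ℂ := Complex.exp (-deriv (spectralZeta d) 0)

/-! ### Stirling and central factorial numbers -/

/-- Signed Stirling numbers of the first kind: `x (x - 1) ⋯ (x - n + 1) = ∑ k, s(n, k) x ^ k`. -/
def stirlingS (n k : ℕ) : ℤ := (descPochhammer ℤ n).coeff k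

/-- The central factorial polynomial `x (x + n/2 - 1) (x + n/2 - 2) ⋯ (x - n/2 + 1)` of
degree `n`, which is `1` for `n = 0`. -/
def centralFactorialPoly (n : ℕ) : Polynomial ℚ :=
  if n = 0 then 1
  else Polynomial.X *
    ∏ j ∈ Finset.Icc 1 (n - 1), (Polynomial.X + Polynomial.C ((n : ℚ) / 2 - (j : ℚ)))

/-- Central factorial numbers of the first kind. -/
def centralT (n k : ℕ) : ℚ := (centralFactorialPoly n).coeff k

/-- Central factorial numbers with even indices. -/
def centralU (n k : ℕ) : ℚ := centralT (2 * n) (2 * k)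

/-- Central factorial numbers with odd indices (for `n, k ≥ 1`). -/
def centralV (n k : ℕ) : ℚ := 4 ^ ((n : ℤ) - (k : ℤ)) * centralT (2 * n - 1) (2 * k - 1)

/-- Normalized central factorial numbers with even indices. -/
def uBar (n k : ℕ) : ℚ := 2 / ((2 * n).factorial : ℚ) * centralU n k

/-- Normalized central factorial numbers with odd indices (for `n, k ≥ 1`). -/
def vBar (n k : ℕ) : ℚ := 1 / (4 ^ (n - 1) * ((2 * n - 1).factorial : ℚ)) * centralV n k

end Hemisphere

end

/-!
The proof computes the Dirichlet spectrum of the hemisphere `S^d_+`, `d = c + 1`, and then the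
regularized value of the resulting Dirichlet series.

**The spectrum.** A homogeneous harmonic polynomial of degree `k` in `d + 1` variables that vanishes
where the last coordinate does restricts to a Dirichlet eigenfunction for `k (k + d - 1)`
(`polyRestrict_mem_dirichletEigenspace`). Such a polynomial is determined by its normal derivative
on the hyperplane, an arbitrary homogeneous polynomial of degree `k - 1` in `d` variables, so these
polynomials form a space of dimension `(k + c - 1 choose c)` (`finrank_dirichletHarmonics`). There
are no other eigenfunctions. Eigenfunctions for different eigenvalues are orthogonal for the
integral over the hemisphere (`integral_meanDensity_mul_eq_zero`). This is Green's identity; it is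
obtained from the divergence theorem on a Euclidean box, applied to the extensions that are constant
along rays, times a radial cut-off supported in a half-shell inside the box. The cut-off does not
disturb the identity because the radial derivatives of the extensions vanish. Completeness
(`eq_zero_of_orthogonal_harmonics`) holds because on the sphere the product of a horizontal
coordinate and a harmonic polynomial is again a sum of harmonic polynomials, and because the
horizontal coordinates separate the points of the hemisphere. Together these give
`finrank_dirichletEigenspace` and `dirichletEigenspace_eq_bot`: the eigenvalues are `k (k + c)`,
`k ≥ 1`, with multiplicities `Q(k) = k (k + 1) ⋯ (k + c - 1) / c!`.

**The zeta function.** Consider `∑ Q(k) k ^ (-τ s) (k + c) ^ (-s)` for `τ = 0, 1`. Expanding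
`(1 + c / k) ^ (-s)` in a binomial series to sufficiently many terms writes both as combinations of
shifted Riemann zeta functions, up to a remainder series that converges on a given ball, and so
continues them (`zetaExt`). At the
origin the remainders have the same derivative for `τ = 0` and `τ = 1`, so the difference of the two
derivatives is a finite sum: the values `ζ'(-i)` that come from the leading term, and a term
from the pole of `ζ` meeting a zero of a binomial coefficient (`deriv_zetaContReg_sub`). The series
for `τ = 0` is itself a combination of shifted zeta functions, as `Q(m - c)` vanishes for
`m = 1, …, c`. The coefficients of `Q(x)` and `Q(x - c)` are Stirling numbers, which gives the first
sum of the formula (`exists_zeta_of_multiplicity`).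

**The pole term.** It is linear in `Q`. In the variable `x = k + c / 2`, the symmetry point of the
spectrum, the monomial `x ^ m` contributes an alternating sum of binomial coefficients times
harmonic numbers, which vanishes for even `m` and is explicit for odd `m`
(`sum_choose_mul_poleWeight`, `binomHarmonicShiftSum_eq`). In this variable `Q` is
`(x - c / 2) / c!` times the quotient of the central factorial polynomial by `x`. That quotient is
even or odd, so up to constant factors the odd coefficients of `Q` are central factorial numbers
(`poleTerm_odd_dim`, `poleTerm_even_dim`).
-/

namespace Hemisphere
open Filter Topology Finset

/-! ### The binomial series with remainder -/

/-- The binomial coefficient `(-s choose j)`, the `j`-th Taylor coefficient of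
`z ↦ (1 + z) ^ (-s)` at `0`. -/
noncomputable def negBinom (j : ℕ) (s : ℂ) : ℂ := (∏ i ∈ range j, (-s - i)) / (j.factorial : ℂ)

/-- The remainder of the binomial series of `(1 + z) ^ (-s)` after `n` terms. -/
noncomputable def negBinomRem (n : ℕ) (s : ℂ) (z : ℝ) : ℂ :=
  ((1 + z : ℝ) : ℂ) ^ (-s) - ∑ j ∈ range n, negBinom j s * (z : ℂ) ^ j

theorem succ_mul_negBinom_succ (j : ℕ) (s : ℂ) :
    ((j : ℂ) + 1) * negBinom (j + 1) s = -s * negBinom j (s + 1) := by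
  have h1 : ((j : ℂ) + 1) ≠ 0 := Nat.cast_add_one_ne_zero j
  have h2 : (j.factorial : ℂ) ≠ 0 := Nat.cast_ne_zero.mpr j.factorial_ne_zero
  rw [negBinom, negBinom, prod_range_succ', Nat.factorial_succ]
  have h3 : ∀ i ∈ range j, (-s - ((i + 1 : ℕ) : ℂ)) = (-(s + 1) - (i : ℂ)) := by
    intro i _; push_cast; ring
  rw [prod_congr rfl h3]
  push_cast
  field_simp
  ring

theorem negBinomRem_succ (n : ℕ) (s : ℂ) (z : ℝ) :
    negBinomRem n s z = negBinomRem (n + 1) s z + negBinom n s * (z : ℂ) ^ n := by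
  simp only [negBinomRem, sum_range_succ]; ring

theorem differentiable_negBinom (j : ℕ) : Differentiable ℂ (negBinom j) := by
  unfold negBinom
  fun_prop

theorem differentiable_negBinomRem (n : ℕ) {z : ℝ} (hz : 0 ≤ z) :
    Differentiable ℂ fun s ↦ negBinomRem n s z := by
  have h : ((1 + z : ℝ) : ℂ) ≠ 0 := Complex.ofReal_ne_zero.mpr (by positivity)
  have hb := differentiable_negBinom
  unfold negBinomRem
  refine Differentiable.sub ?_ ?_
  · exact fun s ↦ (differentiableAt_id.neg).const_cpow (Or.inl h)
  · fun_prop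

theorem negBinom_at_zero (j : ℕ) : negBinom j 0 = if j = 0 then 1 else 0 := by
  rcases j with _ | j
  · simp [negBinom]
  · simp [negBinom, prod_range_succ']

theorem negBinomRem_at_zero {n : ℕ} (hn : 1 ≤ n) (z : ℝ) : negBinomRem n 0 z = 0 := by
  rw [negBinomRem, sum_eq_single_of_mem 0 (by simp; omega)]
  · simp [negBinom_at_zero]
  · intro j _ hj; simp [negBinom_at_zero, hj]

theorem hasDerivAt_negBinomRem (n : ℕ) (s : ℂ) {z : ℝ} (hz : 0 ≤ z) :
    HasDerivAt (negBinomRem (n + 1) s) (-s * negBinomRem n (s + 1) z) z := by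
  have hmem : (1 + (z : ℂ)) ∈ Complex.slitPlane := by
    have : ((1 + z : ℝ) : ℂ) ∈ Complex.slitPlane :=
      Complex.ofReal_mem_slitPlane.mpr (by positivity)
    simpa using this
  have h2 : HasDerivAt (fun x : ℝ ↦ ((1 + x : ℝ) : ℂ) ^ (-s))
      (-s * ((1 + z : ℝ) : ℂ) ^ (-s - 1) * 1) z := by
    have := (((hasDerivAt_id (z : ℂ)).const_add 1).cpow_const (c := -s) hmem).comp_ofReal
    simpa using this
  have h3 : HasDerivAt (fun x : ℝ ↦ ∑ j ∈ range (n + 1), negBinom j s * (x : ℂ) ^ j)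
      (∑ j ∈ range (n + 1), negBinom j s * ((j : ℂ) * (z : ℂ) ^ (j - 1))) z := by
    refine HasDerivAt.fun_sum fun j _ ↦ ?_
    have h4 := ((hasDerivAt_id (z : ℂ)).pow j).comp_ofReal
    have h5 : HasDerivAt (fun x : ℝ ↦ (x : ℂ) ^ j) ((j : ℂ) * (z : ℂ) ^ (j - 1)) z := by
      simpa using h4
    exact h5.const_mul _
  refine (h2.sub h3).congr_deriv ?_
  rw [sum_range_succ', negBinomRem, mul_sub, mul_sum]
  have h6 : -s - 1 = -(s + 1) := by ring
  rw [h6, mul_one]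
  congr 1
  simp only [Nat.cast_zero, zero_mul, mul_zero, add_zero]
  refine sum_congr rfl fun j _ ↦ ?_
  have := succ_mul_negBinom_succ j s
  push_cast
  linear_combination (z : ℂ) ^ j * this

/-- The Taylor estimate for the binomial series on the half-line `0 ≤ z`. -/
theorem norm_negBinomRem_le (n : ℕ) : ∀ (s : ℂ), 0 ≤ s.re + n → ∀ z : ℝ, 0 ≤ z →
    ‖negBinomRem n s z‖ ≤ (∏ i ∈ range n, ‖s + i‖) * z ^ n := by
  induction n with
  | zero =>
    intro s hs z hz
    have h1 : 0 < 1 + z := by positivity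
    simp only [negBinomRem, range_zero, sum_empty, sub_zero, prod_empty, pow_zero, mul_one]
    rw [Complex.norm_cpow_eq_rpow_re_of_pos h1]
    refine Real.rpow_le_one_of_one_le_of_nonpos (by linarith) ?_
    simp at hs ⊢; exact hs
  | succ n ih =>
    intro s hs z hz
    have hs' : 0 ≤ (s + 1).re + n := by simp at hs ⊢; linarith
    have h0 : negBinomRem (n + 1) s 0 = 0 := by
      rw [negBinomRem, sum_eq_single_of_mem 0 (by simp)]
      · simp [negBinom]
      · intro j _ hj; simp [hj]
    have key := (convex_Icc (0 : ℝ) z).norm_image_sub_le_of_norm_hasDerivWithin_le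
      (f := negBinomRem (n + 1) s) (f' := fun x ↦ -s * negBinomRem n (s + 1) x)
      (C := ‖s‖ * ((∏ i ∈ range n, ‖s + 1 + i‖) * z ^ n)) (x := 0) (y := z)
      (fun x hx ↦ (hasDerivAt_negBinomRem n s hx.1).hasDerivWithinAt)
      (fun x hx ↦ by
        rw [norm_mul, norm_neg]
        refine mul_le_mul_of_nonneg_left ((ih (s + 1) hs' x hx.1).trans ?_) (norm_nonneg s)
        refine mul_le_mul_of_nonneg_left (pow_le_pow_left₀ hx.1 hx.2 n) ?_
        exact prod_nonneg fun _ _ ↦ norm_nonneg _)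
      (Set.left_mem_Icc.mpr hz) (Set.right_mem_Icc.mpr hz)
    rw [h0, sub_zero, sub_zero, Real.norm_of_nonneg hz] at key
    refine key.trans (le_of_eq ?_)
    rw [prod_range_succ']
    have h3 : ∀ i ∈ range n, ‖s + ((i + 1 : ℕ) : ℂ)‖ = ‖s + 1 + (i : ℂ)‖ := by
      intro i _; congr 1; push_cast; ring
    rw [prod_congr rfl h3]
    simp only [Nat.cast_zero, add_zero]
    ring

end Hemisphere

namespace Hemisphere
open Filter Topology Finset Polynomial

/-! ### The zeta function of a perturbed arithmetic progression -/

/-- The `k`-th term (`k ≥ 0`, standing for the integer `k + 1`) of the Dirichlet series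
`∑ Q(m) m ^ (-τ s) (m + c) ^ (-s)` over `m ≥ 1`. -/
noncomputable def zetaTerm (Q : ℂ[X]) (c τ k : ℕ) (s : ℂ) : ℂ :=
  Q.eval (((k + 1 : ℕ) : ℂ)) * ((k + 1 : ℕ) : ℂ) ^ (-((τ : ℂ) * s)) *
    ((k + 1 + c : ℕ) : ℂ) ^ (-s)

/-- The part of `zetaTerm` left after removing `n` terms of its expansion in powers of
`c / (k + 1)`. -/
noncomputable def remTerm (Q : ℂ[X]) (c τ n k : ℕ) (s : ℂ) : ℂ :=
  Q.eval (((k + 1 : ℕ) : ℂ)) * ((k + 1 : ℕ) : ℂ) ^ (-(((τ : ℂ) + 1) * s)) *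
    negBinomRem n s ((c : ℝ) / (k + 1 : ℕ))

/-- The continuation of `∑ zetaTerm` obtained by expanding `n` terms in Riemann zeta
functions. -/
noncomputable def zetaCont (Q : ℂ[X]) (c τ n : ℕ) (s : ℂ) : ℂ :=
  (∑ j ∈ range n, ∑ i ∈ range (Q.natDegree + 1),
    Q.coeff i * (c : ℂ) ^ j * (negBinom j s * riemannZeta (((τ : ℂ) + 1) * s + j - i))) +
  ∑' k, remTerm Q c τ n k s

theorem remTerm_zero (Q : ℂ[X]) (c τ k : ℕ) (s : ℂ) :
    remTerm Q c τ 0 k s = zetaTerm Q c τ k s := by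
  have h1 : ((k + 1 : ℕ) : ℝ) ≠ 0 := by positivity
  have h2 : ((k + 1 : ℕ) : ℂ) ≠ 0 := by exact_mod_cast h1
  have h3 : ((k + 1 + c : ℕ) : ℂ) = (((k + 1 : ℕ) : ℝ) : ℂ) *
      (((1 + (c : ℝ) / (k + 1 : ℕ)) : ℝ) : ℂ) := by
    have : ((k + 1 + c : ℕ) : ℝ) = ((k + 1 : ℕ) : ℝ) * (1 + (c : ℝ) / (k + 1 : ℕ)) := by
      field_simp; push_cast; ring
    rw [← Complex.ofReal_mul, ← this]; simp
  rw [remTerm, zetaTerm, negBinomRem, range_zero, sum_empty, sub_zero, h3,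
    Complex.mul_cpow_ofReal_nonneg (by positivity) (by positivity), Complex.ofReal_natCast]
  have h4 : -(((τ : ℂ) + 1) * s) = -((τ : ℂ) * s) + -s := by ring
  rw [h4, Complex.cpow_add _ _ h2]
  ring

theorem differentiable_remTerm (Q : ℂ[X]) (c τ n k : ℕ) :
    Differentiable ℂ (remTerm Q c τ n k) := by
  have h2 : ((k + 1 : ℕ) : ℂ) ≠ 0 := by exact_mod_cast k.succ_ne_zero
  unfold remTerm
  refine Differentiable.mul (Differentiable.const_mul ?_ _)
    (differentiable_negBinomRem n (by positivity))
  exact fun s ↦ DifferentiableAt.const_cpow (by fun_prop) (Or.inl h2)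

/-- A polynomial bound on a polynomial at the positive integers. -/
theorem norm_eval_le (Q : ℂ[X]) (k : ℕ) :
    ‖Q.eval (((k + 1 : ℕ) : ℂ))‖ ≤
      (∑ i ∈ range (Q.natDegree + 1), ‖Q.coeff i‖) * ((k + 1 : ℕ) : ℝ) ^ Q.natDegree := by
  rw [eval_eq_sum_range, sum_mul]
  refine (norm_sum_le _ _).trans (sum_le_sum fun i hi ↦ ?_)
  rw [norm_mul, norm_pow, Complex.norm_natCast]
  refine mul_le_mul_of_nonneg_left ?_ (norm_nonneg _)
  refine pow_le_pow_right₀ ?_ (by simp at hi; omega)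
  exact_mod_cast Nat.succ_le_succ (Nat.zero_le k)

/-- The condition under which the remainder series after `n` terms converges like
`∑ k ^ (-2)`. -/
def IsGood (Q : ℂ[X]) (τ n : ℕ) (s : ℂ) : Prop :=
  0 ≤ s.re + n ∧ (Q.natDegree : ℝ) + 2 ≤ (τ + 1) * s.re + n

theorem IsGood.succ {Q : ℂ[X]} {τ n : ℕ} {s : ℂ} (h : IsGood Q τ n s) : IsGood Q τ (n + 1) s := by
  refine ⟨?_, ?_⟩ <;> push_cast <;> linarith [h.1, h.2]

/-- The summable majorant of `remTerm`, uniform over `‖s‖ ≤ M`. -/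
noncomputable def remBound (Q : ℂ[X]) (c n : ℕ) (M : ℝ) (k : ℕ) : ℝ :=
  ((∑ i ∈ range (Q.natDegree + 1), ‖Q.coeff i‖) * (∏ i ∈ range n, (M + i)) * (c : ℝ) ^ n) *
    (1 / ((k + 1 : ℕ) : ℝ) ^ 2)

theorem summable_remBound (Q : ℂ[X]) (c n : ℕ) (M : ℝ) : Summable (remBound Q c n M) := by
  have h := (summable_nat_add_iff 1).mpr (Real.summable_one_div_nat_pow.mpr one_lt_two)
  exact h.mul_left _

theorem norm_remTerm_le {Q : ℂ[X]} {c τ n : ℕ} {s : ℂ} {M : ℝ} (h : IsGood Q τ n s)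
    (hM : ‖s‖ ≤ M) (k : ℕ) : ‖remTerm Q c τ n k s‖ ≤ remBound Q c n M k := by
  have hK : (0 : ℝ) < ((k + 1 : ℕ) : ℝ) := by positivity
  have hK1 : (1 : ℝ) ≤ ((k + 1 : ℕ) : ℝ) := by exact_mod_cast Nat.succ_le_succ (Nat.zero_le k)
  have h1 := norm_eval_le Q k
  have h2 := norm_negBinomRem_le n s h.1 ((c : ℝ) / (k + 1 : ℕ)) (by positivity)
  have h3 : ‖((k + 1 : ℕ) : ℂ) ^ (-(((τ : ℂ) + 1) * s))‖ =
      ((k + 1 : ℕ) : ℝ) ^ (-((τ + 1) * s.re)) := by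
    rw [← Complex.ofReal_natCast, Complex.norm_cpow_eq_rpow_re_of_pos hK]
    congr 1
    have : ((τ : ℂ) + 1) = ((τ + 1 : ℝ) : ℂ) := by push_cast; rfl
    rw [this, Complex.neg_re, Complex.re_ofReal_mul]
  have h4 : (∏ i ∈ range n, ‖s + i‖) ≤ ∏ i ∈ range n, (M + i) := by
    refine prod_le_prod (fun _ _ ↦ norm_nonneg _) fun i _ ↦ (norm_add_le _ _).trans ?_
    rw [Complex.norm_natCast]; linarith
  have hexp : ((k + 1 : ℕ) : ℝ) ^ Q.natDegree * ((k + 1 : ℕ) : ℝ) ^ (-((τ + 1) * s.re)) *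
      (1 / ((k + 1 : ℕ) : ℝ)) ^ n ≤ 1 / ((k + 1 : ℕ) : ℝ) ^ 2 := by
    rw [one_div, one_div, inv_pow, ← Real.rpow_natCast, ← Real.rpow_natCast, ← Real.rpow_natCast,
      ← Real.rpow_neg hK.le, ← Real.rpow_neg hK.le, ← Real.rpow_add hK, ← Real.rpow_add hK]
    refine Real.rpow_le_rpow_of_exponent_le hK1 ?_
    have := h.2
    push_cast
    linarith
  have hA : 0 ≤ ∑ i ∈ range (Q.natDegree + 1), ‖Q.coeff i‖ := sum_nonneg fun _ _ ↦ norm_nonneg _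
  have hP : 0 ≤ ∏ i ∈ range n, ‖s + i‖ := prod_nonneg fun _ _ ↦ norm_nonneg _
  rw [remTerm, norm_mul, norm_mul, h3, remBound]
  set A := ∑ i ∈ range (Q.natDegree + 1), ‖Q.coeff i‖
  set K := ((k + 1 : ℕ) : ℝ)
  calc _ ≤ (A * K ^ Q.natDegree) * K ^ (-((τ + 1) * s.re)) *
        ((∏ i ∈ range n, ‖s + i‖) * ((c : ℝ) / K) ^ n) := by gcongr
    _ = (A * (∏ i ∈ range n, ‖s + i‖) * (c : ℝ) ^ n) *
        (K ^ Q.natDegree * K ^ (-((τ + 1) * s.re)) * (1 / K) ^ n) := by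
      rw [div_eq_mul_one_div, mul_pow]; ring
    _ ≤ _ := by
      have hP' := hP.trans h4
      gcongr

theorem summable_remTerm {Q : ℂ[X]} (c : ℕ) {τ n : ℕ} {s : ℂ} (h : IsGood Q τ n s) :
    Summable fun k ↦ remTerm Q c τ n k s :=
  Summable.of_norm_bounded (summable_remBound Q c n ‖s‖) (norm_remTerm_le h le_rfl)

theorem hasSum_zeta {s : ℂ} (hs : 1 < s.re) :
    HasSum (fun k : ℕ ↦ ((k + 1 : ℕ) : ℂ) ^ (-s)) (riemannZeta s) := by
  have h1 : Summable fun k : ℕ ↦ 1 / ((k + 1 : ℕ) : ℂ) ^ s :=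
    (summable_nat_add_iff 1).mpr (Complex.summable_one_div_nat_cpow.mpr hs)
  have h2 := h1.hasSum
  have h3 := zeta_eq_tsum_one_div_nat_add_one_cpow hs
  push_cast at h2
  rw [← h3] at h2
  convert h2 using 2 with k
  rw [Complex.cpow_neg, one_div]; push_cast; rfl

/-- A Dirichlet series whose coefficients are the values of a polynomial is a combination of
shifted Riemann zeta functions. -/
theorem hasSum_eval_mul_cpow (Q : ℂ[X]) {s : ℂ} (hs : (Q.natDegree : ℝ) + 1 < s.re) :
    HasSum (fun k : ℕ ↦ Q.eval (((k + 1 : ℕ) : ℂ)) * ((k + 1 : ℕ) : ℂ) ^ (-s))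
      (∑ i ∈ range (Q.natDegree + 1), Q.coeff i * riemannZeta (s - i)) := by
  have h1 : HasSum (fun k : ℕ ↦ ∑ i ∈ range (Q.natDegree + 1),
      Q.coeff i * ((k + 1 : ℕ) : ℂ) ^ (-(s - i)))
      (∑ i ∈ range (Q.natDegree + 1), Q.coeff i * riemannZeta (s - i)) := by
    refine hasSum_sum fun i hi ↦ (hasSum_zeta ?_).mul_left _
    have : (i : ℝ) ≤ Q.natDegree := by exact_mod_cast Nat.lt_succ_iff.mp (mem_range.mp hi)
    simp; linarith
  convert h1 using 2 with k
  have h2 : ((k + 1 : ℕ) : ℂ) ≠ 0 := by exact_mod_cast k.succ_ne_zero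
  rw [eval_eq_sum_range, sum_mul]
  refine sum_congr rfl fun i _ ↦ ?_
  rw [show -(s - (i : ℂ)) = (i : ℂ) + -s by ring, Complex.cpow_add _ _ h2, Complex.cpow_natCast]
  ring

/-- The next term of the expansion moves from the remainder series into the finite sum. -/
theorem zetaCont_succ {Q : ℂ[X]} {c τ n : ℕ} {s : ℂ} (h : IsGood Q τ n s) :
    zetaCont Q c τ n s = zetaCont Q c τ (n + 1) s := by
  have hs : (Q.natDegree : ℝ) + 1 < (((τ : ℂ) + 1) * s + n).re := by
    have : ((τ : ℂ) + 1) = ((τ + 1 : ℝ) : ℂ) := by push_cast; rfl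
    rw [this, Complex.add_re, Complex.re_ofReal_mul, Complex.natCast_re]
    linarith [h.2]
  have h1 := (hasSum_eval_mul_cpow Q hs).mul_left ((c : ℂ) ^ n * negBinom n s)
  have h2 := (summable_remTerm c h.succ).hasSum.add h1
  have h3 : (fun k ↦ remTerm Q c τ n k s) = fun k ↦ remTerm Q c τ (n + 1) k s +
      (c : ℂ) ^ n * negBinom n s * (Q.eval (((k + 1 : ℕ) : ℂ)) *
        ((k + 1 : ℕ) : ℂ) ^ (-(((τ : ℂ) + 1) * s + n))) := by
    funext k
    have h2 : ((k + 1 : ℕ) : ℂ) ≠ 0 := by exact_mod_cast k.succ_ne_zero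
    rw [remTerm, negBinomRem_succ, remTerm, mul_add]
    congr 1
    rw [show -(((τ : ℂ) + 1) * s + n) = -(((τ : ℂ) + 1) * s) + -(n : ℂ) by ring,
      Complex.cpow_add _ _ h2, Complex.cpow_neg _ (n : ℂ), Complex.cpow_natCast]
    push_cast
    rw [div_pow]
    push_cast at h2
    field_simp
  rw [← h3] at h2
  rw [zetaCont, zetaCont, h2.tsum_eq, sum_range_succ _ n, mul_sum, add_assoc]
  congr 1
  rw [add_comm]
  congr 1
  refine sum_congr rfl fun i _ ↦ ?_
  ring

theorem zetaCont_eq_of_le {Q : ℂ[X]} {c τ n m : ℕ} {s : ℂ} (h : IsGood Q τ n s) (hnm : n ≤ m) :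
    IsGood Q τ m s ∧ zetaCont Q c τ m s = zetaCont Q c τ n s := by
  induction m, hnm using Nat.le_induction with
  | base => exact ⟨h, rfl⟩
  | succ m _ ih => exact ⟨ih.1.succ, by rw [← zetaCont_succ ih.1, ih.2]⟩

theorem zetaCont_eq {Q : ℂ[X]} {c τ n m : ℕ} {s : ℂ} (hn : IsGood Q τ n s)
    (hm : IsGood Q τ m s) : zetaCont Q c τ n s = zetaCont Q c τ m s := by
  rcases le_total n m with h | h
  · exact (zetaCont_eq_of_le hn h).2.symm
  · exact (zetaCont_eq_of_le hm h).2

theorem hasSum_zetaCont {Q : ℂ[X]} {c τ n : ℕ} {s : ℂ} (hn : IsGood Q τ n s)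
    (hs : (Q.natDegree : ℝ) + 2 ≤ s.re) :
    HasSum (fun k ↦ zetaTerm Q c τ k s) (zetaCont Q c τ n s) := by
  have h0 : (0 : ℝ) ≤ Q.natDegree := Nat.cast_nonneg _
  have hg : IsGood Q τ 0 s := by
    refine ⟨by push_cast; linarith, ?_⟩
    have : 0 ≤ (τ : ℝ) * s.re := mul_nonneg (Nat.cast_nonneg _) (by linarith)
    push_cast; linarith
  rw [zetaCont_eq hn hg]
  have := (summable_remTerm c hg).hasSum
  simp only [remTerm_zero] at this
  simpa [zetaCont, remTerm_zero] using this

/-- A number of expansion terms sufficient on the ball of radius `M`. -/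
noncomputable def goodIndex (Q : ℂ[X]) (τ M : ℕ) : ℕ := (τ + 1) * M + Q.natDegree + 2

theorem isGood_goodIndex (Q : ℂ[X]) (τ : ℕ) {M : ℕ} {s : ℂ} (hs : ‖s‖ ≤ M) :
    IsGood Q τ (goodIndex Q τ M) s := by
  have h1 : -(M : ℝ) ≤ s.re := by
    have := (abs_le.mp (Complex.abs_re_le_norm s)).1
    linarith
  have h2 : 0 ≤ (τ + 1 : ℝ) * (s.re + M) := mul_nonneg (by positivity) (by linarith)
  have h3 : (0 : ℝ) ≤ τ * M := by positivity
  have h4 : (0 : ℝ) ≤ Q.natDegree := Nat.cast_nonneg _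
  constructor
  · rw [goodIndex]; push_cast; nlinarith
  · rw [goodIndex]; push_cast; nlinarith

theorem analyticAt_tsum_remTerm (Q : ℂ[X]) (c τ : ℕ) {M : ℕ} {s : ℂ} (hs : ‖s‖ < M) :
    AnalyticAt ℂ (fun s ↦ ∑' k, remTerm Q c τ (goodIndex Q τ M) k s) s := by
  have hU : IsOpen (Metric.ball (0 : ℂ) M) := Metric.isOpen_ball
  refine (Complex.differentiableOn_tsum_of_summable_norm
    (summable_remBound Q c (goodIndex Q τ M) M)
    (fun k ↦ (differentiable_remTerm Q c τ _ k).differentiableOn) hU ?_).analyticAt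
    (hU.mem_nhds (by simpa using hs))
  intro k w hw
  have hw' : ‖w‖ ≤ M := by simpa using (mem_ball_zero_iff.mp hw).le
  exact norm_remTerm_le (isGood_goodIndex Q τ hw') hw' k

/-- Near the origin the remainder series may be differentiated term by term. Its derivative at `0`
does not depend on `τ`, since each remainder vanishes there. -/
theorem analyticAt_and_hasSum_deriv_tsum_remTerm {Q : ℂ[X]} {c τ n : ℕ}
    (hn : goodIndex Q τ 1 ≤ n) :
    AnalyticAt ℂ (fun s ↦ ∑' k, remTerm Q c τ n k s) 0 ∧
    HasSum (fun k ↦ Q.eval (((k + 1 : ℕ) : ℂ)) *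
        deriv (fun s ↦ negBinomRem n s ((c : ℝ) / (k + 1 : ℕ))) 0)
      (deriv (fun s ↦ ∑' k, remTerm Q c τ n k s) 0) := by
  have hU : IsOpen (Metric.ball (0 : ℂ) 1) := Metric.isOpen_ball
  have hbd : ∀ (k : ℕ) (w : ℂ), w ∈ Metric.ball (0 : ℂ) 1 →
      ‖remTerm Q c τ n k w‖ ≤ remBound Q c n 1 k := by
    intro k w hw
    have hw' : ‖w‖ ≤ (1 : ℕ) := by simpa using (mem_ball_zero_iff.mp hw).le
    exact norm_remTerm_le (zetaCont_eq_of_le (c := c) (isGood_goodIndex Q τ hw') hn).1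
      (by simpa using hw') k
  refine ⟨(Complex.differentiableOn_tsum_of_summable_norm (summable_remBound Q c n 1)
    (fun k ↦ (differentiable_remTerm Q c τ _ k).differentiableOn) hU hbd).analyticAt
    (hU.mem_nhds (by simp)), ?_⟩
  have h := Complex.hasSum_deriv_of_summable_norm (summable_remBound Q c n 1)
    (fun k ↦ (differentiable_remTerm Q c τ n k).differentiableOn) hU hbd
    (z := 0) (by simp)
  suffices e : ∀ k, Q.eval (((k + 1 : ℕ) : ℂ)) *
      deriv (fun s ↦ negBinomRem n s ((c : ℝ) / (k + 1 : ℕ))) 0 =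
      deriv (remTerm Q c τ n k) 0 by
    simpa only [e] using h
  intro k
  have h2 : ((k + 1 : ℕ) : ℂ) ≠ 0 := by exact_mod_cast k.succ_ne_zero
  have hd1 : DifferentiableAt ℂ (fun s : ℂ ↦ Q.eval (((k + 1 : ℕ) : ℂ)) *
      ((k + 1 : ℕ) : ℂ) ^ (-(((τ : ℂ) + 1) * s))) 0 :=
    DifferentiableAt.const_mul (DifferentiableAt.const_cpow (by fun_prop) (Or.inl h2)) _
  have hd2 : DifferentiableAt ℂ (fun s ↦ negBinomRem n s ((c : ℝ) / (k + 1 : ℕ))) 0 :=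
    differentiable_negBinomRem n (by positivity) 0
  have hn1 : 1 ≤ n := le_trans (by rw [goodIndex]; omega) hn
  have h3 := (hd1.hasDerivAt.mul hd2.hasDerivAt).deriv
  have h4 : remTerm Q c τ n k = (fun s : ℂ ↦ Q.eval (((k + 1 : ℕ) : ℂ)) *
      ((k + 1 : ℕ) : ℂ) ^ (-(((τ : ℂ) + 1) * s))) *
      fun s ↦ negBinomRem n s ((c : ℝ) / (k + 1 : ℕ)) := rfl
  rw [h4, h3, negBinomRem_at_zero hn1]
  simp

/-! ### Regularization at the origin -/

/-- The entire function `w ↦ w ζ(1 + w)`, with the value `1` at `w = 0`, where the pole of `ζ` is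
cancelled. -/
noncomputable def zetaReg : ℂ → ℂ := Function.update (fun w ↦ w * riemannZeta (1 + w)) 0 1

theorem zetaReg_of_ne {w : ℂ} (hw : w ≠ 0) : zetaReg w = w * riemannZeta (1 + w) := by
  simp [zetaReg, hw]

theorem zetaReg_zero : zetaReg 0 = 1 := by simp [zetaReg]

theorem analyticAt_riemannZeta {s : ℂ} (hs : s ≠ 1) : AnalyticAt ℂ riemannZeta s :=
  differentiableOn_riemannZeta.analyticAt (isOpen_compl_singleton.mem_nhds hs)

theorem analyticAt_zetaReg : AnalyticAt ℂ zetaReg 0 := by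
  refine Complex.analyticAt_of_differentiable_on_punctured_nhds_of_continuousAt ?_ ?_
  · filter_upwards [self_mem_nhdsWithin] with w hw
    have hw : w ≠ 0 := hw
    have h1 : DifferentiableAt ℂ (fun w ↦ w * riemannZeta (1 + w)) w := by
      have h2 : DifferentiableAt ℂ riemannZeta (1 + w) :=
        differentiableAt_riemannZeta (by simpa using hw)
      have h3 : DifferentiableAt ℂ (fun w ↦ riemannZeta (1 + w)) w :=
        h2.comp w (by fun_prop)
      exact differentiableAt_id.mul h3
    refine h1.congr_of_eventuallyEq ?_
    filter_upwards [isOpen_ne.mem_nhds hw] with v hv using zetaReg_of_ne hv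
  · rw [zetaReg, continuousAt_update_same]
    have h1 : Tendsto (fun w : ℂ ↦ 1 + w) (𝓝[≠] 0) (𝓝[≠] 1) := by
      refine tendsto_nhdsWithin_iff.mpr ⟨?_, ?_⟩
      · have : ContinuousAt (fun w : ℂ ↦ 1 + w) 0 := by fun_prop
        have h2 := this.tendsto.mono_left (nhdsWithin_le_nhds (s := {0}ᶜ))
        simpa using h2
      · filter_upwards [self_mem_nhdsWithin] with w hw
        have hw : w ≠ 0 := hw
        simpa using hw
    have h2 := riemannZeta_residue_one.comp h1
    refine h2.congr fun w ↦ ?_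
    simp

theorem meromorphic_riemannZeta : Meromorphic riemannZeta := by
  intro s
  by_cases hs : s = 1
  · subst hs
    have h1 : AnalyticAt ℂ (fun s ↦ zetaReg (s - 1)) 1 := by
      refine AnalyticAt.fun_comp (g := zetaReg) (f := fun s : ℂ ↦ s - 1) ?_ (by fun_prop)
      simpa using analyticAt_zetaReg
    have h2 : MeromorphicAt (fun s : ℂ ↦ zetaReg (s - 1) / (s - 1)) 1 :=
      h1.meromorphicAt.div (by fun_prop : AnalyticAt ℂ (fun s : ℂ ↦ s - 1) 1).meromorphicAt
    refine h2.congr ?_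
    filter_upwards [self_mem_nhdsWithin] with w hw
    have hw : w - 1 ≠ 0 := sub_ne_zero.mpr hw
    rw [zetaReg_of_ne hw]
    field_simp
    congr 1; ring
  · exact (analyticAt_riemannZeta hs).meromorphicAt

theorem meromorphicAt_riemannZeta_affine (a b s : ℂ) :
    MeromorphicAt (fun s ↦ riemannZeta (a * s + b)) s := by
  exact MeromorphicAt.comp_analyticAt (f := riemannZeta) (g := fun s : ℂ ↦ a * s + b)
    (meromorphic_riemannZeta _) (by fun_prop)

/-- The quotient `(-s choose j + 1) / s`, extended to a polynomial in `s`. -/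
noncomputable def negBinomDiv (j : ℕ) (s : ℂ) : ℂ :=
  -(∏ i ∈ range j, (-s - (i + 1))) / ((j + 1).factorial : ℂ)

theorem negBinom_succ_eq (j : ℕ) (s : ℂ) : negBinom (j + 1) s = s * negBinomDiv j s := by
  rw [negBinom, negBinomDiv, prod_range_succ']
  push_cast
  ring

theorem differentiable_negBinomDiv (j : ℕ) : Differentiable ℂ (negBinomDiv j) := by
  unfold negBinomDiv
  fun_prop

theorem negBinomDiv_succ (j : ℕ) (s : ℂ) :
    negBinomDiv (j + 1) s = negBinomDiv j s * ((-s - (j + 1)) / (j + 2)) := by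
  have h1 : ((j : ℂ) + 2) ≠ 0 := by exact_mod_cast (show (j + 2 : ℕ) ≠ 0 by omega)
  have h2 : ((j + 1).factorial : ℂ) ≠ 0 := Nat.cast_ne_zero.mpr (Nat.factorial_ne_zero _)
  rw [negBinomDiv, negBinomDiv, prod_range_succ, Nat.factorial_succ (j + 1)]
  push_cast
  rw [show (j : ℂ) + 1 + 1 = j + 2 by ring]
  field_simp

theorem negBinomDiv_at_zero (j : ℕ) : negBinomDiv j 0 = (-1) ^ (j + 1) / (j + 1) := by
  induction j with
  | zero => simp [negBinomDiv]
  | succ j ih =>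
    have h1 : ((j : ℂ) + 2) ≠ 0 := by exact_mod_cast (show (j + 2 : ℕ) ≠ 0 by omega)
    have h2 : ((j : ℂ) + 1) ≠ 0 := Nat.cast_add_one_ne_zero j
    rw [negBinomDiv_succ, ih]
    push_cast
    rw [show (j : ℂ) + 1 + 1 = j + 2 by ring]
    field_simp
    ring

theorem deriv_negBinomDiv_zero (j : ℕ) :
    deriv (negBinomDiv j) 0 = (-1) ^ (j + 1) * (harmonic j : ℂ) / (j + 1) := by
  induction j with
  | zero =>
    have : negBinomDiv 0 = fun _ ↦ -1 := by funext s; simp [negBinomDiv]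
    simp [this]
  | succ j ih =>
    have h1 : ((j : ℂ) + 2) ≠ 0 := by exact_mod_cast (show (j + 2 : ℕ) ≠ 0 by omega)
    have h2 : ((j : ℂ) + 1) ≠ 0 := Nat.cast_add_one_ne_zero j
    have h3 : negBinomDiv (j + 1) =
        fun s ↦ negBinomDiv j s * ((-s - (j + 1)) / (j + 2)) := funext (negBinomDiv_succ j)
    have h4 : HasDerivAt (fun s : ℂ ↦ ((-s - (j + 1)) / (j + 2))) (-1 / (j + 2)) 0 :=
      ((hasDerivAt_id (0 : ℂ)).neg.sub_const _).div_const _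
    have h5 := ((differentiable_negBinomDiv j 0).hasDerivAt.mul h4).deriv
    rw [h3]
    refine h5.trans ?_
    rw [ih, negBinomDiv_at_zero, harmonic_succ]
    push_cast
    rw [show (j : ℂ) + 1 + 1 = j + 2 by ring]
    field_simp
    ring

/-- The analytic form, near `s = 0`, of the summand
`(-s choose j) ζ((τ + 1) s + j - i)` of `zetaCont`. -/
noncomputable def regTerm (τ j i : ℕ) (s : ℂ) : ℂ :=
  if j = i + 1 then negBinomDiv i s * zetaReg (((τ : ℂ) + 1) * s) / (τ + 1)
  else negBinom j s * riemannZeta (((τ : ℂ) + 1) * s + j - i)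

theorem regTerm_eq (τ j i : ℕ) {s : ℂ} (hs : s ≠ 0) :
    regTerm τ j i s = negBinom j s * riemannZeta (((τ : ℂ) + 1) * s + j - i) := by
  rw [regTerm]
  split_ifs with h
  · subst h
    have h1 : ((τ : ℂ) + 1) ≠ 0 := Nat.cast_add_one_ne_zero τ
    rw [zetaReg_of_ne (mul_ne_zero h1 hs), negBinom_succ_eq]
    push_cast
    rw [show ((τ : ℂ) + 1) * s + (i + 1) - i = 1 + ((τ : ℂ) + 1) * s by ring]
    field_simp
  · rfl

/-- Analyticity of `regTerm` at the origin and its derivative there. -/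
theorem analyticAt_and_deriv_regTerm (τ j i : ℕ) :
    AnalyticAt ℂ (regTerm τ j i) 0 ∧ deriv (regTerm τ j i) 0 =
      if j = i + 1 then deriv (negBinomDiv i) 0 / (τ + 1) + negBinomDiv i 0 * deriv zetaReg 0
      else if j = 0 then (τ + 1) * deriv riemannZeta (-i)
      else deriv (negBinom j) 0 * riemannZeta (j - i) := by
  have h1 : ((τ : ℂ) + 1) ≠ 0 := Nat.cast_add_one_ne_zero τ
  have hlin : HasDerivAt (fun s : ℂ ↦ ((τ : ℂ) + 1) * s) (τ + 1) 0 := by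
    simpa using (hasDerivAt_id (0 : ℂ)).const_mul ((τ : ℂ) + 1)
  split_ifs with h h0
  · have e : regTerm τ j i =
        fun s ↦ negBinomDiv i s * zetaReg (((τ : ℂ) + 1) * s) / (τ + 1) := by
      funext s; rw [regTerm, if_pos h]
    have ha : AnalyticAt ℂ (fun s ↦ zetaReg (((τ : ℂ) + 1) * s)) 0 := by
      refine AnalyticAt.fun_comp (g := zetaReg) (f := fun s : ℂ ↦ ((τ : ℂ) + 1) * s) ?_
        (by fun_prop)
      simpa using analyticAt_zetaReg
    have hb : AnalyticAt ℂ (negBinomDiv i) 0 := (differentiable_negBinomDiv i).analyticAt 0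
    rw [e]
    refine ⟨(hb.mul ha).div_const, ?_⟩
    have hz : HasDerivAt zetaReg (deriv zetaReg 0) (((τ : ℂ) + 1) * 0) := by
      simpa using analyticAt_zetaReg.differentiableAt.hasDerivAt
    have hc : HasDerivAt (fun s ↦ zetaReg (((τ : ℂ) + 1) * s)) (deriv zetaReg 0 * (τ + 1)) 0 :=
      hz.comp (0 : ℂ) hlin
    refine ((hb.differentiableAt.hasDerivAt.mul hc).div_const _).deriv.trans ?_
    rw [mul_zero, zetaReg_zero]
    field_simp
  all_goals
    have e : regTerm τ j i =
        fun s ↦ negBinom j s * riemannZeta (((τ : ℂ) + 1) * s + j - i) := by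
      funext s; rw [regTerm, if_neg h]
    have hne : ((τ : ℂ) + 1) * 0 + j - i ≠ 1 := by
      intro h2
      apply h
      have h3 : (j : ℂ) = ((i + 1 : ℕ) : ℂ) := by push_cast; linear_combination h2
      exact_mod_cast h3
    have hlin' : HasDerivAt (fun s : ℂ ↦ ((τ : ℂ) + 1) * s + j - i) (τ + 1) 0 :=
      (hlin.add_const _).sub_const _
    have ha : AnalyticAt ℂ (fun s ↦ riemannZeta (((τ : ℂ) + 1) * s + j - i)) 0 :=
      AnalyticAt.fun_comp (g := riemannZeta) (f := fun s : ℂ ↦ ((τ : ℂ) + 1) * s + j - i)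
        (analyticAt_riemannZeta hne) (by fun_prop)
    have hb : AnalyticAt ℂ (negBinom j) 0 := (differentiable_negBinom j).analyticAt 0
    have hc : HasDerivAt (fun s ↦ riemannZeta (((τ : ℂ) + 1) * s + j - i))
        (deriv riemannZeta (((τ : ℂ) + 1) * 0 + j - i) * (τ + 1)) 0 :=
      (analyticAt_riemannZeta hne).differentiableAt.hasDerivAt.comp (0 : ℂ) hlin'
    rw [e]
    refine ⟨hb.mul ha, (hb.differentiableAt.hasDerivAt.mul hc).deriv.trans ?_⟩
    rw [negBinom_at_zero]
  · subst h0
    have : deriv (negBinom 0) 0 = 0 := by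
      have : negBinom 0 = fun _ ↦ 1 := by funext s; simp [negBinom]
      simp [this]
    rw [this]
    simp
    ring
  · simp [h0]

/-- `zetaCont` with its summands replaced by their analytic forms. -/
noncomputable def zetaContReg (Q : ℂ[X]) (c τ n : ℕ) (s : ℂ) : ℂ :=
  (∑ j ∈ range n, ∑ i ∈ range (Q.natDegree + 1),
    Q.coeff i * (c : ℂ) ^ j * regTerm τ j i s) + ∑' k, remTerm Q c τ n k s

theorem zetaContReg_eq (Q : ℂ[X]) (c τ n : ℕ) {s : ℂ} (hs : s ≠ 0) :
    zetaContReg Q c τ n s = zetaCont Q c τ n s := by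
  simp only [zetaContReg, zetaCont, regTerm_eq _ _ _ hs]

theorem analyticAt_and_deriv_zetaContReg (Q : ℂ[X]) (c : ℕ) {τ n : ℕ} (hn : goodIndex Q τ 1 ≤ n) :
    AnalyticAt ℂ (zetaContReg Q c τ n) 0 ∧ deriv (zetaContReg Q c τ n) 0 =
      (∑ j ∈ range n, ∑ i ∈ range (Q.natDegree + 1),
        Q.coeff i * (c : ℂ) ^ j * deriv (regTerm τ j i) 0) +
      ∑' k : ℕ, Q.eval (((k + 1 : ℕ) : ℂ)) *
        deriv (fun s ↦ negBinomRem n s ((c : ℝ) / (k + 1 : ℕ))) 0 := by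
  obtain ⟨h1, h2⟩ := analyticAt_and_hasSum_deriv_tsum_remTerm (c := c) hn
  have h3 : ∀ j i, AnalyticAt ℂ (regTerm τ j i) 0 := fun j i ↦
    (analyticAt_and_deriv_regTerm τ j i).1
  constructor
  · unfold zetaContReg
    refine AnalyticAt.fun_add ?_ h1
    refine Finset.analyticAt_fun_sum _ fun j _ ↦ Finset.analyticAt_fun_sum _ fun i _ ↦ ?_
    exact analyticAt_const.mul (h3 j i)
  · refine HasDerivAt.deriv ?_
    rw [h2.tsum_eq]
    refine HasDerivAt.add ?_ h1.differentiableAt.hasDerivAt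
    refine HasDerivAt.fun_sum fun j _ ↦ HasDerivAt.fun_sum fun i _ ↦ ?_
    exact (h3 j i).differentiableAt.hasDerivAt.const_mul _

/-- The effect on the derivative at `0` of inserting the factor `k ^ (-s)` into the series
`∑ Q(k) (k + c) ^ (-s)`: a linear combination of values of `ζ'`, and the contribution of the
poles of `ζ` in the expansion. -/
theorem deriv_zetaContReg_sub (Q : ℂ[X]) (c : ℕ) {n : ℕ} (hn : goodIndex Q 1 1 ≤ n) :
    deriv (zetaContReg Q c 1 n) 0 - deriv (zetaContReg Q c 0 n) 0 =
      ∑ i ∈ range (Q.natDegree + 1), Q.coeff i * (deriv riemannZeta (-i) -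
        (-(c : ℂ)) ^ (i + 1) * (harmonic i : ℂ) / (2 * (i + 1))) := by
  have hn0 : goodIndex Q 0 1 ≤ n := le_trans (by simp [goodIndex]) hn
  have hn' : Q.natDegree + 2 ≤ n := le_trans (by simp [goodIndex]) hn
  rw [(analyticAt_and_deriv_zetaContReg Q c hn).2, (analyticAt_and_deriv_zetaContReg Q c hn0).2,
    add_sub_add_right_eq_sub, sum_comm, sum_comm (s := range n), ← sum_sub_distrib]
  refine sum_congr rfl fun i hi ↦ ?_
  have hi : i < Q.natDegree + 1 := mem_range.mp hi
  simp only [mul_assoc]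
  rw [← mul_sum, ← mul_sum, ← mul_sub, ← sum_sub_distrib]
  congr 1
  simp only [← mul_sub]
  rw [sum_eq_add_of_mem 0 (i + 1) (by simp; omega) (by simp; omega) (by omega)]
  · rw [(analyticAt_and_deriv_regTerm 1 0 i).2, (analyticAt_and_deriv_regTerm 0 0 i).2,
      (analyticAt_and_deriv_regTerm 1 (i + 1) i).2, (analyticAt_and_deriv_regTerm 0 (i + 1) i).2,
      deriv_negBinomDiv_zero]
    have h2 : ((i : ℂ) + 1) ≠ 0 := Nat.cast_add_one_ne_zero i
    simp only [if_true, show ¬ (0 = i + 1) by omega, if_false]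
    push_cast
    rw [neg_pow (c : ℂ)]
    field_simp
    ring
  · rintro j _ ⟨hj0, hj1⟩
    rw [(analyticAt_and_deriv_regTerm 1 j i).2, (analyticAt_and_deriv_regTerm 0 j i).2]
    simp [hj0, hj1]

/-- The meromorphic continuation of `∑ zetaTerm`, made analytic at the origin. -/
noncomputable def zetaExt (Q : ℂ[X]) (c τ n : ℕ) : ℂ → ℂ :=
  Function.update (fun s ↦ zetaCont Q c τ (goodIndex Q τ (⌈‖s‖⌉₊)) s) 0 (zetaContReg Q c τ n 0)

theorem zetaExt_eq (Q : ℂ[X]) (c τ n : ℕ) {M : ℕ} {s : ℂ} (h0 : s ≠ 0) (hs : ‖s‖ ≤ M) :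
    zetaExt Q c τ n s = zetaCont Q c τ (goodIndex Q τ M) s := by
  rw [zetaExt, Function.update_of_ne h0]
  exact zetaCont_eq (isGood_goodIndex Q τ (Nat.le_ceil _)) (isGood_goodIndex Q τ hs)

theorem meromorphicAt_zetaCont (Q : ℂ[X]) (c τ : ℕ) {M : ℕ} {s : ℂ} (hs : ‖s‖ < M) :
    MeromorphicAt (zetaCont Q c τ (goodIndex Q τ M)) s := by
  unfold zetaCont
  refine MeromorphicAt.fun_add ?_ (analyticAt_tsum_remTerm Q c τ hs).meromorphicAt
  refine MeromorphicAt.fun_sum fun j _ ↦ MeromorphicAt.fun_sum fun i _ ↦ ?_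
  refine (MeromorphicAt.const _ _).fun_mul
    (((differentiable_negBinom j).analyticAt s).meromorphicAt.fun_mul ?_)
  simpa [add_sub_assoc] using meromorphicAt_riemannZeta_affine ((τ : ℂ) + 1) (j - i) s

theorem meromorphic_zetaExt (Q : ℂ[X]) (c τ n : ℕ) : Meromorphic (zetaExt Q c τ n) := by
  intro s
  obtain ⟨M, hM⟩ := exists_nat_gt ‖s‖
  refine (meromorphicAt_zetaCont Q c τ hM).congr ?_
  have h1 : ∀ᶠ w in 𝓝 s, ‖w‖ < M := (continuous_norm.tendsto s).eventually (gt_mem_nhds hM)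
  by_cases h0 : s = 0
  · filter_upwards [h1.filter_mono nhdsWithin_le_nhds, self_mem_nhdsWithin] with w hw hw0
    subst h0
    exact (zetaExt_eq Q c τ n hw0 hw.le).symm
  · filter_upwards [h1.filter_mono nhdsWithin_le_nhds,
      (isOpen_ne.eventually_mem h0).filter_mono nhdsWithin_le_nhds] with w hw hw0
    exact (zetaExt_eq Q c τ n hw0 hw.le).symm

theorem zetaExt_eventuallyEq (Q : ℂ[X]) (c : ℕ) {τ n : ℕ} (hn : goodIndex Q τ 1 ≤ n) :
    zetaExt Q c τ n =ᶠ[𝓝 0] zetaContReg Q c τ n := by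
  have h1 : ∀ᶠ w in 𝓝 (0 : ℂ), ‖w‖ < 1 :=
    (continuous_norm.tendsto (0 : ℂ)).eventually (gt_mem_nhds (by simp))
  filter_upwards [h1] with w hw
  by_cases h0 : w = 0
  · subst h0; simp [zetaExt]
  · have hw' : ‖w‖ ≤ (1 : ℕ) := by simpa using hw.le
    rw [zetaExt_eq Q c τ n h0 hw', zetaContReg_eq Q c τ n h0]
    exact (zetaCont_eq_of_le (isGood_goodIndex Q τ hw') hn).2.symm

theorem hasSum_zetaExt (Q : ℂ[X]) (c τ n : ℕ) {s : ℂ} (hs : (Q.natDegree : ℝ) + 2 ≤ s.re) :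
    HasSum (fun k ↦ zetaTerm Q c τ k s) (zetaExt Q c τ n s) := by
  have h0 : s ≠ 0 := by
    rintro rfl
    have : (0 : ℝ) ≤ Q.natDegree := Nat.cast_nonneg _
    simp at hs; linarith
  rw [zetaExt_eq Q c τ n h0 (Nat.le_ceil _)]
  exact hasSum_zetaCont (isGood_goodIndex Q τ (Nat.le_ceil _)) hs

/-- Two meromorphic functions that agree on a right half-plane and are analytic at `0` have the
same germ there. -/
theorem eventuallyEq_of_eq_on_halfPlane {f g : ℂ → ℂ} (hf : Meromorphic f) (hg : Meromorphic g)
    (hf0 : AnalyticAt ℂ f 0) (hg0 : AnalyticAt ℂ g 0) {μ : ℝ}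
    (h : ∀ s : ℂ, μ < s.re → f s = g s) : f =ᶠ[𝓝 0] g := by
  have hfg : Meromorphic (f - g) := fun s ↦ (hf s).sub (hg s)
  have h1 : meromorphicOrderAt (f - g) ((μ + 1 : ℝ) : ℂ) = ⊤ := by
    rw [meromorphicOrderAt_eq_top_iff]
    have ho : IsOpen {s : ℂ | μ < s.re} := isOpen_lt continuous_const Complex.continuous_re
    have := ho.mem_nhds (show ((μ + 1 : ℝ) : ℂ) ∈ {s : ℂ | μ < s.re} by simp)
    filter_upwards [mem_nhdsWithin_of_mem_nhds this] with s hs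
    simp [h s hs]
  have h2 : meromorphicOrderAt (f - g) 0 = ⊤ := by
    by_contra hne
    exact (hfg.exists_meromorphicOrderAt_ne_top_iff_forall.mp ⟨0, hne⟩) _ h1
  rw [meromorphicOrderAt_eq_top_iff] at h2
  have h3 : ∃ᶠ s in 𝓝[≠] (0 : ℂ), f s = g s := by
    refine Eventually.frequently ?_
    filter_upwards [h2] with s hs
    exact sub_eq_zero.mp hs
  exact (hf0.frequently_eq_iff_eventually_eq hg0).mp h3

/-- The spectral zeta function of a spectrum `k (k + c)` with multiplicities `Q(k)`, `k ≥ 1`: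
its continuation, and its derivative at the origin when `∑ Q(k) (k + c) ^ (-s)` continues to a
given function `W`. -/
theorem exists_zeta_continuation (Q : ℂ[X]) (c : ℕ) {W : ℂ → ℂ} (hW : Meromorphic W)
    (hW0 : AnalyticAt ℂ W 0) {μ : ℝ}
    (hWs : ∀ s : ℂ, μ < s.re → HasSum (fun k ↦ zetaTerm Q c 0 k s) (W s)) :
    ∃ Z : ℂ → ℂ, Meromorphic Z ∧ AnalyticAt ℂ Z 0 ∧
      (∀ s : ℂ, (Q.natDegree : ℝ) + 2 ≤ s.re → HasSum (fun k ↦ zetaTerm Q c 1 k s) (Z s)) ∧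
      deriv Z 0 = deriv W 0 + ∑ i ∈ range (Q.natDegree + 1), Q.coeff i *
        (deriv riemannZeta (-i) - (-(c : ℂ)) ^ (i + 1) * (harmonic i : ℂ) / (2 * (i + 1))) := by
  set n := goodIndex Q 1 1 with hn
  have hn0 : goodIndex Q 0 1 ≤ n := by simp [hn, goodIndex]
  have e1 := zetaExt_eventuallyEq Q c (le_refl (goodIndex Q 1 1))
  have e0 := zetaExt_eventuallyEq Q c hn0
  have a1 := (analyticAt_and_deriv_zetaContReg Q c (le_refl (goodIndex Q 1 1))).1.congr e1.symm
  have a0 := (analyticAt_and_deriv_zetaContReg Q c hn0).1.congr e0.symm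
  refine ⟨zetaExt Q c 1 n, meromorphic_zetaExt Q c 1 n, a1,
    fun s hs ↦ hasSum_zetaExt Q c 1 n hs, ?_⟩
  have e2 : W =ᶠ[𝓝 0] zetaExt Q c 0 n := by
    refine eventuallyEq_of_eq_on_halfPlane hW (meromorphic_zetaExt Q c 0 n) hW0 a0
      (μ := max μ (Q.natDegree + 2)) fun s hs ↦ ?_
    exact (hWs s ((le_max_left _ _).trans_lt hs)).unique
      (hasSum_zetaExt Q c 0 n ((le_max_right _ _).trans_lt hs).le)
  rw [← deriv_zetaContReg_sub Q c (le_refl (goodIndex Q 1 1)), e1.deriv_eq, (e2.trans e0).deriv_eq]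
  ring

/-! ### Harmonic number identities -/

/-- The alternating binomial sum `∑ (M choose j) (-2) ^ j H_j`. -/
def binomHarmonicSum (M : ℕ) : ℚ :=
  ∑ j ∈ range (M + 1), (M.choose j : ℚ) * (-2) ^ j * harmonic j

/-- The alternating binomial sum `∑ (M choose j + 1) (-2) ^ (j + 1) H_j`. -/
def binomHarmonicShiftSum (M : ℕ) : ℚ :=
  ∑ j ∈ range M, (M.choose (j + 1) : ℚ) * (-2) ^ (j + 1) * harmonic j

theorem binomHarmonicShiftSum_succ (M : ℕ) :
    binomHarmonicShiftSum (M + 1) = binomHarmonicShiftSum M - 2 * binomHarmonicSum M := by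
  have h1 : binomHarmonicShiftSum M =
      ∑ j ∈ range (M + 1), (M.choose (j + 1) : ℚ) * (-2) ^ (j + 1) * harmonic j := by
    rw [sum_range_succ]; simp [binomHarmonicShiftSum]
  rw [h1, binomHarmonicSum, binomHarmonicShiftSum, mul_sum, ← sum_sub_distrib]
  refine sum_congr rfl fun j _ ↦ ?_
  rw [Nat.choose_succ_succ]
  push_cast
  ring

theorem sum_choose_mul_pow_div (M : ℕ) :
    ∑ j ∈ range (M + 1), (M.choose j : ℚ) * (-2) ^ (j + 1) / (j + 1) =
      ((-1) ^ (M + 1) - 1) / (M + 1) := by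
  have h1 : ((M : ℚ) + 1) ≠ 0 := Nat.cast_add_one_ne_zero M
  have h2 := add_pow (-2 : ℚ) 1 (M + 1)
  rw [sum_range_succ'] at h2
  norm_num at h2
  rw [eq_div_iff h1, h2, add_sub_cancel_right, sum_mul]
  refine sum_congr rfl fun j _ ↦ ?_
  have h3 : ((j : ℚ) + 1) ≠ 0 := Nat.cast_add_one_ne_zero j
  have h4 : ((M + 1 : ℕ) : ℚ) * (M.choose j : ℚ) = ((M + 1).choose (j + 1) : ℚ) * (j + 1 : ℕ) := by
    exact_mod_cast Nat.add_one_mul_choose_eq M j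
  push_cast at h4
  field_simp
  linear_combination h4

theorem binomHarmonicSum_succ (M : ℕ) :
    binomHarmonicSum (M + 1) = -binomHarmonicSum M + ((-1) ^ (M + 1) - 1) / (M + 1) := by
  have h1 : binomHarmonicSum M = ∑ j ∈ range (M + 1),
      (M.choose (j + 1) : ℚ) * (-2) ^ (j + 1) * harmonic (j + 1) := by
    rw [sum_range_succ, binomHarmonicSum, sum_range_succ']; simp
  have h2 : binomHarmonicSum (M + 1) = ∑ j ∈ range (M + 1),
      ((M + 1).choose (j + 1) : ℚ) * (-2) ^ (j + 1) * harmonic (j + 1) := by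
    rw [binomHarmonicSum, sum_range_succ']; simp
  have h3 : binomHarmonicSum (M + 1) - binomHarmonicSum M + 2 * binomHarmonicSum M =
      ∑ j ∈ range (M + 1), (M.choose j : ℚ) * (-2) ^ (j + 1) / (j + 1) := by
    rw [h2, h1, ← sum_sub_distrib, ← h1, binomHarmonicSum, mul_sum, ← sum_add_distrib]
    refine sum_congr rfl fun j _ ↦ ?_
    have h3 : ((j : ℚ) + 1) ≠ 0 := Nat.cast_add_one_ne_zero j
    rw [harmonic_succ, Nat.choose_succ_succ]
    push_cast
    field_simp
    ring
  rw [sum_choose_mul_pow_div] at h3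
  linear_combination h3

/-- The closed form of the alternating sum, by induction on `M` over the two parities. -/
theorem binomHarmonicSum_eq (m : ℕ) :
    binomHarmonicSum (2 * m) = 2 * harmonic (2 * m) - harmonic m ∧
    binomHarmonicSum (2 * m + 1) = harmonic m - 2 * harmonic (2 * m + 1) := by
  induction m with
  | zero => constructor <;> norm_num [binomHarmonicSum, sum_range_succ, harmonic_succ]
  | succ m ih =>
    have h1 : ((m : ℚ) + 1) ≠ 0 := Nat.cast_add_one_ne_zero m
    have h2 : (2 * (m : ℚ) + 3) ≠ 0 := by positivity
    have e1 : binomHarmonicSum (2 * (m + 1)) = 2 * harmonic (2 * (m + 1)) - harmonic (m + 1) := by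
      rw [show 2 * (m + 1) = (2 * m + 1) + 1 by ring, binomHarmonicSum_succ, ih.2,
        harmonic_succ m, harmonic_succ (2 * m + 1)]
      have : ((-1 : ℚ)) ^ (2 * m + 1 + 1) = 1 := by
        rw [show 2 * m + 1 + 1 = 2 * (m + 1) by ring, pow_mul]; norm_num
      rw [this]
      push_cast
      field_simp
      ring
    refine ⟨e1, ?_⟩
    rw [binomHarmonicSum_succ, e1, harmonic_succ (2 * (m + 1))]
    have : ((-1 : ℚ)) ^ (2 * (m + 1) + 1) = -1 := by
      rw [pow_succ, pow_mul]; norm_num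
    rw [this]
    push_cast
    field_simp
    ring

/-- The shifted sum vanishes for odd `M`; this is why only odd powers of the centered variable
contribute to the pole term. -/
theorem binomHarmonicShiftSum_eq (m : ℕ) :
    binomHarmonicShiftSum (2 * m + 1) = 0 ∧
    binomHarmonicShiftSum (2 * m + 2) = 4 * harmonic (2 * m + 1) - 2 * harmonic m := by
  induction m with
  | zero => constructor <;> norm_num [binomHarmonicShiftSum, sum_range_succ, harmonic_succ]
  | succ m ih =>
    have e1 : binomHarmonicShiftSum (2 * (m + 1) + 1) = 0 := by
      have h1 : ((m : ℚ) + 1) ≠ 0 := Nat.cast_add_one_ne_zero m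
      rw [binomHarmonicShiftSum_succ, (binomHarmonicSum_eq (m + 1)).1,
        show 2 * (m + 1) = 2 * m + 2 by ring, ih.2, harmonic_succ m, harmonic_succ (2 * m + 1)]
      push_cast
      field_simp
      ring
    refine ⟨e1, ?_⟩
    rw [show 2 * (m + 1) + 2 = 2 * (m + 1) + 1 + 1 by ring, binomHarmonicShiftSum_succ, e1,
      (binomHarmonicSum_eq (m + 1)).2]
    ring

/-- The contribution of `x ^ m` to the pole term, where `x` is the variable centered at the
symmetry point of the spectrum: only odd `m` matter. -/
noncomputable def centeredWeight (a : ℂ) (m : ℕ) : ℂ :=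
  if Even m then 0 else a ^ (m + 1) / ((m + 1 : ℕ) / 2 : ℂ) *
    ((harmonic ((m - 1) / 2) : ℂ) / 2 - (harmonic m : ℂ))

theorem centeredWeight_eq (a : ℂ) (m : ℕ) :
    centeredWeight a m = -(a ^ (m + 1) / (2 * (m + 1))) * (binomHarmonicShiftSum (m + 1) : ℂ) := by
  rw [centeredWeight]
  split_ifs with h
  · obtain ⟨j, rfl⟩ := h
    rw [← two_mul, (binomHarmonicShiftSum_eq j).1]
    simp
  · rw [Nat.not_even_iff_odd] at h
    obtain ⟨j, rfl⟩ := h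
    have h1 : ((j : ℂ) + 1) ≠ 0 := Nat.cast_add_one_ne_zero j
    rw [(binomHarmonicShiftSum_eq j).2, show (2 * j + 1 - 1) / 2 = j by omega]
    push_cast
    rw [show 2 * (j : ℂ) + 1 + 1 = 2 * (j + 1) by ring]
    field_simp
    ring

theorem sum_choose_mul_poleWeight (a : ℂ) (m : ℕ) :
    ∑ i ∈ range (m + 1), a ^ (m - i) * (m.choose i : ℂ) *
      ((-(2 * a)) ^ (i + 1) * (harmonic i : ℂ) / (2 * (i + 1))) = -centeredWeight a m := by
  rw [centeredWeight_eq, binomHarmonicShiftSum]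
  push_cast
  rw [neg_mul, neg_neg, mul_sum]
  refine sum_congr rfl fun i hi ↦ ?_
  have hi : i ≤ m := Nat.lt_succ_iff.mp (mem_range.mp hi)
  have h1 : ((i : ℂ) + 1) ≠ 0 := Nat.cast_add_one_ne_zero i
  have h2 : ((m : ℂ) + 1) ≠ 0 := Nat.cast_add_one_ne_zero m
  have h4 : ((m + 1 : ℕ) : ℂ) * (m.choose i : ℂ) = ((m + 1).choose (i + 1) : ℂ) * (i + 1 : ℕ) := by
    exact_mod_cast Nat.add_one_mul_choose_eq m i
  have h5 : a ^ (m + 1) = a ^ (m - i) * a ^ (i + 1) := by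
    rw [← pow_add]; congr 1; omega
  push_cast at h4
  rw [h5, show -(2 * a) = (-2) * a by ring, mul_pow]
  field_simp
  linear_combination a ^ (m - i) * a ^ (i + 1) * (harmonic i : ℂ) * h4

/-- The pole term expressed through the polynomial centered at the symmetry point `a` of the
spectrum. -/
theorem sum_taylor_mul_poleWeight (P : ℂ[X]) (a : ℂ) :
    (taylor a P).sum (fun i q ↦ q * ((-(2 * a)) ^ (i + 1) * (harmonic i : ℂ) / (2 * (i + 1)))) =
      -P.sum fun m p ↦ p * centeredWeight a m := by
  induction P using Polynomial.induction_on' with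
  | add p q hp hq =>
    rw [map_add, sum_add_index _ _ _ (by simp) (by intros; ring),
      sum_add_index _ _ _ (by simp) (by intros; ring), hp, hq]
    ring
  | monomial m r =>
    rw [sum_monomial_index r _ (by simp)]
    have hd : (taylor a (monomial m r)).natDegree < m + 1 := by
      rw [natDegree_taylor]
      exact Nat.lt_succ_of_le (natDegree_monomial_le r)
    rw [sum_over_range' _ (by simp) _ hd, taylor_monomial]
    simp only [coeff_C_mul, coeff_X_add_C_pow]
    simp only [mul_assoc]
    rw [← mul_sum]
    have := sum_choose_mul_poleWeight a m
    simp only [mul_assoc] at this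
    rw [this]
    ring

/-! ### The multiplicity polynomial -/

/-- The polynomial `k (k + 1) ⋯ (k + c - 1) / c!`, whose values are the multiplicities of the
eigenvalues `k (k + c)`. -/
noncomputable def multPoly (c : ℕ) : ℂ[X] := C (1 / (c.factorial : ℂ)) * ascPochhammer ℂ c

/-- The multiplicity polynomial in the variable `k + c`. -/
noncomputable def multPolyShift (c : ℕ) : ℂ[X] :=
  C (1 / (c.factorial : ℂ)) * (descPochhammer ℂ c).comp (X - 1)

theorem multPoly_eval (c k : ℕ) :
    (multPoly c).eval (((k + 1 : ℕ) : ℂ)) = ((k + c).choose c : ℂ) := by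
  have h1 : (c.factorial : ℂ) ≠ 0 := Nat.cast_ne_zero.mpr c.factorial_ne_zero
  rw [multPoly, eval_C_mul, ascPochhammer_nat_eq_natCast_ascFactorial,
    Nat.ascFactorial_eq_factorial_mul_choose]
  push_cast
  field_simp

theorem multPolyShift_eval (c m : ℕ) :
    (multPolyShift c).eval (((m + 1 : ℕ) : ℂ)) = (m.choose c : ℂ) := by
  have h1 : (c.factorial : ℂ) ≠ 0 := Nat.cast_ne_zero.mpr c.factorial_ne_zero
  rw [multPolyShift, eval_C_mul, eval_comp]
  simp only [eval_sub, eval_X, eval_one, Nat.cast_add, Nat.cast_one, add_sub_cancel_right]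
  rw [descPochhammer_eval_eq_descFactorial, Nat.descFactorial_eq_factorial_mul_choose]
  push_cast
  field_simp

theorem natDegree_multPoly (c : ℕ) : (multPoly c).natDegree = c := by
  have h1 : (1 / (c.factorial : ℂ)) ≠ 0 :=
    one_div_ne_zero (Nat.cast_ne_zero.mpr c.factorial_ne_zero)
  rw [multPoly, natDegree_C_mul h1, ascPochhammer_natDegree]

theorem natDegree_multPolyShift (c : ℕ) : (multPolyShift c).natDegree = c := by
  have h1 : (1 / (c.factorial : ℂ)) ≠ 0 :=
    one_div_ne_zero (Nat.cast_ne_zero.mpr c.factorial_ne_zero)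
  rw [multPolyShift, natDegree_C_mul h1, natDegree_comp, descPochhammer_natDegree,
    ← C_1, natDegree_X_sub_C, mul_one]

theorem coeff_descPochhammer_complex (n i : ℕ) :
    (descPochhammer ℂ n).coeff i = (stirlingS n i : ℂ) := by
  rw [stirlingS, ← descPochhammer_map (Int.castRingHom ℂ) n, coeff_map]
  rfl

theorem multPolyShift_coeff (c i : ℕ) :
    (multPolyShift c).coeff i = (stirlingS (c + 1) (i + 1) : ℂ) / (c.factorial : ℂ) := by
  rw [← coeff_descPochhammer_complex, descPochhammer_succ_left, coeff_X_mul, multPolyShift,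
    coeff_C_mul]
  ring

theorem multPoly_coeff (c i : ℕ) :
    (multPoly c).coeff i = (-1) ^ (c + i) * (stirlingS c i : ℂ) / (c.factorial : ℂ) := by
  have h1 : ascPochhammer ℂ c = C ((-1) ^ c) * (descPochhammer ℂ c).comp (C (-1) * X) := by
    refine Polynomial.funext fun x ↦ ?_
    have := ascPochhammer_eval_neg_eq_descPochhammer ℂ (-x) c
    rw [neg_neg] at this
    rw [this]
    simp [eval_comp]
  rw [multPoly, h1, coeff_C_mul, coeff_C_mul, comp_C_mul_X_coeff, coeff_descPochhammer_complex,
    pow_add]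
  ring

/-- The zeta function of the spectrum `k (k + c)` with multiplicities `(k + c - 1 choose c)`,
`k ≥ 1`, written over `k - 1`. -/
theorem exists_zeta_of_multiplicity (c : ℕ) :
    ∃ Z : ℂ → ℂ, Meromorphic Z ∧ AnalyticAt ℂ Z 0 ∧
      (∀ s : ℂ, (c : ℝ) + 2 ≤ s.re → HasSum (fun k : ℕ ↦ ((k + c).choose c : ℂ) *
        (((k + 1) * (k + 1 + c) : ℕ) : ℂ) ^ (-s)) (Z s)) ∧
      deriv Z 0 = 1 / (c.factorial : ℂ) * ∑ k ∈ range (c + 1), deriv riemannZeta (-(k : ℂ)) *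
          ((stirlingS (c + 1) (k + 1) : ℂ) + (-1) ^ (c + k) * (stirlingS c k : ℂ)) +
        ∑ m ∈ range (c + 1), (taylor (-((c : ℂ) / 2)) (multPoly c)).coeff m *
          centeredWeight ((c : ℂ) / 2) m := by
  set W : ℂ → ℂ := fun s ↦
    ∑ i ∈ range (c + 1), (multPolyShift c).coeff i * riemannZeta (s - i) with hW
  have hne : ∀ i : ℕ, (0 : ℂ) - i ≠ 1 := by
    intro i h
    have h2 : (((i + 1 : ℕ)) : ℂ) = 0 := by push_cast; linear_combination -h
    exact absurd (Nat.cast_eq_zero.mp h2) (Nat.succ_ne_zero i)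
  have hWm : Meromorphic W := by
    intro s
    refine MeromorphicAt.fun_sum fun i _ ↦ (MeromorphicAt.const _ _).fun_mul ?_
    simpa [sub_eq_add_neg] using meromorphicAt_riemannZeta_affine 1 (-i) s
  have hW0 : AnalyticAt ℂ W 0 := by
    refine Finset.analyticAt_fun_sum _ fun i _ ↦ analyticAt_const.mul ?_
    exact AnalyticAt.fun_comp (g := riemannZeta) (f := fun s : ℂ ↦ s - i)
      (analyticAt_riemannZeta (hne i)) (by fun_prop)
  have hWd : deriv W 0 = ∑ i ∈ range (c + 1),
      (multPolyShift c).coeff i * deriv riemannZeta (-i) := by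
    refine HasDerivAt.deriv (HasDerivAt.fun_sum fun i _ ↦ HasDerivAt.const_mul _ ?_)
    have h1 : HasDerivAt (fun s : ℂ ↦ riemannZeta (s - i)) (deriv riemannZeta (0 - i) * 1) 0 :=
      (analyticAt_riemannZeta (hne i)).differentiableAt.hasDerivAt.comp (0 : ℂ)
        ((hasDerivAt_id (0 : ℂ)).sub_const (i : ℂ))
    rwa [mul_one, zero_sub] at h1
  have hWs : ∀ s : ℂ, (c : ℝ) + 1 < s.re →
      HasSum (fun k ↦ zetaTerm (multPoly c) c 0 k s) (W s) := by
    intro s hs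
    have h1 := hasSum_eval_mul_cpow (multPolyShift c) (s := s)
      (by rw [natDegree_multPolyShift]; exact hs)
    rw [natDegree_multPolyShift] at h1
    -- The shifted polynomial vanishes at `1, …, c`, so that the series may start at `c + 1`.
    have h2 : ∑ k ∈ range c, (multPolyShift c).eval (((k + 1 : ℕ) : ℂ)) *
        ((k + 1 : ℕ) : ℂ) ^ (-s) = 0 := by
      refine sum_eq_zero fun k hk ↦ ?_
      rw [multPolyShift_eval, Nat.choose_eq_zero_of_lt (mem_range.mp hk)]
      simp
    have h3 := (hasSum_nat_add_iff' c).mpr h1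
    rw [h2, sub_zero] at h3
    suffices e : (fun k ↦ zetaTerm (multPoly c) c 0 k s) = fun k : ℕ ↦
        (multPolyShift c).eval (((k + c + 1 : ℕ) : ℂ)) * ((k + c + 1 : ℕ) : ℂ) ^ (-s) by
      rw [e]; exact h3
    funext k
    rw [zetaTerm, multPoly_eval, multPolyShift_eval, show k + 1 + c = k + c + 1 by ring]
    simp
  obtain ⟨Z, hZm, hZ0, hZs, hZd⟩ := exists_zeta_continuation (multPoly c) c hWm hW0 hWs
  rw [natDegree_multPoly] at hZs hZd
  refine ⟨Z, hZm, hZ0, fun s hs ↦ ?_, ?_⟩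
  · suffices e : (fun k : ℕ ↦ ((k + c).choose c : ℂ) *
        (((k + 1) * (k + 1 + c) : ℕ) : ℂ) ^ (-s)) = fun k ↦ zetaTerm (multPoly c) c 1 k s by
      rw [e]; exact hZs s hs
    funext k
    rw [zetaTerm, multPoly_eval, Nat.cast_mul, Complex.natCast_mul_natCast_cpow]
    simp [mul_assoc]
  · have ht := sum_taylor_mul_poleWeight (taylor (-((c : ℂ) / 2)) (multPoly c)) ((c : ℂ) / 2)
    rw [taylor_taylor, add_neg_cancel, taylor_zero] at ht
    rw [sum_over_range _ (by simp), sum_over_range _ (by simp), natDegree_taylor,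
      natDegree_multPoly, show 2 * ((c : ℂ) / 2) = c by ring] at ht
    rw [hZd, hWd]
    simp only [mul_sub, sum_sub_distrib]
    rw [ht, sub_neg_eq_add, ← add_assoc, ← sum_add_distrib, mul_sum]
    congr 1
    refine sum_congr rfl fun i _ ↦ ?_
    rw [multPolyShift_coeff, multPoly_coeff]
    ring

/-! ### Central factorial numbers -/

/-- The central factorial polynomial of degree `c` divided by its factor `x`. -/
noncomputable def centralProd (c : ℕ) : ℚ[X] :=
  ∏ j ∈ Icc 1 (c - 1), (X + C ((c : ℚ) / 2 - (j : ℚ)))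

theorem centralT_succ {c : ℕ} (hc : c ≠ 0) (k : ℕ) :
    centralT c (k + 1) = (centralProd c).coeff k := by
  rw [centralT, centralFactorialPoly, if_neg hc, coeff_X_mul, centralProd]

theorem centralProd_comp_neg (c : ℕ) :
    (centralProd c).comp (C (-1) * X) = C ((-1) ^ (c - 1)) * centralProd c := by
  have h1 : (centralProd c).comp (C (-1) * X) =
      ∏ j ∈ Icc 1 (c - 1), (C (-1) * (X + C ((c : ℚ) / 2 - (j : ℚ)))) := by
    rw [centralProd, Polynomial.prod_comp]
    refine prod_nbij' (fun j ↦ c - j) (fun j ↦ c - j) ?_ ?_ ?_ ?_ ?_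
    · intro j hj; simp only [mem_Icc] at hj ⊢; omega
    · intro j hj; simp only [mem_Icc] at hj ⊢; omega
    · intro j hj; simp only [mem_Icc] at hj; omega
    · intro j hj; simp only [mem_Icc] at hj; omega
    · intro j hj
      simp only [mem_Icc] at hj
      rw [Nat.cast_sub (by omega), mul_add, ← C_mul, add_comp, X_comp, C_comp]
      congr 2
      ring
  rw [h1, prod_mul_distrib, prod_const, Nat.card_Icc, Nat.add_sub_cancel, ← C_pow, centralProd]

/-- `centralProd c` has the parity of `c - 1`. -/
theorem centralProd_coeff_eq_zero {c i : ℕ} (hc : c ≠ 0) (h : Even (c + i)) :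
    (centralProd c).coeff i = 0 := by
  have h1 := congrArg (fun p ↦ coeff p i) (centralProd_comp_neg c)
  simp only [comp_C_mul_X_coeff, coeff_C_mul] at h1
  have h2 : (-1 : ℚ) ^ (c - 1) * (-1) ^ i = -1 := by
    rw [← pow_add]
    refine Odd.neg_one_pow ?_
    rw [show c - 1 + i = c + i - 1 by omega]
    exact Nat.Even.sub_odd (by omega) h odd_one
  have h3 : ((-1 : ℚ) ^ i) * (-1) ^ i = 1 := by rw [← mul_pow]; norm_num
  have h4 : (centralProd c).coeff i * ((-1 : ℚ) ^ i * (-1) ^ i) =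
      (-1 : ℚ) ^ (c - 1) * (-1) ^ i * (centralProd c).coeff i := by
    rw [← mul_assoc, h1]; ring
  rw [h2, h3] at h4
  linarith

/-- The multiplicity polynomial, centered at the symmetry point of the spectrum. -/
theorem taylor_multPoly {c : ℕ} (hc : c ≠ 0) :
    taylor (-((c : ℂ) / 2)) (multPoly c) = C (1 / (c.factorial : ℂ)) *
      ((X - C ((c : ℂ) / 2)) * (centralProd c).map (algebraMap ℚ ℂ)) := by
  have hprod : ∀ (n : ℕ) (x : ℂ), (ascPochhammer ℂ n).eval x = ∏ i ∈ range n, (x + i) := by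
    intro n x
    induction n with
    | zero => simp
    | succ n ih => rw [ascPochhammer_succ_eval, ih, prod_range_succ]
  obtain ⟨b, rfl⟩ := Nat.exists_eq_succ_of_ne_zero hc
  refine Polynomial.funext fun x ↦ ?_
  rw [taylor_eval, multPoly, eval_C_mul, eval_C_mul, hprod, eval_mul, centralProd,
    Polynomial.map_prod, eval_prod, prod_range_succ']
  congr 1
  rw [mul_comm]
  congr 1
  · simp [sub_eq_add_neg]
  · refine prod_nbij' (fun j ↦ b - j) (fun j ↦ b - j) ?_ ?_ ?_ ?_ ?_
    · intro j hj; simp only [mem_Icc, mem_range] at hj ⊢; omega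
    · intro j hj; simp only [mem_Icc, mem_range] at hj ⊢; omega
    · intro j hj; simp only [mem_range] at hj; omega
    · intro j hj; simp only [mem_Icc] at hj; omega
    · intro j hj
      simp only [mem_range] at hj
      have h : ((b - j : ℕ) : ℚ) = b - j := Nat.cast_sub hj.le
      rw [Polynomial.map_add, map_X, map_C, eval_add, eval_X, eval_C, h]
      simp only [map_sub, map_div₀, map_natCast, map_ofNat, Nat.succ_eq_add_one]
      push_cast
      ring

theorem taylor_multPoly_coeff {c : ℕ} (hc : c ≠ 0) (i : ℕ) :
    (taylor (-((c : ℂ) / 2)) (multPoly c)).coeff (i + 1) = 1 / (c.factorial : ℂ) *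
      (((centralProd c).coeff i : ℂ) - (c : ℂ) / 2 * ((centralProd c).coeff (i + 1) : ℂ)) := by
  rw [taylor_multPoly hc, coeff_C_mul, sub_mul, coeff_sub, coeff_X_mul, coeff_C_mul, coeff_map,
    coeff_map]
  rfl

theorem sum_range_two_mul_of_even_eq_zero {f : ℕ → ℂ} (hf : ∀ m, Even m → f m = 0) (n : ℕ) :
    ∑ m ∈ range (2 * n), f m = ∑ i ∈ Icc 1 n, f (2 * i - 1) := by
  induction n with
  | zero => simp
  | succ n ih =>
    rw [show 2 * (n + 1) = 2 * n + 1 + 1 by ring, sum_range_succ, sum_range_succ, ih,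
      hf (2 * n) (by simp), add_zero, sum_Icc_succ_top (by omega),
      show 2 * (n + 1) - 1 = 2 * n + 1 by omega]

theorem centeredWeight_odd (a : ℂ) {i : ℕ} (hi : 1 ≤ i) :
    centeredWeight a (2 * i - 1) =
      a ^ (2 * i) / i * ((harmonic (i - 1) : ℂ) / 2 - (harmonic (2 * i - 1) : ℂ)) := by
  have h1 : ¬ Even (2 * i - 1) := by
    rw [Nat.not_even_iff_odd]; exact ⟨i - 1, by omega⟩
  rw [centeredWeight, if_neg h1, show 2 * i - 1 + 1 = 2 * i by omega,
    show (2 * i - 1 - 1) / 2 = i - 1 by omega]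
  push_cast
  rw [mul_div_cancel_left₀ _ two_ne_zero]

/-- The pole term of the hemisphere of odd dimension `2 n - 1`, in central factorial numbers. -/
theorem poleTerm_odd_dim {n : ℕ} (hn : 1 ≤ n) :
    ∑ m ∈ range (2 * n - 2 + 1),
        (taylor (-(((2 * n - 2 : ℕ) : ℂ) / 2)) (multPoly (2 * n - 2))).coeff m *
          centeredWeight (((2 * n - 2 : ℕ) : ℂ) / 2) m =
      -∑ i ∈ Icc 1 (n - 1), (uBar (n - 1) i : ℂ) *
        (((n : ℂ) - 1) ^ (2 * i + 1) / (2 * (i : ℂ))) *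
        ((harmonic (i - 1) : ℂ) / 2 - (harmonic (2 * i - 1) : ℂ)) := by
  obtain ⟨b, rfl⟩ : ∃ b, n = b + 1 := ⟨n - 1, by omega⟩
  rw [show 2 * (b + 1) - 2 = 2 * b by omega, Nat.add_sub_cancel, sum_range_succ,
    sum_range_two_mul_of_even_eq_zero (fun m hm ↦ by simp [centeredWeight, hm])]
  rw [show centeredWeight (((2 * b : ℕ) : ℂ) / 2) (2 * b) = 0 by simp [centeredWeight], mul_zero,
    add_zero, ← sum_neg_distrib]
  refine sum_congr rfl fun i hi ↦ ?_
  obtain ⟨hi1, hi2⟩ := mem_Icc.mp hi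
  obtain ⟨j, rfl⟩ : ∃ j, i = j + 1 := ⟨i - 1, by omega⟩
  have hc : 2 * b ≠ 0 := by omega
  rw [centeredWeight_odd _ hi1, show 2 * (j + 1) - 1 = 2 * j + 1 by omega,
    taylor_multPoly_coeff hc, centralProd_coeff_eq_zero hc (i := 2 * j) ⟨b + j, by ring⟩,
    uBar, centralU, show 2 * (j + 1) = 2 * j + 1 + 1 by ring, centralT_succ hc]
  have h1 : ((j : ℂ) + 1) ≠ 0 := Nat.cast_add_one_ne_zero j
  have h2 : ((2 * b).factorial : ℂ) ≠ 0 := Nat.cast_ne_zero.mpr (Nat.factorial_ne_zero _)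
  push_cast
  rw [show 2 * (b : ℂ) / 2 = b by ring, show (b : ℂ) + 1 - 1 = b by ring]
  field_simp
  ring

/-- The pole term of the hemisphere of even dimension `2 n`, in central factorial numbers. -/
theorem poleTerm_even_dim {n : ℕ} (hn : 1 ≤ n) :
    ∑ m ∈ range (2 * n - 1 + 1),
        (taylor (-(((2 * n - 1 : ℕ) : ℂ) / 2)) (multPoly (2 * n - 1))).coeff m *
          centeredWeight (((2 * n - 1 : ℕ) : ℂ) / 2) m =
      ∑ i ∈ Icc 1 n, (vBar n i : ℂ) *
        ((2 * (n : ℂ) - 1) ^ (2 * i) / (4 * (i : ℂ))) *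
        ((harmonic (i - 1) : ℂ) / 2 - (harmonic (2 * i - 1) : ℂ)) := by
  rw [Nat.sub_add_cancel (by omega),
    sum_range_two_mul_of_even_eq_zero (fun m hm ↦ by simp [centeredWeight, hm])]
  refine sum_congr rfl fun i hi ↦ ?_
  obtain ⟨hi1, hi2⟩ := mem_Icc.mp hi
  obtain ⟨j, rfl⟩ : ∃ j, i = j + 1 := ⟨i - 1, by omega⟩
  have hc : 2 * n - 1 ≠ 0 := by omega
  rw [centeredWeight_odd _ hi1, show 2 * (j + 1) - 1 = 2 * j + 1 by omega,
    taylor_multPoly_coeff hc,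
    centralProd_coeff_eq_zero hc (i := 2 * j + 1) ⟨n + j, by omega⟩,
    vBar, centralV, show 2 * (j + 1) - 1 = 2 * j + 1 by omega, centralT_succ hc]
  have h1 : ((j : ℂ) + 1) ≠ 0 := Nat.cast_add_one_ne_zero j
  have h2 : ((2 * n - 1).factorial : ℂ) ≠ 0 := Nat.cast_ne_zero.mpr (Nat.factorial_ne_zero _)
  have h4 : ((2 * n - 1 : ℕ) : ℂ) = 2 * n - 1 := by
    rw [Nat.cast_sub (by omega)]; push_cast; ring
  obtain ⟨b, rfl⟩ : ∃ b, n = b + 1 := ⟨n - 1, by omega⟩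
  have h5 : (4 : ℂ) ^ (((b + 1 : ℕ) : ℤ) - ((j + 1 : ℕ) : ℤ)) = 4 ^ b / 4 ^ j := by
    rw [show (((b + 1 : ℕ) : ℤ) - ((j + 1 : ℕ) : ℤ)) = (b : ℤ) - j by push_cast; ring,
      zpow_sub₀ (by norm_num), zpow_natCast, zpow_natCast]
  rw [h4, div_pow, pow_mul (2 : ℂ) 2 (j + 1)]
  norm_num only [Rat.cast_mul, Rat.cast_div, Rat.cast_pow, Rat.cast_zpow, Rat.cast_natCast,
    Rat.cast_one, Rat.cast_zero, Rat.cast_ofNat, Nat.add_sub_cancel, mul_zero, sub_zero]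
  rw [h5]
  push_cast
  rw [pow_succ (4 : ℂ) j]
  field_simp

/-! ### Reality of the derivative -/

theorem deriv_riemannZeta_im (k : ℕ) : (deriv riemannZeta (-(k : ℂ))).im = 0 := by
  have h1 : (starRingEnd ℂ) ∘ riemannZeta ∘ (starRingEnd ℂ) = riemannZeta := by
    funext s
    simp [riemannZeta_conj]
  have h2 := congrFun (deriv_conj_conj (f := riemannZeta)) (-(k : ℂ))
  rw [h1] at h2
  refine Complex.conj_eq_iff_im.mp ?_
  simpa using h2.symm

end Hemisphere

namespace Hemisphere
open MvPolynomial

/-! ### Harmonic polynomials vanishing on a hyperplane -/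

section PolyLaplacian

variable {σ : Type*} [Fintype σ]

/-- The Laplacian of a real polynomial. -/
noncomputable def polyLaplacian : MvPolynomial σ ℝ →ₗ[ℝ] MvPolynomial σ ℝ :=
  ∑ i, (pderiv i).toLinearMap ∘ₗ (pderiv i).toLinearMap

theorem polyLaplacian_apply (p : MvPolynomial σ ℝ) :
    polyLaplacian p = ∑ i, pderiv i (pderiv i p) := by
  simp [polyLaplacian]

theorem polyLaplacian_C_mul (a : ℝ) (p : MvPolynomial σ ℝ) :
    polyLaplacian (C a * p) = C a * polyLaplacian p := by
  rw [← smul_eq_C_mul, map_smul, smul_eq_C_mul]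

theorem polyLaplacian_mul (p q : MvPolynomial σ ℝ) :
    polyLaplacian (p * q) =
      polyLaplacian p * q + 2 * ∑ i, pderiv i p * pderiv i q + p * polyLaplacian q := by
  simp only [polyLaplacian_apply, pderiv_mul, map_add, Finset.sum_add_distrib]
  rw [Finset.sum_mul, Finset.mul_sum _ _ p]
  ring

theorem pderiv_comm {σ : Type*} (i j : σ) (p : MvPolynomial σ ℝ) :
    pderiv i (pderiv j p) = pderiv j (pderiv i p) := by
  classical
  induction p using MvPolynomial.induction_on with
  | C a => simp
  | add p q hp hq => simp [hp, hq]
  | mul_X p k h =>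
    simp only [pderiv_mul, map_add, h, pderiv_X, Pi.single_apply]
    split_ifs <;> simp [add_comm, add_left_comm]

theorem polyLaplacian_pderiv (i : σ) (p : MvPolynomial σ ℝ) :
    polyLaplacian (pderiv i p) = pderiv i (polyLaplacian p) := by
  simp only [polyLaplacian_apply, map_sum]
  refine Finset.sum_congr rfl fun j _ ↦ ?_
  rw [pderiv_comm j i p, pderiv_comm j i]

theorem sum_pderiv_X_mul (j : σ) (c : MvPolynomial σ ℝ) (f : σ → MvPolynomial σ ℝ) :
    ∑ i, c * pderiv i (X j) * f i = c * f j := by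
  classical
  rw [Finset.sum_eq_single j]
  · simp
  · intro i _ hij; rw [pderiv_X_of_ne hij.symm]; ring
  · simp

theorem polyLaplacian_X (j : σ) : polyLaplacian (X j : MvPolynomial σ ℝ) = 0 := by
  classical
  rw [polyLaplacian_apply]
  refine Finset.sum_eq_zero fun i _ ↦ ?_
  rw [pderiv_X, Pi.single_apply]
  split_ifs <;> simp

theorem polyLaplacian_X_mul (j : σ) (p : MvPolynomial σ ℝ) :
    polyLaplacian (X j * p) = 2 * pderiv j p + X j * polyLaplacian p := by
  have h := sum_pderiv_X_mul j 1 fun i ↦ pderiv i p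
  simp only [one_mul] at h
  rw [polyLaplacian_mul, polyLaplacian_X, h]
  ring

theorem polyLaplacian_X_pow_mul (j : σ) (a : ℕ) (p : MvPolynomial σ ℝ) :
    polyLaplacian (X j ^ (a + 2) * p) = X j ^ a * (C (((a : ℝ) + 2) * (a + 1)) * p +
      C (2 * ((a : ℝ) + 2)) * X j * pderiv j p + X j ^ 2 * polyLaplacian p) := by
  have h0 : ∀ n : ℕ, polyLaplacian (X j ^ (n + 1) : MvPolynomial σ ℝ) =
      C (((n : ℝ) + 1) * n) * X j ^ (n - 1) := by
    intro n
    induction n with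
    | zero => simp [polyLaplacian_X]
    | succ n ih =>
      rw [pow_succ', polyLaplacian_X_mul, ih, pderiv_pow, pderiv_X_self]
      have hn : (C (n : ℝ) : MvPolynomial σ ℝ) = n := map_natCast C n
      rcases n with _ | n
      · simp only [zero_add, Nat.cast_zero, mul_zero, Nat.cast_one, one_add_one_eq_two, C_0]
        simp [show (C 2 : MvPolynomial σ ℝ) = 2 from map_ofNat C 2]
      · simp only [Nat.add_sub_cancel, pow_succ, C_add, C_mul, C_1, Nat.cast_add, Nat.cast_one]
          at hn ⊢
        rw [← hn]
        ring
  have h1 := sum_pderiv_X_mul j (((a + 2 : ℕ) : MvPolynomial σ ℝ) * X j ^ (a + 1))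
    fun i ↦ pderiv i p
  have h2 : ∀ i, pderiv i (X j ^ (a + 2) : MvPolynomial σ ℝ) =
      ((a + 2 : ℕ) : MvPolynomial σ ℝ) * X j ^ (a + 1) * pderiv i (X j) := by
    intro i; rw [pderiv_pow]; rfl
  rw [polyLaplacian_mul, h0 (a + 1)]
  simp only [h2, h1]
  simp only [Nat.add_sub_cancel, map_add, map_mul, map_natCast, map_one, map_ofNat]
  push_cast
  ring

/-- A harmonic polynomial with vanishing Cauchy data on a coordinate hyperplane is zero. -/
theorem eq_zero_of_X_sq_dvd {p : MvPolynomial σ ℝ} {j : σ} (hp : polyLaplacian p = 0)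
    (h : X j ^ 2 ∣ p) : p = 0 := by
  have key : ∀ a : ℕ, X j ^ (a + 2) ∣ p := by
    intro a
    induction a with
    | zero => exact h
    | succ a ih =>
      obtain ⟨r, rfl⟩ := ih
      rw [polyLaplacian_X_pow_mul] at hp
      have h1 := (mul_eq_zero.mp hp).resolve_left (pow_ne_zero _ (X_ne_zero j))
      have h2 : ((a : ℝ) + 2) * (a + 1) ≠ 0 := by positivity
      have h3 : X j ∣ r := by
        have h4 : X j ∣ C (((a : ℝ) + 2) * (a + 1)) * r :=
          ⟨-(C (2 * ((a : ℝ) + 2)) * pderiv j r + X j * polyLaplacian r),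
            by linear_combination h1⟩
        have h5 : C (1 / (((a : ℝ) + 2) * (a + 1))) * (C (((a : ℝ) + 2) * (a + 1)) * r) = r := by
          rw [← mul_assoc, ← C_mul, one_div_mul_cancel h2, C_1, one_mul]
        rw [← h5]
        exact h4.mul_left _
      obtain ⟨t, rfl⟩ := h3
      exact ⟨t, by ring⟩
  by_contra hne
  have hu : ¬ IsUnit (X j : MvPolynomial σ ℝ) := X_prime.not_isUnit
  obtain ⟨n, hn⟩ := FiniteMultiplicity.of_not_isUnit hu hne
  exact hn ((pow_dvd_pow _ (by omega)).trans (key n))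

/-- The polynomial `|y|²`. -/
noncomputable def normSqPoly : MvPolynomial σ ℝ := ∑ i, X i ^ 2

theorem pderiv_normSqPoly (j : σ) : pderiv j (normSqPoly : MvPolynomial σ ℝ) = 2 * X j := by
  classical
  rw [normSqPoly, map_sum, Finset.sum_eq_single j]
  · rw [pderiv_pow, pderiv_X_self]; simp
  · intro i _ hij; rw [pderiv_pow, pderiv_X_of_ne hij]; simp
  · simp

theorem polyLaplacian_normSqPoly_mul {m : ℕ} {p : MvPolynomial σ ℝ} (hp : p.IsHomogeneous m) :
    polyLaplacian (normSqPoly * p) =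
      C (2 * (Fintype.card σ : ℝ) + 4 * m) * p + normSqPoly * polyLaplacian p := by
  have h1 : polyLaplacian (normSqPoly : MvPolynomial σ ℝ) = C (2 * (Fintype.card σ : ℝ)) := by
    rw [polyLaplacian_apply]
    have : ∀ i : σ, pderiv i (pderiv i (normSqPoly : MvPolynomial σ ℝ)) = C 2 := by
      intro i
      rw [pderiv_normSqPoly, show (2 : MvPolynomial σ ℝ) = C 2 from (map_ofNat C 2).symm,
        pderiv_C_mul, pderiv_X_self, mul_one]
    simp [this, mul_comm]
  have h2 : ∑ i, pderiv i (normSqPoly : MvPolynomial σ ℝ) * pderiv i p = 2 * (m • p) := by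
    rw [← hp.sum_X_mul_pderiv, Finset.mul_sum]
    refine Finset.sum_congr rfl fun i _ ↦ ?_
    rw [pderiv_normSqPoly]; ring
  rw [polyLaplacian_mul, h1, h2, nsmul_eq_mul]
  simp only [C_add, C_mul, map_natCast, map_ofNat]
  ring

theorem isHomogeneous_normSqPoly : (normSqPoly : MvPolynomial σ ℝ).IsHomogeneous 2 :=
  IsHomogeneous.sum _ _ _ fun i _ ↦ isHomogeneous_X_pow i 2

end PolyLaplacian

variable {d : ℕ}

/-- Restriction of a polynomial to the hyperplane where the last coordinate vanishes. -/
noncomputable def restrictLast (d : ℕ) :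
    MvPolynomial (Fin (d + 1)) ℝ →ₐ[ℝ] MvPolynomial (Fin d) ℝ :=
  aeval (Fin.lastCases 0 X)

theorem restrictLast_X_last : restrictLast d (X (Fin.last d)) = 0 := by simp [restrictLast]

theorem restrictLast_X_castSucc (i : Fin d) : restrictLast d (X i.castSucc) = X i := by
  simp [restrictLast]

theorem restrictLast_rename (q : MvPolynomial (Fin d) ℝ) :
    restrictLast d (rename Fin.castSucc q) = q := by
  induction q using MvPolynomial.induction_on with
  | C a => simp [restrictLast]
  | add p q hp hq => simp [hp, hq]
  | mul_X p i h => rw [map_mul, map_mul, h, rename_X, restrictLast_X_castSucc]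

theorem X_last_dvd_sub (p : MvPolynomial (Fin (d + 1)) ℝ) :
    X (Fin.last d) ∣ p - rename Fin.castSucc (restrictLast d p) := by
  induction p using MvPolynomial.induction_on with
  | C a => simp [restrictLast]
  | add p q hp hq =>
    rw [map_add, map_add, add_sub_add_comm]
    exact dvd_add hp hq
  | mul_X p i h =>
    rw [map_mul, map_mul]
    induction i using Fin.lastCases with
    | last => rw [restrictLast_X_last, map_zero, mul_zero, sub_zero]; exact dvd_mul_left _ _
    | cast i => rw [restrictLast_X_castSucc, rename_X, ← sub_mul]; exact h.mul_right _

theorem X_last_dvd_iff {p : MvPolynomial (Fin (d + 1)) ℝ} :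
    X (Fin.last d) ∣ p ↔ restrictLast d p = 0 := by
  constructor
  · rintro ⟨r, rfl⟩
    rw [map_mul, restrictLast_X_last, zero_mul]
  · intro h
    simpa [h] using X_last_dvd_sub p

theorem isHomogeneous_restrictLast {p : MvPolynomial (Fin (d + 1)) ℝ} {m : ℕ}
    (hp : p.IsHomogeneous m) : (restrictLast d p).IsHomogeneous m := by
  have h := hp.aeval (n := 1) (Fin.lastCases 0 X : Fin (d + 1) → MvPolynomial (Fin d) ℝ) (by
    intro i
    induction i using Fin.lastCases with
    | last => simpa using isHomogeneous_zero _ _ _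
    | cast i => simpa using isHomogeneous_X _ _)
  rwa [one_mul] at h

/-- The harmonic polynomials in `d + 1` variables, homogeneous of degree `k`, that vanish where
the last coordinate does. -/
noncomputable def dirichletHarmonics (d k : ℕ) : Submodule ℝ (MvPolynomial (Fin (d + 1)) ℝ) :=
  homogeneousSubmodule (Fin (d + 1)) ℝ k ⊓ LinearMap.ker polyLaplacian ⊓
    LinearMap.ker (restrictLast d).toLinearMap

theorem mem_dirichletHarmonics {k : ℕ} {p : MvPolynomial (Fin (d + 1)) ℝ} :
    p ∈ dirichletHarmonics d k ↔
      p.IsHomogeneous k ∧ polyLaplacian p = 0 ∧ X (Fin.last d) ∣ p := by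
  rw [X_last_dvd_iff]
  simp [dirichletHarmonics, Submodule.mem_inf, mem_homogeneousSubmodule, and_assoc]

instance finiteDimensional_dirichletHarmonics (d k : ℕ) :
    FiniteDimensional ℝ (dirichletHarmonics d k) := by
  have : FiniteDimensional ℝ (homogeneousSubmodule (Fin (d + 1)) ℝ k) :=
    Module.Finite.iff_fg.mpr (homogeneousSubmodule_fg _ _ k)
  exact Submodule.finiteDimensional_of_le
    (inf_le_left.trans inf_le_left : dirichletHarmonics d k ≤ homogeneousSubmodule _ ℝ k)

theorem pderiv_mem_dirichletHarmonics {k : ℕ} {p : MvPolynomial (Fin (d + 1)) ℝ}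
    (hp : p ∈ dirichletHarmonics d (k + 1)) (i : Fin d) :
    pderiv i.castSucc p ∈ dirichletHarmonics d k := by
  rw [mem_dirichletHarmonics] at hp ⊢
  obtain ⟨h1, h2, r, rfl⟩ := hp
  refine ⟨h1.pderiv, by rw [polyLaplacian_pderiv, h2, map_zero], ⟨pderiv i.castSucc r, ?_⟩⟩
  rw [pderiv_mul, pderiv_X_of_ne (Fin.castSucc_lt_last i).ne']
  ring

/-- Multiplication by a coordinate, corrected by a multiple of `|y|²` to be harmonic. -/
theorem X_mul_sub_mem_dirichletHarmonics {k : ℕ} {p : MvPolynomial (Fin (d + 1)) ℝ}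
    (hp : p ∈ dirichletHarmonics d (k + 1)) (i : Fin d) :
    X i.castSucc * p - normSqPoly * (C (1 / ((d : ℝ) + 2 * k + 1)) * pderiv i.castSucc p) ∈
      dirichletHarmonics d (k + 2) := by
  have hd := pderiv_mem_dirichletHarmonics hp i
  rw [mem_dirichletHarmonics] at hp hd ⊢
  obtain ⟨h1, h2, h3⟩ := hp
  obtain ⟨g1, g2, g3⟩ := hd
  have g4 := g1.C_mul (1 / ((d : ℝ) + 2 * k + 1))
  refine ⟨?_, ?_, ?_⟩
  · refine IsHomogeneous.sub ?_ ?_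
    · rw [show k + 2 = 1 + (k + 1) by ring]; exact (isHomogeneous_X _ _).mul h1
    · rw [show k + 2 = 2 + k by ring]; exact isHomogeneous_normSqPoly.mul g4
  · have e : (d : ℝ) + 2 * k + 1 ≠ 0 := by positivity
    rw [map_sub, polyLaplacian_X_mul, h2, polyLaplacian_normSqPoly_mul g4,
      polyLaplacian_C_mul, g2, Fintype.card_fin, ← mul_assoc, ← C_mul]
    have e2 : (2 * ((d + 1 : ℕ) : ℝ) + 4 * k) * (1 / ((d : ℝ) + 2 * k + 1)) = 2 := by
      push_cast; field_simp; ring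
    rw [e2, show (C 2 : MvPolynomial (Fin (d + 1)) ℝ) = 2 from map_ofNat C 2]
    simp
  · exact dvd_sub (h3.mul_left _) ((g3.mul_left _).mul_left _)

/-- The Cauchy-Kovalevskaya solution of Laplace's equation with value `0` and normal derivative
`q` on the hyperplane, truncated after `M` terms. -/
noncomputable def harmonicExt (M : ℕ) (q : MvPolynomial (Fin d) ℝ) :
    MvPolynomial (Fin (d + 1)) ℝ :=
  ∑ j ∈ Finset.range M, C ((-1) ^ j / ((2 * j + 1).factorial : ℝ)) *
    (X (Fin.last d) ^ (2 * j + 1) * rename Fin.castSucc (polyLaplacian^[j] q))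

theorem pderiv_last_rename (q : MvPolynomial (Fin d) ℝ) :
    pderiv (Fin.last d) (rename Fin.castSucc q) = 0 := by
  induction q using MvPolynomial.induction_on with
  | C a => simp
  | add p q hp hq => simp [hp, hq]
  | mul_X p i h =>
    rw [map_mul, pderiv_mul, h, rename_X, pderiv_X_of_ne (Fin.castSucc_lt_last i).ne]
    ring

theorem polyLaplacian_rename (q : MvPolynomial (Fin d) ℝ) :
    polyLaplacian (rename Fin.castSucc q) = rename Fin.castSucc (polyLaplacian q) := by
  rw [polyLaplacian_apply, Fin.sum_univ_castSucc, pderiv_last_rename, map_zero, add_zero,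
    polyLaplacian_apply, map_sum]
  refine Finset.sum_congr rfl fun i _ ↦ ?_
  rw [pderiv_rename (Fin.castSucc_injective d), pderiv_rename (Fin.castSucc_injective d)]

/-- The sum telescopes under the Laplacian, up to its last term. -/
theorem polyLaplacian_harmonicExt (M : ℕ) (q : MvPolynomial (Fin d) ℝ) :
    polyLaplacian (harmonicExt (M + 1) q) = C ((-1) ^ M / ((2 * M + 1).factorial : ℝ)) *
      (X (Fin.last d) ^ (2 * M + 1) * rename Fin.castSucc (polyLaplacian^[M + 1] q)) := by
  induction M with
  | zero =>
    simp only [harmonicExt, zero_add, Finset.range_one, Finset.sum_singleton, mul_zero, pow_zero,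
      Nat.factorial_one, Nat.cast_one, div_one, C_1, one_mul, pow_one, Function.iterate_zero_apply,
      Function.iterate_one]
    rw [polyLaplacian_X_mul, pderiv_last_rename, polyLaplacian_rename]
    ring
  | succ M ih =>
    have h1 : harmonicExt (M + 1 + 1) q = harmonicExt (M + 1) q +
        C ((-1) ^ (M + 1) / ((2 * (M + 1) + 1).factorial : ℝ)) *
        (X (Fin.last d) ^ (2 * (M + 1) + 1) * rename Fin.castSucc (polyLaplacian^[M + 1] q)) := by
      rw [harmonicExt, Finset.sum_range_succ]; rfl
    have h2 : ((2 * (M + 1) + 1).factorial : ℝ) =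
        (2 * M + 1 + 2) * (2 * M + 1 + 1) * ((2 * M + 1).factorial : ℝ) := by
      rw [show 2 * (M + 1) + 1 = 2 * M + 1 + 1 + 1 by ring, Nat.factorial_succ, Nat.factorial_succ]
      push_cast; ring
    have h3 : ((2 * M + 1).factorial : ℝ) ≠ 0 := Nat.cast_ne_zero.mpr (Nat.factorial_ne_zero _)
    have h4 : (-1 : ℝ) ^ (M + 1) / ((2 * (M + 1) + 1).factorial : ℝ) *
        ((((2 * M + 1 : ℕ) : ℝ) + 2) * (((2 * M + 1 : ℕ) : ℝ) + 1)) =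
        -((-1) ^ M / ((2 * M + 1).factorial : ℝ)) := by
      have : (2 * (M : ℝ) + 1 + 2) ≠ 0 := by positivity
      have : (2 * (M : ℝ) + 1 + 1) ≠ 0 := by positivity
      rw [h2, pow_succ]; push_cast; field_simp
    rw [h1, map_add, ih, polyLaplacian_C_mul,
      show 2 * (M + 1) + 1 = 2 * M + 1 + 2 by ring, polyLaplacian_X_pow_mul, pderiv_last_rename,
      polyLaplacian_rename, Function.iterate_succ_apply' _ (M + 1)]
    rw [show 2 * M + 1 + 2 = 2 * (M + 1) + 1 by ring]
    have h5 := congrArg (C : ℝ → MvPolynomial (Fin (d + 1)) ℝ) h4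
    simp only [C_mul, C_neg] at h5 ⊢
    rw [show 2 * (M + 1) + 1 = 2 * M + 1 + 2 by ring] at h5 ⊢
    linear_combination X (Fin.last d) ^ (2 * M + 1) *
      rename Fin.castSucc (polyLaplacian^[M + 1] q) * h5

theorem isHomogeneous_polyLaplacian {q : MvPolynomial (Fin d) ℝ} {m : ℕ}
    (hq : q.IsHomogeneous m) : (polyLaplacian q).IsHomogeneous (m - 2) := by
  rw [polyLaplacian_apply]
  exact IsHomogeneous.sum _ _ _ fun i _ ↦ hq.pderiv.pderiv

theorem polyLaplacian_eq_zero {q : MvPolynomial (Fin d) ℝ} {m : ℕ}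
    (hq : q.IsHomogeneous m) (hm : m < 2) : polyLaplacian q = 0 := by
  rw [polyLaplacian_apply]
  refine Finset.sum_eq_zero fun i _ ↦ ?_
  have h : (pderiv i q).IsHomogeneous 0 := by
    have := hq.pderiv (i := i)
    rwa [show m - 1 = 0 by omega] at this
  rw [← totalDegree_zero_iff_isHomogeneous, totalDegree_eq_zero_iff_eq_C] at h
  rw [h, pderiv_C]

theorem iterate_polyLaplacian {q : MvPolynomial (Fin d) ℝ} {m : ℕ}
    (hq : q.IsHomogeneous m) (j : ℕ) : (polyLaplacian^[j] q).IsHomogeneous (m - 2 * j) ∧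
      (m < 2 * j → polyLaplacian^[j] q = 0) := by
  induction j with
  | zero => exact ⟨hq, fun h ↦ by omega⟩
  | succ j ih =>
    rw [Function.iterate_succ_apply']
    refine ⟨isHomogeneous_polyLaplacian ih.1, fun h ↦ ?_⟩
    exact polyLaplacian_eq_zero ih.1 (by omega)

theorem harmonicExt_mem {q : MvPolynomial (Fin d) ℝ} {m : ℕ} (hq : q.IsHomogeneous m) :
    harmonicExt (m + 1) q ∈ dirichletHarmonics d (m + 1) := by
  rw [mem_dirichletHarmonics]
  refine ⟨?_, ?_, ?_⟩
  · refine IsHomogeneous.sum _ _ _ fun j _ ↦ IsHomogeneous.C_mul ?_ _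
    obtain ⟨h1, h2⟩ := iterate_polyLaplacian hq j
    by_cases hj : m < 2 * j
    · rw [h2 hj, map_zero, mul_zero]; exact isHomogeneous_zero _ _ _
    · rw [show m + 1 = 2 * j + 1 + (m - 2 * j) by omega]
      exact (isHomogeneous_X_pow _ _).mul h1.rename_isHomogeneous
  · rw [polyLaplacian_harmonicExt, (iterate_polyLaplacian hq (m + 1)).2 (by omega), map_zero,
      mul_zero, mul_zero]
  · refine Finset.dvd_sum fun j _ ↦ Dvd.dvd.mul_left (Dvd.dvd.mul_right ?_ _) _
    exact dvd_pow_self _ (by omega)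

/-- The normal derivative on the hyperplane where the last coordinate vanishes. -/
noncomputable def normalDeriv (d : ℕ) :
    MvPolynomial (Fin (d + 1)) ℝ →ₗ[ℝ] MvPolynomial (Fin d) ℝ :=
  (restrictLast d).toLinearMap ∘ₗ (pderiv (Fin.last d)).toLinearMap

theorem normalDeriv_harmonicExt (M : ℕ) (q : MvPolynomial (Fin d) ℝ) :
    normalDeriv d (harmonicExt (M + 1) q) = q := by
  have h : ∀ j, normalDeriv d (C ((-1) ^ j / ((2 * j + 1).factorial : ℝ)) *
      (X (Fin.last d) ^ (2 * j + 1) * rename Fin.castSucc (polyLaplacian^[j] q))) =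
      if j = 0 then q else 0 := by
    intro j
    simp only [normalDeriv, LinearMap.comp_apply, AlgHom.toLinearMap_apply, Derivation.coeFn_coe]
    rw [pderiv_C_mul, pderiv_mul, pderiv_last_rename, pderiv_pow, pderiv_X_self]
    split_ifs with h0
    · subst h0; simp [restrictLast_rename]
    · simp [restrictLast_X_last, h0]
  rw [harmonicExt, map_sum, Finset.sum_eq_single_of_mem 0 (by simp)]
  · rw [h]; simp
  · intro j _ hj; rw [h]; simp [hj]

theorem finrank_homogeneousSubmodule (c k : ℕ) :
    Module.finrank ℝ (homogeneousSubmodule (Fin (c + 1)) ℝ k) = (k + c).choose c := by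
  classical
  rw [homogeneousSubmodule_eq_finsupp_supported]
  have e : {f : Fin (c + 1) →₀ ℕ | f.degree = k} =
      ((Finset.univ.finsuppAntidiag k : Finset (Fin (c + 1) →₀ ℕ)) : Set (Fin (c + 1) →₀ ℕ)) := by
    ext f
    simp [Finsupp.degree_eq_sum]
  rw [e, (AddMonoidAlgebra.supportedEquivFinsupp _).finrank_eq, Module.finrank_finsupp_self]
  simp only [Finset.coe_sort_coe, Fintype.card_coe]
  rw [Finset.card_finsuppAntidiag_nat_eq_choose, Finset.card_univ, Fintype.card_fin,
    show c + 1 + k - 1 = k + c by omega]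
  exact Nat.choose_symm_add

/-- A harmonic polynomial vanishing on the hyperplane corresponds to its normal derivative. -/
theorem finrank_dirichletHarmonics (c k : ℕ) :
    Module.finrank ℝ (dirichletHarmonics (c + 1) (k + 1)) = (k + c).choose c := by
  rw [← finrank_homogeneousSubmodule]
  have hmap : ∀ p ∈ dirichletHarmonics (c + 1) (k + 1),
      normalDeriv (c + 1) p ∈ homogeneousSubmodule (Fin (c + 1)) ℝ k := fun p hp ↦
    isHomogeneous_restrictLast (mem_dirichletHarmonics.mp hp).1.pderiv
  refine (LinearEquiv.ofBijective ((normalDeriv (c + 1)).restrict hmap) ⟨?_, ?_⟩).finrank_eq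
  · rw [injective_iff_map_eq_zero]
    rintro ⟨p, hp⟩ h
    have h1 : restrictLast (c + 1) (pderiv (Fin.last (c + 1)) p) = 0 := congrArg Subtype.val h
    obtain ⟨-, h2, r, rfl⟩ := mem_dirichletHarmonics.mp hp
    rw [pderiv_mul, pderiv_X_self, map_add, map_mul, map_mul, restrictLast_X_last, zero_mul,
      add_zero, map_one, one_mul, ← X_last_dvd_iff] at h1
    obtain ⟨t, rfl⟩ := h1
    exact Subtype.ext (eq_zero_of_X_sq_dvd h2 ⟨t, by ring⟩)
  · rintro ⟨q, hq⟩
    exact ⟨⟨harmonicExt (k + 1) q, harmonicExt_mem hq⟩,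
      Subtype.ext (normalDeriv_harmonicExt k q)⟩

end Hemisphere

namespace Hemisphere
open Set Filter Topology

/-! ### Functions on the hemisphere as functions on the cone -/

section Cone

variable {d : ℕ}

local notation "E" => EuclideanSpace ℝ (Fin (d + 1))

/-- The open upper half-space. -/
def openCone (d : ℕ) : Set (EuclideanSpace ℝ (Fin (d + 1))) := {y | 0 < y (Fin.last d)}

theorem isOpen_openCone : IsOpen (openCone d) := isOpen_lt continuous_const (by fun_prop)

theorem openCone_subset_closedCone : openCone d ⊆ closedCone d := by
  intro y hy
  have hy' : 0 < y (Fin.last d) := hy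
  refine ⟨?_, hy'.le⟩
  rintro rfl
  simp at hy'

theorem closedCone_eq : closedCone d = {y : E | 0 ≤ y (Fin.last d)} ∩ {0}ᶜ := by
  ext y; simp [closedCone, and_comm]

/-- Unique differentiability up to the boundary hyperplane makes `fderivWithin` on the closed cone
continuous for smooth functions, also at the boundary. -/
theorem uniqueDiffOn_closedCone : UniqueDiffOn ℝ (closedCone d) := by
  rw [closedCone_eq]
  refine UniqueDiffOn.inter (uniqueDiffOn_convex ?_ ?_) isOpen_compl_singleton
  · intro x hx y hy a b ha hb _
    have hx : 0 ≤ x (Fin.last d) := hx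
    have hy : 0 ≤ y (Fin.last d) := hy
    change 0 ≤ (a • x + b • y) (Fin.last d)
    simp only [PiLp.add_apply, PiLp.smul_apply, smul_eq_mul]
    positivity
  · refine ⟨EuclideanSpace.single (Fin.last d) 1, mem_interior.mpr ⟨openCone d, ?_,
      isOpen_openCone, by simp [openCone]⟩⟩
    intro y hy
    exact (show 0 < y (Fin.last d) from hy).le

theorem smul_mem_closedCone {y : E} (hy : y ∈ closedCone d) {c : ℝ} (hc : 0 < c) :
    c • y ∈ closedCone d := by
  refine ⟨smul_ne_zero hc.ne' hy.1, ?_⟩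
  rw [PiLp.smul_apply, smul_eq_mul]
  exact mul_nonneg hc.le hy.2

theorem smul_mem_openCone {y : E} (hy : y ∈ openCone d) {c : ℝ} (hc : 0 < c) :
    c • y ∈ openCone d := by
  have hy : 0 < y (Fin.last d) := hy
  change 0 < (c • y) (Fin.last d)
  rw [PiLp.smul_apply, smul_eq_mul]
  exact mul_pos hc hy

theorem homExt_of_mem (u : closedHemisphere d → ℝ) {y : E} (hy : y ∈ closedCone d) :
    homExt u y = u ⟨‖y‖⁻¹ • y, normalize_mem hy⟩ := dif_pos hy

theorem coe_mem_closedCone (x : closedHemisphere d) : (x : E) ∈ closedCone d := by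
  refine ⟨?_, x.2.2⟩
  intro h
  have := x.2.1
  rw [h, norm_zero] at this
  exact zero_ne_one this

theorem homExt_coe (u : closedHemisphere d → ℝ) (x : closedHemisphere d) :
    homExt u (x : E) = u x := by
  rw [homExt_of_mem u (coe_mem_closedCone x)]
  congr 1
  ext1
  simp [x.2.1]

theorem homExt_mul (u v : closedHemisphere d → ℝ) : homExt (u * v) = homExt u * homExt v := by
  funext y
  by_cases hy : y ∈ closedCone d <;> simp [homExt, hy]

theorem homExt_smul_pos (u : closedHemisphere d → ℝ) {y : E} (hy : y ∈ closedCone d) {c : ℝ}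
    (hc : 0 < c) : homExt u (c • y) = homExt u y := by
  rw [homExt_of_mem u hy, homExt_of_mem u (smul_mem_closedCone hy hc)]
  congr 1
  ext1
  simp only [norm_smul, Real.norm_of_nonneg hc.le, smul_smul]
  congr 1
  field_simp

theorem continuousOn_homExt {u : closedHemisphere d → ℝ} (hu : Continuous u) :
    ContinuousOn (homExt u) (closedCone d) := by
  rw [continuousOn_iff_continuous_domRestrict]
  have h : (closedCone d).domRestrict (homExt u) =
      fun y : closedCone d ↦ u ⟨‖(y : E)‖⁻¹ • (y : E), normalize_mem y.2⟩ := by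
    funext y; exact homExt_of_mem u y.2
  rw [h]
  have h1 : Continuous fun y : closedCone d ↦ ‖(y : E)‖⁻¹ • (y : E) :=
    ((continuous_norm.comp continuous_subtype_val).inv₀
      fun y ↦ norm_ne_zero_iff.mpr y.2.1).smul continuous_subtype_val
  exact hu.comp (h1.subtype_mk fun y ↦ normalize_mem y.2)

theorem IsSmooth.continuous {u : closedHemisphere d → ℝ} (hu : IsSmooth u) : Continuous u := by
  have h1 := continuousOn_iff_continuous_domRestrict.mp (ContDiffOn.continuousOn hu)
  have h2 : u = fun x : closedHemisphere d ↦
      (closedCone d).domRestrict (homExt u) ⟨x, coe_mem_closedCone x⟩ := by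
    funext x; exact (homExt_coe u x).symm
  rw [h2]
  exact h1.comp (Continuous.subtype_mk continuous_subtype_val _)

theorem IsSmooth.contDiffAt_openCone {u : closedHemisphere d → ℝ} (hu : IsSmooth u) {y : E}
    (hy : y ∈ openCone d) : ContDiffAt ℝ ∞ (homExt u) y :=
  ContDiffOn.contDiffAt hu
    (mem_of_superset (isOpen_openCone.mem_nhds hy) openCone_subset_closedCone)

/-- The Euclidean Laplacian as the sum of the repeated partial derivatives. -/
theorem laplacian_eq_sum_fderiv {f : E → ℝ} {x : E} (hf : ContDiffAt ℝ 2 f x) :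
    (Δ f) x = ∑ i, fderiv ℝ (fun z ↦ fderiv ℝ f z (EuclideanSpace.single i 1)) x
      (EuclideanSpace.single i 1) := by
  rw [InnerProductSpace.laplacian_eq_iteratedFDeriv_orthonormalBasis f
    (EuclideanSpace.basisFun (Fin (d + 1)) ℝ)]
  refine Finset.sum_congr rfl fun i _ ↦ ?_
  have h1 : DifferentiableAt ℝ (fderiv ℝ f) x :=
    (hf.fderiv_right (m := 1) (by norm_num)).differentiableAt (by norm_num)
  rw [iteratedFDeriv_two_apply, fderiv_clm_apply h1 (by fun_prop)]
  simp

theorem fderiv_homogeneous {f : E → ℝ} {a c : ℝ}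
    (hf : ∀ z ∈ openCone d, f z = a * f (c • z)) {y : E} (hy : y ∈ openCone d)
    (hd : DifferentiableAt ℝ f (c • y)) (e : E) :
    fderiv ℝ f y e = (a * c) * fderiv ℝ f (c • y) e := by
  have h1 : HasFDerivAt (fun z : E ↦ c • z) (c • ContinuousLinearMap.id ℝ E) y :=
    (hasFDerivAt_id y).const_smul c
  have h2 : HasFDerivAt (fun z ↦ f (c • z)) _ y := hd.hasFDerivAt.comp y h1
  have h3 := (h2.const_mul a).congr_of_eventuallyEq
    (f₁ := f) (by filter_upwards [isOpen_openCone.mem_nhds hy] with z hz using hf z hz)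
  rw [h3.fderiv]
  simp
  ring

/-- The Laplacian of an extension that is homogeneous of degree zero is homogeneous of degree
`-2`. -/
theorem laplacian_homExt {u : closedHemisphere d → ℝ} (hu : IsSmooth u) {y : E}
    (hy : y ∈ openCone d) {c : ℝ} (hc : 0 < c) :
    (Δ (homExt u)) y = c ^ 2 * (Δ (homExt u)) (c • y) := by
  have hcy := smul_mem_openCone hy hc
  have hsm : ∀ z ∈ openCone d, ContDiffAt ℝ 2 (homExt u) z := fun z hz ↦
    (hu.contDiffAt_openCone hz).of_le (WithTop.coe_le_coe.mpr (le_top : (2 : ℕ∞) ≤ ⊤))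
  rw [laplacian_eq_sum_fderiv (hsm y hy), laplacian_eq_sum_fderiv (hsm _ hcy), Finset.mul_sum]
  refine Finset.sum_congr rfl fun i _ ↦ ?_
  have h1 : ∀ z ∈ openCone d, fderiv ℝ (homExt u) z (EuclideanSpace.single i 1) =
      c * fderiv ℝ (homExt u) (c • z) (EuclideanSpace.single i 1) := by
    intro z hz
    have := fderiv_homogeneous (f := homExt u) (a := 1) (c := c)
      (fun w hw ↦ by rw [homExt_smul_pos u (openCone_subset_closedCone hw) hc, one_mul]) hz
      ((hsm _ (smul_mem_openCone hz hc)).differentiableAt (by norm_num))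
      (EuclideanSpace.single i 1)
    rwa [one_mul] at this
  have h2 : DifferentiableAt ℝ (fderiv ℝ (homExt u)) (c • y) :=
    ((hsm _ hcy).fderiv_right (m := 1) (by norm_num)).differentiableAt (by norm_num)
  rw [fderiv_homogeneous h1 hy (h2.clm_apply (by fun_prop)), sq]

/-- The extension to the cone has no radial derivative. -/
theorem fderiv_homExt_self {u : closedHemisphere d → ℝ} (hu : IsSmooth u) {y : E}
    (hy : y ∈ openCone d) : fderiv ℝ (homExt u) y y = 0 := by
  have h1 : HasFDerivAt (homExt u) (fderiv ℝ (homExt u) y) ((1 : ℝ) • y) := by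
    rw [one_smul]
    exact ((hu.contDiffAt_openCone hy).differentiableAt (by simp)).hasFDerivAt
  have h2 : HasDerivAt (fun t : ℝ ↦ t • y) ((1 : ℝ) • y) 1 := (hasDerivAt_id 1).smul_const y
  have h3 := h1.comp_hasDerivAt (1 : ℝ) h2
  have h4 : HasDerivAt (homExt u ∘ fun t : ℝ ↦ t • y) 0 1 := by
    refine (hasDerivAt_const (1 : ℝ) (homExt u y)).congr_of_eventuallyEq ?_
    filter_upwards [lt_mem_nhds (zero_lt_one' ℝ)] with t ht
    exact homExt_smul_pos u (openCone_subset_closedCone hy) ht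
  have := h3.unique h4
  rwa [one_smul] at this

/-- The eigenvalue equation for the extension to the cone. -/
theorem laplacian_homExt_of_mem {u : closedHemisphere d → ℝ} {l : ℝ}
    (hu : u ∈ dirichletEigenspace d l) {y : E} (hy : y ∈ openCone d) :
    (Δ (homExt u)) y = -(l / ‖y‖ ^ 2) * homExt u y := by
  obtain ⟨hs, -, he⟩ := hu
  have hyK := openCone_subset_closedCone hy
  have hn : 0 < ‖y‖ := norm_pos_iff.mpr hyK.1
  rw [laplacian_homExt hs hy (inv_pos.mpr hn)]
  have h1 := he ⟨‖y‖⁻¹ • y, normalize_mem hyK⟩ (smul_mem_openCone hy (inv_pos.mpr hn))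
  rw [laplaceBeltrami, ← homExt_of_mem u hyK] at h1
  rw [neg_eq_iff_eq_neg.mp h1]
  field_simp

theorem homExt_eq_zero_of_mem {u : closedHemisphere d → ℝ} {l : ℝ}
    (hu : u ∈ dirichletEigenspace d l) {y : E} (hy : y ∈ closedCone d) (h0 : y (Fin.last d) = 0) :
    homExt u y = 0 := by
  rw [homExt_of_mem u hy]
  refine hu.2.1 _ ?_
  simp [h0]

/-! ### The radial weight -/

/-- A bump function of `‖y‖²`, supported in a shell around the unit sphere scaled by
`√(5/2)`. -/
noncomputable def shellBump : ContDiffBump (5 / 2 : ℝ) := ⟨1 / 2, 1, by norm_num, by norm_num⟩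

/-- The smooth radial cut-off: it vanishes near the origin and outside the ball of radius `3`. -/
noncomputable def shellWeight (y : E) : ℝ := shellBump (‖y‖ ^ 2)

theorem contDiff_shellWeight : ContDiff ℝ ∞ (shellWeight (d := d)) :=
  shellBump.contDiff.comp (contDiff_norm_sq ℝ)

theorem shellWeight_nonneg (y : E) : 0 ≤ shellWeight y := shellBump.nonneg

theorem shellWeight_eq_zero {y : E} (h : ‖y‖ ^ 2 ≤ 3 / 2 ∨ 7 / 2 ≤ ‖y‖ ^ 2) :
    shellWeight y = 0 := by
  refine shellBump.zero_of_le_dist ?_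
  change 1 ≤ dist (‖y‖ ^ 2) (5 / 2)
  rw [Real.dist_eq]
  rcases h with h | h
  · rw [abs_of_nonpos (by linarith)]; linarith
  · rw [abs_of_nonneg (by linarith)]; linarith

theorem shellWeight_eventually_zero : ∀ᶠ y : E in 𝓝 0, shellWeight y = 0 := by
  have h : ∀ᶠ y : E in 𝓝 0, ‖y‖ ^ 2 < 3 / 2 := by
    have : Continuous fun y : E ↦ ‖y‖ ^ 2 := by fun_prop
    exact (this.tendsto 0).eventually (gt_mem_nhds (by simp))
  filter_upwards [h] with y hy using shellWeight_eq_zero (Or.inl hy.le)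

/-- The cut-off removes the singularity at the origin. -/
theorem continuousOn_shellWeight_mul {g : E → ℝ} (hg : ContinuousOn g (closedCone d)) :
    ContinuousOn (fun y ↦ shellWeight y * g y) {y : E | 0 ≤ y (Fin.last d)} := by
  intro y hy
  by_cases h0 : y = 0
  · subst h0
    refine ContinuousAt.continuousWithinAt ?_
    refine (continuousAt_const (y := (0 : ℝ))).congr ?_
    filter_upwards [shellWeight_eventually_zero] with z hz
    rw [hz, zero_mul]
  · have hK : y ∈ closedCone d := ⟨h0, hy⟩
    refine ContinuousWithinAt.mono_of_mem_nhdsWithin (t := closedCone d)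
      (contDiff_shellWeight.continuous.continuousWithinAt.mul (hg y hK)) ?_
    rw [closedCone_eq]
    exact inter_mem self_mem_nhdsWithin
      (mem_nhdsWithin_of_mem_nhds (isOpen_compl_singleton.mem_nhds h0))

end Cone

end Hemisphere

namespace Hemisphere
open Set Filter Topology MeasureTheory

/-! ### Green's identity and the spherical mean -/

section Green

variable {d : ℕ}

local notation "E" => EuclideanSpace ℝ (Fin (d + 1))

/-- The identification of coordinate space, where integrals are taken, with Euclidean space. -/
noncomputable def toE (d : ℕ) : (Fin (d + 1) → ℝ) ≃L[ℝ] EuclideanSpace ℝ (Fin (d + 1)) :=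
  (EuclideanSpace.equiv (Fin (d + 1)) ℝ).symm

theorem toE_apply (x : Fin (d + 1) → ℝ) (i : Fin (d + 1)) : toE d x i = x i := rfl

theorem toE_single (i : Fin (d + 1)) : toE d (Pi.single i 1) = EuclideanSpace.single i 1 := by
  ext j
  rw [toE_apply]
  simp [Pi.single_apply]

/-- The lower corner of the box of integration, whose bottom face lies on the equatorial
hyperplane. -/
def boxLower (d : ℕ) : Fin (d + 1) → ℝ := Fin.lastCases 0 fun _ ↦ -3

/-- The upper corner of the box of integration. -/
def boxUpper (d : ℕ) : Fin (d + 1) → ℝ := fun _ ↦ 3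

theorem boxLower_last : boxLower d (Fin.last d) = 0 := by simp [boxLower]

theorem boxLower_castSucc (i : Fin d) : boxLower d i.castSucc = -3 := by simp [boxLower]

theorem boxLower_le : boxLower d ≤ boxUpper d := by
  intro i
  induction i using Fin.lastCases with
  | last => rw [boxLower_last]; norm_num [boxUpper]
  | cast i => rw [boxLower_castSucc]; norm_num [boxUpper]

theorem toE_mem_of_mem_box {x : Fin (d + 1) → ℝ} (hx : x ∈ Icc (boxLower d) (boxUpper d)) :
    toE d x ∈ {y : E | 0 ≤ y (Fin.last d)} := by
  have := hx.1 (Fin.last d)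
  rwa [boxLower_last] at this

theorem toE_mem_openCone {x : Fin (d + 1) → ℝ}
    (hx : x ∈ Set.pi univ fun i ↦ Ioo (boxLower d i) (boxUpper d i)) : toE d x ∈ openCone d := by
  have := (hx (Fin.last d) (mem_univ _)).1
  rwa [boxLower_last] at this

theorem sq_le_norm_sq (y : E) (i : Fin (d + 1)) : y i ^ 2 ≤ ‖y‖ ^ 2 := by
  rw [EuclideanSpace.real_norm_sq_eq]
  exact Finset.single_le_sum (f := fun i ↦ y i ^ 2) (fun _ _ ↦ sq_nonneg _) (Finset.mem_univ i)

/-- The `i`-th component of the cut-off Green vector field `V ∇U - U ∇V`. -/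
noncomputable def greenField (u v : closedHemisphere d → ℝ) (i : Fin (d + 1)) (y : E) : ℝ :=
  shellWeight y * (homExt v y * fderivWithin ℝ (homExt u) (closedCone d) y
      (EuclideanSpace.single i 1) -
    homExt u y * fderivWithin ℝ (homExt v) (closedCone d) y (EuclideanSpace.single i 1))

theorem continuousOn_greenField {u v : closedHemisphere d → ℝ} (hu : IsSmooth u) (hv : IsSmooth v)
    (i : Fin (d + 1)) : ContinuousOn (greenField u v i) {y : E | 0 ≤ y (Fin.last d)} := by
  refine continuousOn_shellWeight_mul (ContinuousOn.sub ?_ ?_)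
  · refine (continuousOn_homExt hv.continuous).mul (ContinuousOn.clm_apply ?_ continuousOn_const)
    exact ContDiffOn.continuousOn_fderivWithin hu uniqueDiffOn_closedCone (by simp)
  · refine (continuousOn_homExt hu.continuous).mul (ContinuousOn.clm_apply ?_ continuousOn_const)
    exact ContDiffOn.continuousOn_fderivWithin hv uniqueDiffOn_closedCone (by simp)

/-- The product of the derivatives cancels, and the radial derivatives vanish, in the divergence
of the Green vector field. -/
theorem div_greenField {u v : closedHemisphere d → ℝ} {l l' : ℝ}
    (hu : u ∈ dirichletEigenspace d l) (hv : v ∈ dirichletEigenspace d l') {y : E}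
    (hy : y ∈ openCone d) :
    (∀ i, DifferentiableAt ℝ (greenField u v i) y) ∧
      ∑ i, fderiv ℝ (greenField u v i) y (EuclideanSpace.single i 1) =
        (l' - l) * (shellWeight y * (homExt u y * homExt v y / ‖y‖ ^ 2)) := by
  have hus := hu.1
  have hvs := hv.1
  set U := homExt u with hU
  set V := homExt v with hV
  set W : E → ℝ := shellWeight with hW
  have hcU : ContDiffAt ℝ 2 U y := (hus.contDiffAt_openCone hy).of_le
    (WithTop.coe_le_coe.mpr (le_top : (2 : ℕ∞) ≤ ⊤))
  have hcV : ContDiffAt ℝ 2 V y := (hvs.contDiffAt_openCone hy).of_le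
    (WithTop.coe_le_coe.mpr (le_top : (2 : ℕ∞) ≤ ⊤))
  have hdU : HasFDerivAt U (fderiv ℝ U y) y := (hcU.differentiableAt (by norm_num)).hasFDerivAt
  have hdV : HasFDerivAt V (fderiv ℝ V y) y := (hcV.differentiableAt (by norm_num)).hasFDerivAt
  have hdW : HasFDerivAt W (fderiv ℝ W y) y :=
    (contDiff_shellWeight.differentiable (by simp) y).hasFDerivAt
  have hpU : ∀ i : Fin (d + 1), DifferentiableAt ℝ
      (fun z ↦ fderiv ℝ U z (EuclideanSpace.single i 1)) y := fun i ↦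
    (((hcU.fderiv_right (m := 1) (by norm_num)).differentiableAt (by norm_num)).clm_apply
      (by fun_prop))
  have hpV : ∀ i : Fin (d + 1), DifferentiableAt ℝ
      (fun z ↦ fderiv ℝ V z (EuclideanSpace.single i 1)) y := fun i ↦
    (((hcV.fderiv_right (m := 1) (by norm_num)).differentiableAt (by norm_num)).clm_apply
      (by fun_prop))
  have heq : ∀ i, greenField u v i =ᶠ[𝓝 y] fun z ↦ W z *
      (V z * fderiv ℝ U z (EuclideanSpace.single i 1) -
        U z * fderiv ℝ V z (EuclideanSpace.single i 1)) := by
    intro i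
    filter_upwards [isOpen_openCone.mem_nhds hy] with z hz
    have hz' : closedCone d ∈ 𝓝 z :=
      mem_of_superset (isOpen_openCone.mem_nhds hz) openCone_subset_closedCone
    rw [greenField, fderivWithin_of_mem_nhds hz', fderivWithin_of_mem_nhds hz']
  have hder : ∀ i, HasFDerivAt (greenField u v i) _ y := fun i ↦
    (hdW.mul ((hdV.mul (hpU i).hasFDerivAt).sub
      (hdU.mul (hpV i).hasFDerivAt))).congr_of_eventuallyEq (heq i)
  refine ⟨fun i ↦ (hder i).differentiableAt, ?_⟩
  have hLU : ∑ i, fderiv ℝ (fun z ↦ fderiv ℝ U z (EuclideanSpace.single i 1)) y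
      (EuclideanSpace.single i 1) = -(l / ‖y‖ ^ 2) * U y := by
    rw [← laplacian_eq_sum_fderiv hcU, laplacian_homExt_of_mem hu hy]
  have hLV : ∑ i, fderiv ℝ (fun z ↦ fderiv ℝ V z (EuclideanSpace.single i 1)) y
      (EuclideanSpace.single i 1) = -(l' / ‖y‖ ^ 2) * V y := by
    rw [← laplacian_eq_sum_fderiv hcV, laplacian_homExt_of_mem hv hy]
  -- The gradient of the radial weight is a multiple of the position vector.
  have hWi : ∃ a : ℝ, ∀ i : Fin (d + 1), fderiv ℝ W y (EuclideanSpace.single i 1) = a * y i := by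
    have h1 : HasDerivAt shellBump (deriv shellBump (‖y‖ ^ 2)) (‖y‖ ^ 2) :=
      ((shellBump.contDiff (n := 1)).differentiable (by norm_num) _).hasDerivAt
    have h2 : HasFDerivAt (fun z : E ↦ ‖z‖ ^ 2) (2 • innerSL ℝ y) y :=
      (hasStrictFDerivAt_norm_sq y).hasFDerivAt
    have h3 := h1.comp_hasFDerivAt y h2
    refine ⟨deriv shellBump (‖y‖ ^ 2) * 2, fun i ↦ ?_⟩
    have h4 : fderiv ℝ W y = deriv shellBump (‖y‖ ^ 2) • (2 • innerSL ℝ y) := h3.fderiv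
    rw [h4]
    simp [EuclideanSpace.inner_single_right]
    ring
  obtain ⟨a, ha⟩ := hWi
  have hbasis : y = ∑ i, y i • EuclideanSpace.single i (1 : ℝ) := by
    have := (EuclideanSpace.basisFun (Fin (d + 1)) ℝ).sum_repr y
    simpa using this.symm
  have hrad : ∀ w : closedHemisphere d → ℝ, IsSmooth w →
      ∑ i, y i * fderiv ℝ (homExt w) y (EuclideanSpace.single i 1) = 0 := by
    intro w hw
    have h1 := fderiv_homExt_self hw hy
    nth_rewrite 2 [hbasis] at h1
    rw [map_sum] at h1
    simpa using h1
  have hrU := hrad u hus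
  have hrV := hrad v hvs
  have hsum : ∀ i, fderiv ℝ (greenField u v i) y (EuclideanSpace.single i 1) =
      W y * (V y * fderiv ℝ (fun z ↦ fderiv ℝ U z (EuclideanSpace.single i 1)) y
        (EuclideanSpace.single i 1)) -
      W y * (U y * fderiv ℝ (fun z ↦ fderiv ℝ V z (EuclideanSpace.single i 1)) y
        (EuclideanSpace.single i 1)) +
      (V y * a) * (y i * fderiv ℝ U y (EuclideanSpace.single i 1)) -
      (U y * a) * (y i * fderiv ℝ V y (EuclideanSpace.single i 1)) := by
    intro i
    rw [(hder i).fderiv]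
    simp only [_root_.add_apply, _root_.smul_apply, _root_.sub_apply, Pi.sub_apply, Pi.mul_apply,
      smul_eq_mul, ha i]
    ring
  simp only [hsum, Finset.sum_add_distrib, Finset.sum_sub_distrib, ← Finset.mul_sum]
  rw [hLU, hLV, hrU, hrV]
  ring

/-- The Green vector field vanishes on the faces of the box of integration: on the far faces by
the cut-off, on the equatorial face by the Dirichlet condition. -/
theorem greenField_eq_zero {u v : closedHemisphere d → ℝ} {l l' : ℝ}
    (hu : u ∈ dirichletEigenspace d l) (hv : v ∈ dirichletEigenspace d l') (i : Fin (d + 1))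
    {y : E} (h : (∃ j, y j ^ 2 = 9) ∨ y (Fin.last d) = 0) : greenField u v i y = 0 := by
  rw [greenField]
  rcases h with ⟨j, hj⟩ | h
  · have := sq_le_norm_sq y j
    rw [shellWeight_eq_zero (Or.inr (by linarith)), zero_mul]
  · by_cases h0 : y = 0
    · rw [shellWeight_eq_zero (Or.inl (by rw [h0]; norm_num)), zero_mul]
    · have hK : y ∈ closedCone d := ⟨h0, h.ge⟩
      rw [homExt_eq_zero_of_mem hu hK h, homExt_eq_zero_of_mem hv hK h]
      ring

/-- The density that defines the spherical mean of a function on the hemisphere. -/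
noncomputable def meanDensity (g : closedHemisphere d → ℝ) (x : Fin (d + 1) → ℝ) : ℝ :=
  shellWeight (toE d x) * (homExt g (toE d x) / ‖toE d x‖ ^ 2)

theorem continuousOn_meanDensity {g : closedHemisphere d → ℝ} (hg : Continuous g) :
    ContinuousOn (meanDensity g) (Icc (boxLower d) (boxUpper d)) := by
  have h1 : ContinuousOn (fun y : E ↦ homExt g y / ‖y‖ ^ 2) (closedCone d) :=
    (continuousOn_homExt hg).div (by fun_prop)
      fun y hy ↦ pow_ne_zero 2 (norm_ne_zero_iff.mpr hy.1)
  exact (continuousOn_shellWeight_mul h1).comp (toE d).continuous.continuousOn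
    fun x hx ↦ toE_mem_of_mem_box hx

theorem integrableOn_meanDensity {g : closedHemisphere d → ℝ} (hg : Continuous g) :
    IntegrableOn (meanDensity g) (Icc (boxLower d) (boxUpper d)) :=
  (continuousOn_meanDensity hg).integrableOn_compact isCompact_Icc

/-- Dirichlet eigenfunctions for different eigenvalues are orthogonal. -/
theorem integral_meanDensity_mul_eq_zero {u v : closedHemisphere d → ℝ} {l l' : ℝ}
    (hu : u ∈ dirichletEigenspace d l) (hv : v ∈ dirichletEigenspace d l') (hl : l ≠ l') :
    ∫ x in Icc (boxLower d) (boxUpper d), meanDensity (u * v) x = 0 := by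
  set F' : Fin (d + 1) → (Fin (d + 1) → ℝ) → (Fin (d + 1) → ℝ) →L[ℝ] ℝ := fun i x ↦
    (fderiv ℝ (greenField u v i) (toE d x)).comp (toE d : (Fin (d + 1) → ℝ) →L[ℝ] E) with hF'
  have hsum : ∀ x ∈ Set.pi univ fun i ↦ Ioo (boxLower d i) (boxUpper d i),
      ∑ i, F' i x (Pi.single i 1) = (l' - l) * meanDensity (u * v) x := by
    intro x hx
    have h1 := (div_greenField hu hv (toE_mem_openCone hx)).2
    simp only [hF', ContinuousLinearMap.comp_apply, ContinuousLinearEquiv.coe_coe, toE_single]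
    rw [h1, meanDensity, homExt_mul]
    rfl
  have hae : ∀ᵐ x ∂volume.restrict (Icc (boxLower d) (boxUpper d)),
      (l' - l) * meanDensity (u * v) x = ∑ i, F' i x (Pi.single i 1) := by
    have hset : (Set.pi univ fun i ↦ Ioo (boxLower d i) (boxUpper d i))
        =ᵐ[(volume : Measure (Fin (d + 1) → ℝ))] Icc (boxLower d) (boxUpper d) :=
      Measure.univ_pi_Ioo_ae_eq_Icc
    rw [← Measure.restrict_congr_set hset]
    refine (ae_restrict_iff' (MeasurableSet.univ_pi fun i ↦ measurableSet_Ioo)).mpr ?_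
    exact Eventually.of_forall fun x hx ↦ (hsum x hx).symm
  have hint := (integrableOn_meanDensity
    (hu.1.continuous.mul hv.1.continuous : Continuous (u * v))).const_mul (l' - l)
  have hdiv := integral_divergence_of_hasFDerivAt_off_countable' (boxLower d) (boxUpper d)
    boxLower_le (fun i x ↦ greenField u v i (toE d x)) F' ∅ countable_empty
    (fun i ↦ (continuousOn_greenField hu.1 hv.1 i).comp (toE d).continuous.continuousOn
      fun x hx ↦ toE_mem_of_mem_box hx)
    (fun x hx i ↦ (((div_greenField hu hv (toE_mem_openCone hx.1)).1 i).hasFDerivAt).comp x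
      (toE d).hasFDerivAt)
    (hint.congr hae)
  rw [← integral_congr_ae hae, integral_const_mul] at hdiv
  have hfaces : ∀ i : Fin (d + 1), ∀ x : Fin d → ℝ,
      greenField u v i (toE d (i.insertNth (boxUpper d i) x)) = 0 ∧
      greenField u v i (toE d (i.insertNth (boxLower d i) x)) = 0 := by
    intro i x
    refine ⟨greenField_eq_zero hu hv i (Or.inl ⟨i, ?_⟩), greenField_eq_zero hu hv i ?_⟩
    · rw [toE_apply, Fin.insertNth_apply_same, boxUpper]; norm_num
    · induction i using Fin.lastCases with
      | last => right; rw [toE_apply, Fin.insertNth_apply_same, boxLower_last]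
      | cast i =>
        left
        refine ⟨i.castSucc, ?_⟩
        rw [toE_apply, Fin.insertNth_apply_same, boxLower_castSucc]; norm_num
  simp only [fun i x ↦ (hfaces i x).1, fun i x ↦ (hfaces i x).2, integral_zero, sub_zero,
    Finset.sum_const_zero] at hdiv
  exact (mul_eq_zero.mp hdiv).resolve_left (sub_ne_zero.mpr hl.symm)

theorem isCompact_closedHemisphere : IsCompact (closedHemisphere d) := by
  have h : closedHemisphere d = Metric.sphere 0 1 ∩ {y : E | 0 ≤ y (Fin.last d)} := by
    ext y; simp [closedHemisphere]
  rw [h]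
  exact (isCompact_sphere 0 1).inter_right (isClosed_le continuous_const (by fun_prop))

instance compactSpace_closedHemisphere : CompactSpace (closedHemisphere d) :=
  isCompact_iff_compactSpace.mp isCompact_closedHemisphere

theorem meanDensity_add (f g : closedHemisphere d → ℝ) :
    meanDensity (f + g) = meanDensity f + meanDensity g := by
  funext x; simp only [meanDensity, homExt_add, Pi.add_apply]; ring

theorem meanDensity_smul (a : ℝ) (f : closedHemisphere d → ℝ) :
    meanDensity (a • f) = fun x ↦ a * meanDensity f x := by
  funext x; simp only [meanDensity, homExt_smul, Pi.smul_apply, smul_eq_mul]; ring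

theorem meanDensity_mono {f g : closedHemisphere d → ℝ} (h : ∀ x, f x ≤ g x)
    (x : Fin (d + 1) → ℝ) : meanDensity f x ≤ meanDensity g x := by
  refine mul_le_mul_of_nonneg_left (div_le_div_of_nonneg_right ?_ (sq_nonneg _))
    (shellWeight_nonneg _)
  by_cases hy : toE d x ∈ closedCone d
  · rw [homExt_of_mem f hy, homExt_of_mem g hy]; exact h _
  · rw [homExt, homExt, dif_neg hy, dif_neg hy]

/-- Integration of continuous functions over the hemisphere, up to a constant factor: the
integral over a half-shell of the extension that is constant along rays. -/
noncomputable def sphericalMean (d : ℕ) : C(closedHemisphere d, ℝ) →L[ℝ] ℝ :=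
  LinearMap.mkContinuous
    { toFun := fun g ↦ ∫ x in Icc (boxLower d) (boxUpper d), meanDensity g x
      map_add' := fun f g ↦ by
        rw [ContinuousMap.coe_add, meanDensity_add]
        exact integral_add (integrableOn_meanDensity f.continuous)
          (integrableOn_meanDensity g.continuous)
      map_smul' := fun a f ↦ by
        rw [ContinuousMap.coe_smul, meanDensity_smul, integral_const_mul]
        rfl }
    (∫ x in Icc (boxLower d) (boxUpper d), meanDensity (1 : C(closedHemisphere d, ℝ)) x)
    (fun g ↦ by
      have h1 : ∀ a : ℝ, ∫ x in Icc (boxLower d) (boxUpper d),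
          meanDensity (a • (1 : C(closedHemisphere d, ℝ)) : C(closedHemisphere d, ℝ)) x =
          a * ∫ x in Icc (boxLower d) (boxUpper d),
            meanDensity (1 : C(closedHemisphere d, ℝ)) x := by
        intro a
        rw [ContinuousMap.coe_smul, meanDensity_smul, integral_const_mul]
      change ‖∫ x in Icc (boxLower d) (boxUpper d), meanDensity g x‖ ≤ _
      rw [Real.norm_eq_abs, abs_le, mul_comm, ← neg_mul, ← h1, ← h1]
      constructor
      · refine integral_mono (integrableOn_meanDensity (ContinuousMap.continuous _))
          (integrableOn_meanDensity g.continuous) (meanDensity_mono fun x ↦ ?_)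
        have := (abs_le.mp (g.norm_coe_le_norm x)).1
        simpa using this
      · refine integral_mono (integrableOn_meanDensity g.continuous)
          (integrableOn_meanDensity (ContinuousMap.continuous _)) (meanDensity_mono fun x ↦ ?_)
        have := (abs_le.mp (g.norm_coe_le_norm x)).2
        simpa using this)

theorem sphericalMean_apply (g : C(closedHemisphere d, ℝ)) :
    sphericalMean d g = ∫ x in Icc (boxLower d) (boxUpper d), meanDensity g x := rfl

/-- A nonnegative continuous function with spherical mean zero vanishes off the equator. -/
theorem eq_zero_of_sphericalMean_eq_zero {g : C(closedHemisphere d, ℝ)} (hg : ∀ x, 0 ≤ g x)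
    (h : sphericalMean d g = 0) (x : closedHemisphere d) (hx : 0 < x.1 (Fin.last d)) :
    g x = 0 := by
  have hnn : ∀ y, 0 ≤ meanDensity g y := by
    intro y
    have h1 := meanDensity_mono (f := (0 : closedHemisphere d → ℝ)) (g := g) hg y
    have h2 : meanDensity (0 : closedHemisphere d → ℝ) y = 0 := by
      simp [meanDensity, homExt_zero]
    linarith
  have h1 := (setIntegral_eq_zero_iff_of_nonneg_ae (Eventually.of_forall hnn)
    (integrableOn_meanDensity g.continuous)).mp h
  set O := Set.pi univ fun i ↦ Ioo (boxLower d i) (boxUpper d i) with hO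
  have hOo : IsOpen O := isOpen_set_pi finite_univ fun i _ ↦ isOpen_Ioo
  have hOI : O ⊆ Icc (boxLower d) (boxUpper d) := fun y hy ↦
    ⟨fun i ↦ (hy i (mem_univ i)).1.le, fun i ↦ (hy i (mem_univ i)).2.le⟩
  have h2 : meanDensity g =ᵐ[volume.restrict O] fun _ ↦ (0 : ℝ) :=
    ae_restrict_of_ae_restrict_of_subset hOI h1
  have h3 := Measure.eqOn_open_of_ae_eq h2 hOo
    ((continuousOn_meanDensity g.continuous).mono hOI) continuousOn_const
  -- The multiple of `x` at which the cut-off is `1`.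
  set r : ℝ := Real.sqrt (5 / 2) with hr
  have hr0 : 0 < r := Real.sqrt_pos.mpr (by norm_num)
  have hr2 : r ^ 2 = 5 / 2 := Real.sq_sqrt (by norm_num)
  have hrx : toE d (fun i ↦ r * x.1 i) = r • (x : E) := by ext i; rfl
  have hmem : (fun i ↦ r * x.1 i) ∈ O := by
    intro i _
    have h4 : (r * x.1 i) ^ 2 < 9 := by
      have := sq_le_norm_sq x.1 i
      rw [x.2.1] at this
      rw [mul_pow, hr2]; nlinarith
    have h5 := abs_lt_of_sq_lt_sq (show (r * x.1 i) ^ 2 < 3 ^ 2 by linarith) (by norm_num)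
    refine ⟨?_, (abs_lt.mp h5).2⟩
    induction i using Fin.lastCases with
    | last => rw [boxLower_last]; exact mul_pos hr0 hx
    | cast i => rw [boxLower_castSucc]; exact (abs_lt.mp h5).1
  have h6 := h3 hmem
  have h7 : ‖r • (x : E)‖ ^ 2 = 5 / 2 := by
    rw [norm_smul, x.2.1, mul_one, Real.norm_of_nonneg hr0.le, hr2]
  have h8 : shellWeight (r • (x : E)) = 1 := by
    rw [shellWeight, h7]
    exact shellBump.one_of_mem_closedBall (Metric.mem_closedBall_self (by norm_num [shellBump]))
  simp only [meanDensity] at h6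
  rw [hrx, h8, homExt_smul_pos _ (coe_mem_closedCone x) hr0, homExt_coe, h7, one_mul] at h6
  simpa using h6

end Green

end Hemisphere

namespace Hemisphere
open Set Filter Topology MvPolynomial

/-! ### Restrictions of harmonic polynomials are eigenfunctions -/

section Restriction

variable {d : ℕ}

local notation "E" => EuclideanSpace ℝ (Fin (d + 1))

theorem eval_smul_of_isHomogeneous {σ : Type*} {p : MvPolynomial σ ℝ} {k : ℕ}
    (hp : p.IsHomogeneous k) (c : ℝ) (x : σ → ℝ) : eval (c • x) p = c ^ k * eval x p := by
  rw [eval_eq, eval_eq, Finset.mul_sum]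
  refine Finset.sum_congr rfl fun m hm ↦ ?_
  have h : ∑ i ∈ m.support, m i = k := by
    rw [← hp (mem_support_iff.mp hm), Finsupp.weight_apply]
    simp [Finsupp.sum]
  rw [← h, ← Finset.prod_pow_eq_pow_sum]
  simp only [Pi.smul_apply, smul_eq_mul, mul_pow, Finset.prod_mul_distrib]
  ring

theorem contDiff_eval (p : MvPolynomial (Fin (d + 1)) ℝ) :
    ContDiff ℝ ∞ fun y : E ↦ eval y p := by
  induction p using MvPolynomial.induction_on with
  | C a => simpa using contDiff_const
  | add p q hp hq => simpa using hp.add hq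
  | mul_X p i hp =>
    simp only [map_mul, eval_X]
    exact hp.mul (by fun_prop)

theorem fderiv_eval (p : MvPolynomial (Fin (d + 1)) ℝ) (y : E) (i : Fin (d + 1)) :
    fderiv ℝ (fun y : E ↦ eval y p) y (EuclideanSpace.single i 1) = eval y (pderiv i p) := by
  have hdiff : ∀ q : MvPolynomial (Fin (d + 1)) ℝ, HasFDerivAt (fun y : E ↦ eval y q)
      (fderiv ℝ (fun y : E ↦ eval y q) y) y := fun q ↦
    ((contDiff_eval q).differentiable (by simp) y).hasFDerivAt
  induction p using MvPolynomial.induction_on with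
  | C a => simp
  | add p q hp hq =>
    have h := ((hdiff p).add (hdiff q)).congr_of_eventuallyEq
      (f₁ := fun y : E ↦ eval y (p + q)) (Eventually.of_forall fun z ↦ by simp)
    rw [h.fderiv, _root_.add_apply, hp, hq, map_add, map_add]
  | mul_X p j hp =>
    have hX : HasFDerivAt (fun y : E ↦ y j)
        (EuclideanSpace.proj j : E →L[ℝ] ℝ) y :=
      (EuclideanSpace.proj j : E →L[ℝ] ℝ).hasFDerivAt
    have h := ((hdiff p).mul hX).congr_of_eventuallyEq
      (f₁ := fun y : E ↦ eval y (p * X j)) (Eventually.of_forall fun z ↦ by simp)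
    rw [h.fderiv, _root_.add_apply, _root_.smul_apply, _root_.smul_apply, hp, pderiv_mul,
      pderiv_X]
    by_cases hij : i = j
    · subst hij; simp; ring
    · simp [Ne.symm hij, mul_comm]

theorem contDiffAt_rpow_mul_eval (a : ℝ) (p : MvPolynomial (Fin (d + 1)) ℝ) {y : E}
    (hy : y ≠ 0) : ContDiffAt ℝ ∞ (fun z : E ↦ (‖z‖ ^ 2) ^ a * eval z p) y :=
  ((contDiff_norm_sq ℝ).contDiffAt.rpow_const_of_ne
    (pow_ne_zero 2 (norm_ne_zero_iff.mpr hy))).mul (contDiff_eval p).contDiffAt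

theorem fderiv_rpow_mul_eval (a : ℝ) (p : MvPolynomial (Fin (d + 1)) ℝ) {y : E} (hy : y ≠ 0)
    (i : Fin (d + 1)) :
    fderiv ℝ (fun z : E ↦ (‖z‖ ^ 2) ^ a * eval z p) y (EuclideanSpace.single i 1) =
      (‖y‖ ^ 2) ^ a * eval y (pderiv i p) +
        (‖y‖ ^ 2) ^ (a - 1) * eval y (C (2 * a) * (X i * p)) := by
  have h1 : HasFDerivAt (fun z : E ↦ ‖z‖ ^ 2) (2 • innerSL ℝ y) y :=
    (hasStrictFDerivAt_norm_sq y).hasFDerivAt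
  have h2 := h1.rpow_const (p := a) (Or.inl (pow_ne_zero 2 (norm_ne_zero_iff.mpr hy)))
  have h3 : HasFDerivAt (fun z : E ↦ eval z p) (fderiv ℝ (fun z : E ↦ eval z p) y) y :=
    ((contDiff_eval p).differentiable (by simp) y).hasFDerivAt
  rw [(h2.fun_mul h3).fderiv, _root_.add_apply, _root_.smul_apply, _root_.smul_apply, fderiv_eval]
  simp [EuclideanSpace.inner_single_right]
  ring

/-- The homogeneous extension of degree zero of a harmonic homogeneous polynomial is the
polynomial divided by a power of the norm, and the Laplacian of the latter follows from Euler's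
identity. -/
theorem laplacian_rpow_mul_eval {k : ℕ} {p : MvPolynomial (Fin (d + 1)) ℝ}
    (hp : p.IsHomogeneous k) (hL : polyLaplacian p = 0) {x : E} (hx : ‖x‖ = 1) :
    (Δ fun z : E ↦ (‖z‖ ^ 2) ^ (-(k : ℝ) / 2) * eval z p) x =
      -((k : ℝ) * (k + d - 1)) * eval x p := by
  set r : ℝ := -(k : ℝ) / 2 with hr
  have hx0 : x ≠ 0 := by rintro rfl; simp at hx
  have h2 : ContDiffAt ℝ 2 (fun z : E ↦ (‖z‖ ^ 2) ^ r * eval z p) x :=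
    (contDiffAt_rpow_mul_eval r p hx0).of_le (WithTop.coe_le_coe.mpr (le_top : (2 : ℕ∞) ≤ ⊤))
  rw [laplacian_eq_sum_fderiv h2]
  have hsecond : ∀ i : Fin (d + 1),
      fderiv ℝ (fun z : E ↦ fderiv ℝ (fun z : E ↦ (‖z‖ ^ 2) ^ r * eval z p) z
        (EuclideanSpace.single i 1)) x (EuclideanSpace.single i 1) =
      eval x (pderiv i (pderiv i p)) + 4 * r * eval x (X i * pderiv i p) +
        2 * r * eval x p + 4 * r * (r - 1) * eval x p * x i ^ 2 := by
    intro i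
    have heq : (fun z : E ↦ fderiv ℝ (fun z : E ↦ (‖z‖ ^ 2) ^ r * eval z p) z
        (EuclideanSpace.single i 1)) =ᶠ[𝓝 x] fun z ↦ (‖z‖ ^ 2) ^ r * eval z (pderiv i p) +
          (‖z‖ ^ 2) ^ (r - 1) * eval z (C (2 * r) * (X i * p)) := by
      filter_upwards [isOpen_ne.mem_nhds hx0] with z hz using fderiv_rpow_mul_eval r p hz i
    rw [heq.fderiv_eq, fderiv_fun_add
      ((contDiffAt_rpow_mul_eval _ _ hx0).differentiableAt (by simp))
      ((contDiffAt_rpow_mul_eval _ _ hx0).differentiableAt (by simp)), _root_.add_apply,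
      fderiv_rpow_mul_eval _ _ hx0, fderiv_rpow_mul_eval _ _ hx0, hx]
    rw [pderiv_C_mul]
    simp only [one_pow, Real.one_rpow, pderiv_mul, pderiv_X_self, map_mul, eval_C, eval_X,
      map_add, one_mul]
    ring
  simp only [hsecond, Finset.sum_add_distrib, ← Finset.mul_sum, ← map_sum]
  rw [← polyLaplacian_apply, hL, hp.sum_X_mul_pderiv, ← EuclideanSpace.real_norm_sq_eq, hx]
  simp [hr]
  ring

/-- Restriction of polynomials to the hemisphere. -/
noncomputable def polyRestrict (d : ℕ) :
    MvPolynomial (Fin (d + 1)) ℝ →ₐ[ℝ] C(closedHemisphere d, ℝ) :=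
  aeval fun i ↦ ⟨fun x ↦ x.1 i, by fun_prop⟩

theorem polyRestrict_apply (p : MvPolynomial (Fin (d + 1)) ℝ) (x : closedHemisphere d) :
    polyRestrict d p x = eval (x : E) p := by
  induction p using MvPolynomial.induction_on with
  | C a => simp [polyRestrict]
  | add p q hp hq => simp [hp, hq]
  | mul_X p i hp => simp only [map_mul, ContinuousMap.mul_apply, hp, eval_X]; simp [polyRestrict]

theorem homExt_polyRestrict {k : ℕ} {p : MvPolynomial (Fin (d + 1)) ℝ} (hp : p.IsHomogeneous k)
    {y : E} (hy : y ∈ closedCone d) :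
    homExt (polyRestrict d p) y = (‖y‖ ^ 2) ^ (-(k : ℝ) / 2) * eval y p := by
  have h : (((‖y‖⁻¹ • y : E) : Fin (d + 1) → ℝ)) = ‖y‖⁻¹ • (y : Fin (d + 1) → ℝ) := rfl
  rw [homExt_of_mem _ hy, polyRestrict_apply, h, eval_smul_of_isHomogeneous hp]
  congr 1
  rw [← Real.rpow_natCast ‖y‖ 2, ← Real.rpow_mul (norm_nonneg y), inv_pow, ← Real.rpow_natCast,
    ← Real.rpow_neg (norm_nonneg y)]
  congr 1
  push_cast
  ring

/-- The restriction of a harmonic polynomial of degree `k` is an eigenfunction for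
`k (k + d - 1)`. -/
theorem polyRestrict_mem_dirichletEigenspace {k : ℕ} {p : MvPolynomial (Fin (d + 1)) ℝ}
    (hp : p ∈ dirichletHarmonics d k) :
    ⇑(polyRestrict d p) ∈ dirichletEigenspace d ((k : ℝ) * (k + d - 1)) := by
  obtain ⟨hh, hL, q, hq⟩ := mem_dirichletHarmonics.mp hp
  refine ⟨?_, fun x hx ↦ ?_, fun x hx ↦ ?_⟩
  · exact ContDiffOn.congr (fun y hy ↦ (contDiffAt_rpow_mul_eval _ p hy.1).contDiffWithinAt)
      fun y hy ↦ homExt_polyRestrict hh hy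
  · rw [polyRestrict_apply, hq, map_mul, eval_X, hx, zero_mul]
  · have heq : homExt (polyRestrict d p) =ᶠ[𝓝 (x : E)]
        fun z ↦ (‖z‖ ^ 2) ^ (-(k : ℝ) / 2) * eval z p := by
      filter_upwards [isOpen_openCone.mem_nhds hx] with z hz using
        homExt_polyRestrict hh (openCone_subset_closedCone hz)
    rw [laplaceBeltrami, (InnerProductSpace.laplacian_congr_nhds heq).eq_of_nhds,
      laplacian_rpow_mul_eval hh hL x.2.1, polyRestrict_apply]
    ring

/-- A homogeneous polynomial is determined by its restriction to the hemisphere. -/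
theorem eq_zero_of_polyRestrict_eq_zero {k : ℕ} {p : MvPolynomial (Fin (d + 1)) ℝ}
    (hp : p.IsHomogeneous k) (h : polyRestrict d p = 0) : p = 0 := by
  refine funext_set (fun _ ↦ Ioi (0 : ℝ)) (fun _ ↦ Ioi_infinite 0) fun x hx ↦ ?_
  have hy : toE d x ∈ closedCone d := openCone_subset_closedCone (hx (Fin.last d) (mem_univ _))
  have h1 := homExt_polyRestrict hp hy
  rw [h, homExt_of_mem _ hy, ContinuousMap.zero_apply] at h1
  have h2 : (‖toE d x‖ ^ 2) ^ (-(k : ℝ) / 2) ≠ 0 :=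
    (Real.rpow_pos_of_pos (pow_pos (norm_pos_iff.mpr hy.1) 2) _).ne'
  rw [map_zero]
  exact (mul_eq_zero.mp h1.symm).resolve_left h2

end Restriction

/-! ### Completeness of the harmonic polynomials -/

section Completeness

variable {d : ℕ}

theorem dirichletHarmonics_zero : dirichletHarmonics d 0 = ⊥ := by
  refine (Submodule.eq_bot_iff _).mpr fun p hp ↦ ?_
  obtain ⟨h1, -, h2⟩ := mem_dirichletHarmonics.mp hp
  rw [X_last_dvd_iff] at h2
  rw [totalDegree_eq_zero_iff_eq_C.mp ((totalDegree_zero_iff_isHomogeneous _).mpr h1)] at h2 ⊢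
  rw [algHom_C] at h2
  have h3 : coeff 0 p = 0 := by simpa using h2
  rw [h3, map_zero]

/-- The linear span of the eigenfunctions that come from harmonic polynomials. -/
noncomputable def harmonicSpan (d : ℕ) : Submodule ℝ C(closedHemisphere d, ℝ) :=
  ⨆ k, (dirichletHarmonics d (k + 1)).map (polyRestrict d).toLinearMap

theorem polyRestrict_mem_harmonicSpan {k : ℕ} {p : MvPolynomial (Fin (d + 1)) ℝ}
    (hp : p ∈ dirichletHarmonics d k) : polyRestrict d p ∈ harmonicSpan d := by
  cases k with
  | zero =>
    rw [dirichletHarmonics_zero, Submodule.mem_bot] at hp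
    rw [hp, map_zero]
    exact zero_mem _
  | succ k =>
    exact Submodule.mem_iSup_of_mem (p := fun k ↦
      (dirichletHarmonics d (k + 1)).map (polyRestrict d).toLinearMap) k ⟨p, hp, rfl⟩

theorem polyRestrict_normSqPoly : polyRestrict d normSqPoly = 1 := by
  ext x
  rw [polyRestrict_apply, normSqPoly]
  have h := EuclideanSpace.real_norm_sq_eq x.1
  rw [x.2.1] at h
  simp [← h]

/-- On the sphere, a coordinate times a harmonic polynomial is a sum of two harmonic
polynomials, of degrees one higher and one lower. -/
theorem X_mul_mem_harmonicSpan (i : Fin d) {f : C(closedHemisphere d, ℝ)}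
    (hf : f ∈ harmonicSpan d) : polyRestrict d (X i.castSucc) * f ∈ harmonicSpan d := by
  induction hf using Submodule.iSup_induction' with
  | mem k f hf =>
    obtain ⟨p, hp, rfl⟩ := hf
    have h1 := polyRestrict_mem_harmonicSpan (X_mul_sub_mem_dirichletHarmonics hp i)
    have h2 := polyRestrict_mem_harmonicSpan (pderiv_mem_dirichletHarmonics hp i)
    have h3 := add_mem h1 (Submodule.smul_mem _ (1 / ((d : ℝ) + 2 * k + 1)) h2)
    convert h3 using 1
    rw [map_sub, map_mul, map_mul, polyRestrict_normSqPoly, ← smul_eq_C_mul, map_smul, one_mul,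
      sub_add_cancel]
    rfl
  | zero => rw [mul_zero]; exact zero_mem _
  | add f g _ _ hf hg => rw [mul_add]; exact add_mem hf hg

theorem X_last_mul_rename_mem_harmonicSpan (q : MvPolynomial (Fin d) ℝ) :
    polyRestrict d (X (Fin.last d) * rename Fin.castSucc q) ∈ harmonicSpan d := by
  induction q using MvPolynomial.induction_on with
  | C a =>
    have h : X (Fin.last d) ∈ dirichletHarmonics d 1 :=
      mem_dirichletHarmonics.mpr ⟨isHomogeneous_X _ _, polyLaplacian_X _, dvd_rfl⟩
    rw [rename_C, mul_comm, ← smul_eq_C_mul, map_smul]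
    exact Submodule.smul_mem _ _ (polyRestrict_mem_harmonicSpan h)
  | add p q hp hq => rw [map_add, mul_add, map_add]; exact add_mem hp hq
  | mul_X p i hp =>
    rw [map_mul (rename Fin.castSucc), rename_X, ← mul_assoc, mul_comm, map_mul]
    exact X_mul_mem_harmonicSpan i hp

/-- The polynomials in all coordinates but the last one. They separate the points of the
hemisphere. -/
noncomputable def horizontalPolys (d : ℕ) : Subalgebra ℝ C(closedHemisphere d, ℝ) :=
  ((polyRestrict d).comp (rename Fin.castSucc)).range

theorem separatesPoints_horizontalPolys : (horizontalPolys d).SeparatesPoints := by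
  intro x y hxy
  by_contra! h
  have hi : ∀ i : Fin d, x.1 i.castSucc = y.1 i.castSucc := by
    intro i
    have h1 := h (polyRestrict d (X i.castSucc))
      ⟨_, ⟨X i, rfl⟩, by simp⟩
    simpa [polyRestrict_apply] using h1
  have hx := EuclideanSpace.real_norm_sq_eq x.1
  have hy := EuclideanSpace.real_norm_sq_eq y.1
  rw [x.2.1, Fin.sum_univ_castSucc] at hx
  rw [y.2.1, Fin.sum_univ_castSucc] at hy
  simp only [hi] at hx
  have hlast : x.1 (Fin.last d) = y.1 (Fin.last d) :=
    (sq_eq_sq₀ x.2.2 y.2.2).mp (by linarith)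
  refine hxy (Subtype.ext (PiLp.ext fun i ↦ ?_))
  induction i using Fin.lastCases with
  | last => exact hlast
  | cast i => exact hi i

/-- Completeness. The harmonic span contains the products of the last coordinate `t` with all
horizontal polynomials, which are dense by the Stone–Weierstrass theorem. Hence a function `u` that
is orthogonal to the harmonic polynomials is orthogonal to `t * u`, and `t * u ^ 2 ≥ 0` vanishes. -/
theorem eq_zero_of_orthogonal_harmonics {u : C(closedHemisphere d, ℝ)}
    (h0 : ∀ x : closedHemisphere d, x.1 (Fin.last d) = 0 → u x = 0)
    (h : ∀ k, ∀ p ∈ dirichletHarmonics d (k + 1), sphericalMean d (u * polyRestrict d p) = 0) :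
    u = 0 := by
  have hspan : ∀ f ∈ harmonicSpan d, sphericalMean d (u * f) = 0 := by
    intro f hf
    induction hf using Submodule.iSup_induction' with
    | mem k f hf => obtain ⟨p, hp, rfl⟩ := hf; exact h k p hp
    | zero => simp
    | add f g _ _ hf hg => rw [mul_add, map_add, hf, hg, add_zero]
  set t := polyRestrict d (X (Fin.last d)) with ht
  have htx : ∀ x : closedHemisphere d, t x = x.1 (Fin.last d) := by
    intro x; rw [ht, polyRestrict_apply, eval_X]
  have hclosed : IsClosed {f : C(closedHemisphere d, ℝ) | sphericalMean d (u * (t * f)) = 0} :=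
    isClosed_eq (by fun_prop) continuous_const
  have hsub : (horizontalPolys d : Set C(closedHemisphere d, ℝ)) ⊆
      {f | sphericalMean d (u * (t * f)) = 0} := by
    rintro _ ⟨q, rfl⟩
    have := hspan _ (X_last_mul_rename_mem_harmonicSpan q)
    rwa [map_mul (polyRestrict d)] at this
  have hu : u ∈ closure (horizontalPolys d : Set C(closedHemisphere d, ℝ)) := by
    rw [← Subalgebra.topologicalClosure_coe,
      ContinuousMap.subalgebra_topologicalClosure_eq_top_of_separatesPoints _
        separatesPoints_horizontalPolys]
    trivial
  have hmean : sphericalMean d (u * (t * u)) = 0 := closure_minimal hsub hclosed hu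
  have hnn : ∀ x, 0 ≤ (u * (t * u)) x := by
    intro x
    have h1 : (u * (t * u)) x = x.1 (Fin.last d) * (u x * u x) := by
      simp only [ContinuousMap.mul_apply, htx]; ring
    rw [h1]
    exact mul_nonneg x.2.2 (mul_self_nonneg _)
  ext x
  rcases x.2.2.eq_or_lt with hx | hx
  · exact h0 x hx.symm
  · have h2 := eq_zero_of_sphericalMean_eq_zero hnn hmean x hx
    simp only [ContinuousMap.mul_apply, htx] at h2
    simpa [hx.ne'] using h2

end Completeness

/-! ### The spectrum -/

section Spectrum

theorem sphericalMean_mul_eq_zero {d : ℕ} {u v : C(closedHemisphere d, ℝ)} {l l' : ℝ}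
    (hu : ⇑u ∈ dirichletEigenspace d l) (hv : ⇑v ∈ dirichletEigenspace d l') (hl : l ≠ l') :
    sphericalMean d (u * v) = 0 := by
  rw [sphericalMean_apply, ContinuousMap.coe_mul]
  exact integral_meanDensity_mul_eq_zero hu hv hl

theorem polyRestrict_mem_dirichletEigenspace_succ {c k : ℕ}
    {p : MvPolynomial (Fin (c + 1 + 1)) ℝ} (hp : p ∈ dirichletHarmonics (c + 1) (k + 1)) :
    ⇑(polyRestrict (c + 1) p) ∈
      dirichletEigenspace (c + 1) (((k + 1) * (k + 1 + c) : ℕ) : ℝ) := by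
  convert polyRestrict_mem_dirichletEigenspace hp using 2
  push_cast
  ring

theorem dirichletEigenspace_eq_bot (c : ℕ) {l : ℝ}
    (hl : ∀ k : ℕ, l ≠ (((k + 1) * (k + 1 + c) : ℕ) : ℝ)) :
    dirichletEigenspace (c + 1) l = ⊥ := by
  refine (Submodule.eq_bot_iff _).mpr fun u hu ↦ ?_
  have h := eq_zero_of_orthogonal_harmonics (u := ⟨u, hu.1.continuous⟩) hu.2.1 fun k p hp ↦
    sphericalMean_mul_eq_zero hu (polyRestrict_mem_dirichletEigenspace_succ hp) (hl k)
  exact congrArg DFunLike.coe h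

theorem injective_eigenvalue (c : ℕ) :
    Function.Injective fun k : ℕ ↦ (((k + 1) * (k + 1 + c) : ℕ) : ℝ) := by
  have h : StrictMono fun k : ℕ ↦ (((k + 1) * (k + 1 + c) : ℕ) : ℝ) := by
    intro a b hab
    have : (a + 1) * (a + 1 + c) < (b + 1) * (b + 1 + c) :=
      Nat.mul_lt_mul'' (by omega) (by omega)
    simpa using (Nat.cast_lt (α := ℝ)).mpr this
  exact h.injective

/-- Restriction of harmonic polynomials to the hemisphere, as a linear map into functions. -/
noncomputable def harmonicRestrict (d k : ℕ) :
    dirichletHarmonics d k →ₗ[ℝ] (closedHemisphere d → ℝ) where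
  toFun p := polyRestrict d p
  map_add' p q := by simp
  map_smul' a p := by simp

theorem injective_harmonicRestrict (d k : ℕ) : Function.Injective (harmonicRestrict d k) := by
  refine (injective_iff_map_eq_zero _).mpr fun p hp ↦ Subtype.ext ?_
  refine eq_zero_of_polyRestrict_eq_zero (mem_dirichletHarmonics.mp p.2).1 ?_
  exact DFunLike.coe_injective hp

/-- Every continuous function agrees with a unique harmonic polynomial of degree `k` in its
inner products with the harmonic polynomials of degree `k`. -/
theorem exists_harmonic_sphericalMean_eq {d k : ℕ} (u : C(closedHemisphere d, ℝ)) :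
    ∃ p ∈ dirichletHarmonics d k, ∀ q ∈ dirichletHarmonics d k,
      sphericalMean d ((u - polyRestrict d p) * polyRestrict d q) = 0 := by
  let ι : dirichletHarmonics d k →ₗ[ℝ] C(closedHemisphere d, ℝ) :=
    (polyRestrict d).toLinearMap ∘ₗ (dirichletHarmonics d k).subtype
  let B : C(closedHemisphere d, ℝ) →ₗ[ℝ] Module.Dual ℝ (dirichletHarmonics d k) :=
    ((LinearMap.mul ℝ C(closedHemisphere d, ℝ)).compr₂ (sphericalMean d).toLinearMap).compl₂ ι
  have hB : ∀ f q, B f q = sphericalMean d (f * polyRestrict d q.1) := fun f q ↦ rfl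
  have hinj : Function.Injective (B ∘ₗ ι) := by
    refine (injective_iff_map_eq_zero _).mpr fun p hp ↦ Subtype.ext ?_
    obtain ⟨hh, -, r, hr⟩ := mem_dirichletHarmonics.mp p.2
    refine eq_zero_of_polyRestrict_eq_zero hh ?_
    have h1 : sphericalMean d (polyRestrict d p.1 * polyRestrict d p.1) = 0 :=
      LinearMap.congr_fun hp p
    ext x
    rcases x.2.2.eq_or_lt with hx | hx
    · rw [polyRestrict_apply, hr, map_mul, eval_X, ← hx, zero_mul]; rfl
    · have h2 := eq_zero_of_sphericalMean_eq_zero (fun x ↦ mul_self_nonneg _) h1 x hx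
      exact mul_self_eq_zero.mp h2
  obtain ⟨p, hp⟩ := (LinearMap.injective_iff_surjective_of_finrank_eq_finrank
    (Subspace.dual_finrank_eq (K := ℝ) (V := dirichletHarmonics d k)).symm).mp hinj (B u)
  refine ⟨p, p.2, fun q hq ↦ ?_⟩
  have h3 : sphericalMean d (polyRestrict d p * polyRestrict d q) =
      sphericalMean d (u * polyRestrict d q) := LinearMap.congr_fun hp ⟨q, hq⟩
  rw [sub_mul, map_sub, h3, sub_self]

/-- Every Dirichlet eigenfunction is the restriction of a harmonic polynomial: its difference
from its orthogonal projection to the harmonic polynomials of the same eigenvalue is orthogonal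
to the harmonic polynomials of all degrees. -/
theorem range_harmonicRestrict (c k : ℕ) :
    LinearMap.range (harmonicRestrict (c + 1) (k + 1)) =
      dirichletEigenspace (c + 1) (((k + 1) * (k + 1 + c) : ℕ) : ℝ) := by
  refine le_antisymm ?_ fun u hu ↦ ?_
  · rintro _ ⟨p, rfl⟩
    exact polyRestrict_mem_dirichletEigenspace_succ p.2
  · obtain ⟨p, hp, horth⟩ :=
      exists_harmonic_sphericalMean_eq (k := k + 1) (⟨u, hu.1.continuous⟩ :
        C(closedHemisphere (c + 1), ℝ))
    set w : C(closedHemisphere (c + 1), ℝ) := ⟨u, hu.1.continuous⟩ - polyRestrict (c + 1) p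
      with hw
    have hwE : ⇑w ∈ dirichletEigenspace (c + 1) (((k + 1) * (k + 1 + c) : ℕ) : ℝ) :=
      sub_mem hu (polyRestrict_mem_dirichletEigenspace_succ hp)
    have hw0 : w = 0 := by
      refine eq_zero_of_orthogonal_harmonics hwE.2.1 fun j q hq ↦ ?_
      by_cases hj : k = j
      · subst hj; exact horth q hq
      · exact sphericalMean_mul_eq_zero hwE (polyRestrict_mem_dirichletEigenspace_succ hq)
          ((injective_eigenvalue c).ne hj)
    exact ⟨⟨p, hp⟩, (congrArg DFunLike.coe (sub_eq_zero.mp hw0)).symm⟩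

theorem finrank_dirichletEigenspace (c k : ℕ) :
    Module.finrank ℝ (dirichletEigenspace (c + 1) (((k + 1) * (k + 1 + c) : ℕ) : ℝ)) =
      (k + c).choose c := by
  rw [← range_harmonicRestrict, LinearMap.finrank_range_of_inj (injective_harmonicRestrict _ _),
    finrank_dirichletHarmonics]

theorem finiteDimensional_dirichletEigenspace (c : ℕ) (l : ℝ) :
    FiniteDimensional ℝ (dirichletEigenspace (c + 1) l) := by
  by_cases hl : ∃ k : ℕ, l = (((k + 1) * (k + 1 + c) : ℕ) : ℝ)
  · obtain ⟨k, rfl⟩ := hl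
    rw [← range_harmonicRestrict]
    infer_instance
  · rw [dirichletEigenspace_eq_bot c fun k hk ↦ hl ⟨k, hk⟩]
    infer_instance

end Spectrum

end Hemisphere

namespace Hemisphere
open Filter Topology Finset Polynomial

/-! ### The spectral zeta function -/

/-- The sum over all real `l` reduces to the eigenvalues `(k + 1) (k + 1 + c)` with
multiplicities `(k + c choose c)`. -/
theorem exists_isSpectralZeta (c : ℕ) :
    ∃ Z : ℂ → ℂ, IsSpectralZeta (c + 1) Z ∧
      deriv Z 0 = 1 / (c.factorial : ℂ) * ∑ k ∈ range (c + 1), deriv riemannZeta (-(k : ℂ)) *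
          ((stirlingS (c + 1) (k + 1) : ℂ) + (-1) ^ (c + k) * (stirlingS c k : ℂ)) +
        ∑ m ∈ range (c + 1), (taylor (-((c : ℂ) / 2)) (multPoly c)).coeff m *
          centeredWeight ((c : ℂ) / 2) m := by
  obtain ⟨Z, hZm, hZ0, hZs, hZd⟩ := exists_zeta_of_multiplicity c
  refine ⟨Z, ⟨finiteDimensional_dirichletEigenspace c, ⟨(c : ℝ) + 2, fun s hs ↦ ?_⟩, hZm, hZ0⟩, hZd⟩
  refine ((injective_eigenvalue c).hasSum_iff ?_).mp ?_
  · intro l hl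
    have h1 : dirichletEigenspace (c + 1) l = ⊥ :=
      dirichletEigenspace_eq_bot c fun k hk ↦ hl ⟨k, hk.symm⟩
    rw [h1, finrank_bot]
    simp
  · suffices e : (fun k : ℕ ↦ ((k + c).choose c : ℂ) * (((k + 1) * (k + 1 + c) : ℕ) : ℂ) ^ (-s)) =
        (fun l : ℝ ↦ (Module.finrank ℝ (dirichletEigenspace (c + 1) l) : ℂ) * (l : ℂ) ^ (-s)) ∘
          fun k : ℕ ↦ (((k + 1) * (k + 1 + c) : ℕ) : ℝ) by
      rw [← e]; exact hZs s hs.le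
    funext k
    rw [Function.comp_apply, finrank_dirichletEigenspace, Complex.ofReal_natCast]

/-- The derivative at the origin does not depend on the choice of continuation. -/
theorem IsSpectralZeta.deriv_eq {d : ℕ} {Z₁ Z₂ : ℂ → ℂ} (h₁ : IsSpectralZeta d Z₁)
    (h₂ : IsSpectralZeta d Z₂) : deriv Z₁ 0 = deriv Z₂ 0 := by
  obtain ⟨μ₁, hs₁⟩ := h₁.hasSum
  obtain ⟨μ₂, hs₂⟩ := h₂.hasSum
  refine (eventuallyEq_of_eq_on_halfPlane h₁.meromorphic h₂.meromorphic h₁.analyticAt_zero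
    h₂.analyticAt_zero (μ := max μ₁ μ₂) fun s hs ↦ ?_).deriv_eq
  exact (hs₁ s ((le_max_left _ _).trans_lt hs)).unique (hs₂ s ((le_max_right _ _).trans_lt hs))

theorem isSpectralZeta_spectralZeta (c : ℕ) :
    IsSpectralZeta (c + 1) (spectralZeta (c + 1)) := by
  have h : ∃ Z, IsSpectralZeta (c + 1) Z := (exists_isSpectralZeta c).imp fun _ hZ ↦ hZ.1
  rw [spectralZeta, dif_pos h]
  exact h.choose_spec

theorem deriv_spectralZeta (c : ℕ) :
    deriv (spectralZeta (c + 1)) 0 =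
      1 / (c.factorial : ℂ) * ∑ k ∈ range (c + 1), deriv riemannZeta (-(k : ℂ)) *
          ((stirlingS (c + 1) (k + 1) : ℂ) + (-1) ^ (c + k) * (stirlingS c k : ℂ)) +
        ∑ m ∈ range (c + 1), (taylor (-((c : ℂ) / 2)) (multPoly c)).coeff m *
          centeredWeight ((c : ℂ) / 2) m := by
  obtain ⟨Z, hZ, hd⟩ := exists_isSpectralZeta c
  rw [← hd]
  exact (isSpectralZeta_spectralZeta c).deriv_eq hZ

/-- When `ζ'(0)` is real, the principal logarithm inverts the exponential in the determinant. -/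
theorem neg_log_spectralDet {d : ℕ} (h : (deriv (spectralZeta d) 0).im = 0) :
    -Complex.log (spectralDet d) = deriv (spectralZeta d) 0 := by
  rw [spectralDet, Complex.log_exp, neg_neg]
  · rw [Complex.neg_im, h]; simpa using Real.pi_pos
  · rw [Complex.neg_im, h]; simpa using Real.pi_pos.le

theorem stirlingS_eq_zero {n k : ℕ} (h : n < k) : stirlingS n k = 0 :=
  coeff_eq_zero_of_natDegree_lt (by rwa [descPochhammer_natDegree])

theorem mem_reals_of_im {z : ℂ} (h : z.im = 0) : z ∈ Complex.ofRealHom.fieldRange :=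
  ⟨z.re, Complex.ext rfl (by simp [h])⟩

theorem im_of_mem_reals {z : ℂ} (h : z ∈ Complex.ofRealHom.fieldRange) : z.im = 0 := by
  obtain ⟨x, rfl⟩ := h
  simp

end Hemisphere

open Hemisphere in
theorem mainTheorem3 (n : ℕ) (hn : 1 ≤ n) :
    (Hemisphere.IsSpectralZeta (2 * n - 1) (Hemisphere.spectralZeta (2 * n - 1)) ∧
      -Complex.log (Hemisphere.spectralDet (2 * n - 1)) =
        deriv (Hemisphere.spectralZeta (2 * n - 1)) 0 ∧
      deriv (Hemisphere.spectralZeta (2 * n - 1)) 0 =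
        1 / ((2 * n - 2).factorial : ℂ) *
            ∑ k ∈ Finset.range (2 * n), deriv riemannZeta (-(k : ℂ)) *
              ((Hemisphere.stirlingS (2 * n - 1) (k + 1) : ℂ)
                + (-1) ^ k * (Hemisphere.stirlingS (2 * n - 2) k : ℂ))
          - ∑ i ∈ Finset.Icc 1 (n - 1), (Hemisphere.uBar (n - 1) i : ℂ) *
              (((n : ℂ) - 1) ^ (2 * i + 1) / (2 * (i : ℂ))) *
              ((harmonic (i - 1) : ℂ) / 2 - (harmonic (2 * i - 1) : ℂ))) ∧
    (Hemisphere.IsSpectralZeta (2 * n) (Hemisphere.spectralZeta (2 * n)) ∧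
      -Complex.log (Hemisphere.spectralDet (2 * n)) =
        deriv (Hemisphere.spectralZeta (2 * n)) 0 ∧
      deriv (Hemisphere.spectralZeta (2 * n)) 0 =
        1 / ((2 * n - 1).factorial : ℂ) *
            ∑ k ∈ Finset.range (2 * n), deriv riemannZeta (-(k : ℂ)) *
              ((Hemisphere.stirlingS (2 * n) (k + 1) : ℂ)
                + (-1) ^ (k + 1) * (Hemisphere.stirlingS (2 * n - 1) k : ℂ))
          + ∑ i ∈ Finset.Icc 1 n, (Hemisphere.vBar n i : ℂ) *
              ((2 * (n : ℂ) - 1) ^ (2 * i) / (4 * (i : ℂ))) *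
              ((harmonic (i - 1) : ℂ) / 2 - (harmonic (2 * i - 1) : ℂ))) := by
  have hζ : ∀ k : ℕ, deriv riemannZeta (-(k : ℂ)) ∈ Complex.ofRealHom.fieldRange := fun k ↦
    mem_reals_of_im (deriv_riemannZeta_im k)
  have hq : ∀ q : ℚ, (q : ℂ) ∈ Complex.ofRealHom.fieldRange := fun q ↦ ⟨q, by simp⟩
  have h1 : 2 * n - 2 + 1 = 2 * n - 1 := by omega
  have h2 : 2 * n - 1 + 1 = 2 * n := by omega
  have e1 := deriv_spectralZeta (2 * n - 2)
  rw [poleTerm_odd_dim hn, h1, ← sub_eq_add_neg] at e1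
  have e2 := deriv_spectralZeta (2 * n - 1)
  rw [poleTerm_even_dim hn, h2] at e2
  have f1 : ∑ k ∈ Finset.range (2 * n - 1), deriv riemannZeta (-(k : ℂ)) *
        ((stirlingS (2 * n - 1) (k + 1) : ℂ) +
          (-1) ^ (2 * n - 2 + k) * (stirlingS (2 * n - 2) k : ℂ)) =
      ∑ k ∈ Finset.range (2 * n), deriv riemannZeta (-(k : ℂ)) *
      ((stirlingS (2 * n - 1) (k + 1) : ℂ) + (-1) ^ k * (stirlingS (2 * n - 2) k : ℂ)) := by
    rw [show Finset.range (2 * n) = Finset.range (2 * n - 1 + 1) by rw [h2], Finset.sum_range_succ,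
      stirlingS_eq_zero (show 2 * n - 1 < 2 * n - 1 + 1 by omega),
      stirlingS_eq_zero (show 2 * n - 2 < 2 * n - 1 by omega)]
    simp only [Int.cast_zero, mul_zero, add_zero]
    refine Finset.sum_congr rfl fun k _ ↦ ?_
    rw [pow_add, show 2 * n - 2 = 2 * (n - 1) by omega, pow_mul]
    norm_num
  have f2 : ∑ k ∈ Finset.range (2 * n), deriv riemannZeta (-(k : ℂ)) *
      ((stirlingS (2 * n) (k + 1) : ℂ) + (-1) ^ (2 * n - 1 + k) * (stirlingS (2 * n - 1) k : ℂ)) =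
      ∑ k ∈ Finset.range (2 * n), deriv riemannZeta (-(k : ℂ)) *
      ((stirlingS (2 * n) (k + 1) : ℂ) + (-1) ^ (k + 1) * (stirlingS (2 * n - 1) k : ℂ)) := by
    refine Finset.sum_congr rfl fun k _ ↦ ?_
    rw [show 2 * n - 1 + k = 2 * (n - 1) + (k + 1) by omega, pow_add, pow_mul]
    norm_num
  rw [f1] at e1
  rw [f2] at e2
  refine ⟨⟨?_, neg_log_spectralDet (im_of_mem_reals ?_), e1⟩,
    ⟨?_, neg_log_spectralDet (im_of_mem_reals ?_), e2⟩⟩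
  · simpa only [h1] using isSpectralZeta_spectralZeta (2 * n - 2)
  -- Every term of the formula is real, so the principal logarithm has no ambiguity.
  · rw [e1]
    refine sub_mem (mul_mem ?_ (sum_mem fun k _ ↦ mul_mem (hζ k) ?_)) (sum_mem fun i _ ↦ ?_)
    · exact div_mem (one_mem _) (natCast_mem _ _)
    · exact add_mem (intCast_mem _ _) (mul_mem (pow_mem (neg_mem (one_mem _)) _) (intCast_mem _ _))
    · exact mul_mem (mul_mem (hq _) (div_mem
        (pow_mem (sub_mem (natCast_mem _ _) (one_mem _)) _)
        (mul_mem (ofNat_mem _ _) (natCast_mem _ _))))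
        (sub_mem (div_mem (hq _) (ofNat_mem _ _)) (hq _))
  · simpa only [h2] using isSpectralZeta_spectralZeta (2 * n - 1)
  · rw [e2]
    refine add_mem (mul_mem ?_ (sum_mem fun k _ ↦ mul_mem (hζ k) ?_)) (sum_mem fun i _ ↦ ?_)
    · exact div_mem (one_mem _) (natCast_mem _ _)
    · exact add_mem (intCast_mem _ _) (mul_mem (pow_mem (neg_mem (one_mem _)) _) (intCast_mem _ _))
    · exact mul_mem (mul_mem (hq _) (div_mem
        (pow_mem (sub_mem (mul_mem (ofNat_mem _ _) (natCast_mem _ _)) (one_mem _)) _)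
        (mul_mem (ofNat_mem _ _) (natCast_mem _ _))))
        (sub_mem (div_mem (hq _) (ofNat_mem _ _)) (hq _))
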